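/- Let $\theta_{(n)}=(\theta_1,\dots,\theta_n)$ and $X_1,\dots,X_n$ be real random variables on a probability space such that, conditionally on $\theta_{(n)}$, the $X_k$ are independent with $X_k\sim N(\theta_k,1)$. Let $G_n=\frac1n\sum_{k=1}^n \mathcal L(\theta_k)$ be the average of the laws of the $\theta_k$. For a probability distribution $G$ on $\mathbb R$ put $\varphi_G(x)=\int\varphi(x-u)\,dG(u)$, with $\varphi(x)=e^{-x^2/2}/\sqrt{2\pi}$, and $$R^*(G)=\inf_{t}\int E\big(t(\theta+Z)-\theta\big)^2\,dG(\theta),\qquad Z\sim N(0,1),$$ where the infimum is over all Borel functions $t:\mathbb R\to\mathbb R$. For $\rho>0$ define the general empirical Bayes (GEB) estimator by $$\hat\theta_k=\hat t_{n,\rho}(X_k),\qquad \hat t_{n,\rho}(x)=x+\frac{\hat\varphi_n'(x)}{\max(\hat\varphi_n(x),\rho)},\qquad \hat\varphi_n(x)=\frac1n\sum_{k=1}^n a_nK\big(a_n(x-X_k)\big),$$ with $a_n=\sqrt{2\log n}$ and $K(x)=\sin(x)/(\pi x)$, $K(0)=1/\pi$. **Theorem 6.1.** There is a function $\eta(n,\rho)$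 of $(n,\rho)$ only such that $\eta(n,\rho_n)\to0$ for every sequence $\rho_n\to0+$ with $\rho_n^{-1}(\log n)^{1/4}/\sqrt n\to0$, and such that for all $n\ge1$, all $\rho$ with $1/n\le\rho<1/\sqrt{2\pi}$, and all $(\theta_k,X_k)_{k\le n}$ as above with $\theta_1,\dots,\theta_n$ independent, each $(\hat\theta_k-\theta_k)^2$ is integrable and $$\frac1n\sum_{k=1}^nE(\hat\theta_k-\theta_k)^2-R^*(G_n)\le\Delta(\rho,G_n)+\{1+\eta(n,\rho)\}\,\Delta^*(n,\rho),$$ where $$\Delta(\rho,G)=\int_{-\infty}^\infty\Big(\frac{\varphi_G'}{\varphi_G}\Big)^2\Big(1-\frac{\varphi_G}{\max(\varphi_G,\rho)}\Big)^2\varphi_G\,dx,$$ $$\Delta^*(n,\rho)=\Big\{\sqrt{\tfrac23\log n}+\sqrt{-\log(\rho^2)}\Big\}^2\frac{\sqrt{2\log n}}{\pi\rho n}.$$ -/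

import Mathlib

open MeasureTheory ProbabilityTheory Filter Topology
open scoped ENNReal

namespace EBMeans

noncomputable section

/-- The model: real random variables `θ_k`, `X_k` (`k < n`) such that, conditionally on the vector
`θ = (θ_k)`, the `X_k` are independent with `X_k ∼ N(θ_k, 1)`. -/
structure IsNormalMeansModel {Ω : Type*} [MeasurableSpace Ω] {n : ℕ}
    (θ X : Fin n → Ω → ℝ) (P : Measure Ω) [IsFiniteMeasure P] : Prop where
  measurable_mean : ∀ k, Measurable (θ k)
  measurable_obs : ∀ k, Measurable (X k)
  condLaw : ∀ᵐ t ∂(P.map fun ω k => θ k ω),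
    condDistrib (fun ω k => X k ω) (fun ω k => θ k ω) P t
      = Measure.pi fun k => gaussianReal (t k) 1

/-- `G_n`, the average of the marginal distributions of `θ_1, …, θ_n`, as a measure on `ℝ`. -/
def mixture {Ω : Type*} [MeasurableSpace Ω] {n : ℕ} (θ : Fin n → Ω → ℝ) (P : Measure Ω) :
    Measure ℝ :=
  (n : ℝ≥0∞)⁻¹ • ∑ k, P.map (θ k)

/-- `φ_G(x) = ∫ φ(x - u) dG(u)`, with `φ` the standard normal density. -/
def mixDensity (G : Measure ℝ) (x : ℝ) : ℝ :=
  ∫ u, gaussianPDFReal 0 1 (x - u) ∂G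

/-- The Bayes risk `R(t, G) = ∫ E_θ (t(X) - θ)² dG(θ)`, where `X ∼ N(θ, 1)` under `P_θ`. -/
def risk (t : ℝ → ℝ) (G : Measure ℝ) : ℝ≥0∞ :=
  ∫⁻ θ, ∫⁻ x, ENNReal.ofReal ((t x - θ) ^ 2) ∂(gaussianReal θ 1) ∂G

/-- The minimum Bayes risk `R*(G)`: the infimum of `R(t, G)` over Borel functions `t`. -/
def optRisk (G : Measure ℝ) : ℝ≥0∞ :=
  ⨅ (t : ℝ → ℝ) (_ : Measurable t), risk t G

/-- `R*(G) ≤ 1` for a probability measure `G`; so `R*(G)` is finite and `ENNReal.toReal` loses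
nothing. -/
theorem optRisk_le_one (G : Measure ℝ) [IsProbabilityMeasure G] : optRisk G ≤ 1 := by
  refine (iInf₂_le (fun x => x) measurable_id).trans ?_
  have h : ∀ θ : ℝ, ∫⁻ x, ENNReal.ofReal ((x - θ) ^ 2) ∂(gaussianReal θ 1) = 1 := by
    intro θ
    have h1 := ofReal_variance (μ := gaussianReal θ 1) (X := fun x : ℝ => x)
      (memLp_id_gaussianReal 2)
    rw [variance_fun_id_gaussianReal, evariance_eq_lintegral_ofReal] at h1
    simpa using h1.symm
  simp [risk, h]

/-- The kernel `K(x) = sin x / (π x)`, with `K(0) = 1/π`. -/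
def sincKernel (x : ℝ) : ℝ := Real.sinc x / Real.pi

/-- The reciprocal bandwidth `a_n = √(2 log n)`. -/
def bandwidth (n : ℕ) : ℝ := √(2 * Real.log n)

/-- The kernel density estimate `φ̂_n(x) = n⁻¹ ∑_k a_n K(a_n (x - X_k))` from a sample
`X_1, …, X_n`. -/
def kernelEst {n : ℕ} (X : Fin n → ℝ) (x : ℝ) : ℝ :=
  (1 / (n : ℝ)) * ∑ k, bandwidth n * sincKernel (bandwidth n * (x - X k))

/-- The general empirical Bayes rule `t̂_{n,ρ}(x) = x + φ̂_n'(x) / max(φ̂_n(x), ρ)`. -/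
def gebRule {n : ℕ} (ρ : ℝ) (X : Fin n → ℝ) (x : ℝ) : ℝ :=
  x + deriv (kernelEst X) x / max (kernelEst X x) ρ

/-- `Δ(ρ, G) = ∫ (φ_G'/φ_G)² (1 - φ_G/(φ_G ∨ ρ))² φ_G dx`. -/
def Delta (ρ : ℝ) (G : Measure ℝ) : ℝ :=
  ∫ x, (deriv (mixDensity G) x / mixDensity G x) ^ 2
    * (1 - mixDensity G x / max (mixDensity G x) ρ) ^ 2 * mixDensity G x

/-- `Δ*(n, ρ) = (√((2/3) log n) + √(-log ρ²))² √(2 log n) / (π ρ n)`. -/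
def DeltaStar (n : ℕ) (ρ : ℝ) : ℝ :=
  (√((2 / 3) * Real.log n) + √(-Real.log (ρ ^ 2))) ^ 2
    * (√(2 * Real.log n) / (Real.pi * ρ * n))

end

end EBMeans

/-! Let `f` be the density of the mixture convolved with N(0,1) and write the estimator as `X_k +
ψ(X_k)`, where `ψ = φ̂'/max(φ̂, ρ)`. The kernel contributes the constant `K(0)` and slope `0` at its
own centre, so at `X_k` the score `ψ` is a function of the other observations only (`looScore`,
`gebRule_self`). Conditioning on those and expanding the square gives the risk of coordinate `k` as
`1 + ∫ (E ψ_k² f_k - 2 E ψ_k f_k') dx`, with `f_k` the density of `X_k` (`risk_gebRule`). If `ψ_k`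
is replaced by the full-sample score, which is the same for all `k`, the average over `k` becomes `1
+ ∫ (E ψ² f - 2 E ψ f') dx`. Since `R* ≥ 1 - ∫ f'²/f` (`one_sub_fisher_le_optRisk`), the regret is
then at most `∫ E (ψ - f'/f)² f dx`.

Put `e = φ̂' - f'`, `δ = φ̂ - f` and `L = √(-log ρ²)`. The bound `|f'| ≤ L max(f, ρ)`
(`abs_mixDeriv_le`) and a case analysis (`regularized_score_sq_sub_le`) show that, beyond the
integrand of `Δ(ρ, G)`, the squared error is at most `(|e| + L|δ|)²/ρ · (1 + |δ|/ρ)` plus a term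
linear in `e` with a deterministic coefficient. The linear term only sees the bias of `φ̂'`.

The sinc kernel is the inverse Fourier transform of the indicator of `[-a, a]`. Plancherel gives its
squared L² norm `a/π`, and `a³/(3π)` for its derivative: divided by `n`, these bound the integrated
variances of `φ̂` and `φ̂'`. The bias is the Gaussian frequency tail beyond `a`, at most `e^{-a²/2}
= 1/n`. Splitting `(|e| + L|δ|)²` with the optimal weight produces exactly `(a/√3 + L)² a/(πρn) =
Δ*`. All other terms (the factor `|δ|/ρ`, handled by fourth moments; the bias; the passage from
leave-one-out to full-sample scores) are smaller by factors controlled by `1/a`, `κ` and `κ³`, where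
`κ = √(a/n)/ρ`; `error_terms_le` collects them. -/

namespace EBMeans

/-! ### Plancherel's inequality for Fourier integrals -/

open Real in
lemma lintegral_gaussian_kernel {v : ℝ} (hv : 0 < v) :
    ∫⁻ r : ℝ, ENNReal.ofReal (rexp (-v * r ^ 2 / 2)) = ENNReal.ofReal (√(2 * π / v)) := by
  have h := integral_gaussian (v / 2)
  have hi := integrable_exp_neg_mul_sq (b := v / 2) (by positivity)
  have e : ∀ r : ℝ, rexp (-v * r ^ 2 / 2) = rexp (-(v / 2) * r ^ 2) := by
    intro r; congr 1; ring
  simp_rw [e]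
  rw [← ofReal_integral_eq_lintegral_ofReal hi (ae_of_all _ fun x => (exp_pos _).le), h]
  congr 2
  field_simp

/-- Second moment of a Fourier integral under a centred Gaussian weight. -/
lemma integral_norm_sq_fourier_gaussianReal (c : ℝ → ℂ) (hc : Integrable c) (v : NNReal) :
    ((∫ x : ℝ, ‖∫ t : ℝ, c t * Complex.exp (t * x * Complex.I)‖ ^ 2 ∂(gaussianReal 0 v) : ℝ) : ℂ)
      = ∫ p : ℝ × ℝ, c p.1 * starRingEnd ℂ (c p.2)
          * Complex.exp (-(v * (p.1 - p.2) ^ 2 / 2)) := by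
  have h1 : ∀ x : ℝ, ((‖∫ t : ℝ, c t * Complex.exp (t * x * Complex.I)‖ ^ 2 : ℝ) : ℂ)
      = ∫ p : ℝ × ℝ, (c p.1 * starRingEnd ℂ (c p.2))
          * Complex.exp ((p.1 - p.2) * x * Complex.I) := by
    intro x
    rw [Complex.ofReal_pow, ← Complex.mul_conj', ← integral_conj, ← integral_prod_mul]
    rw [Measure.volume_eq_prod]
    congr 1
    ext p
    rw [map_mul, ← Complex.exp_conj]
    simp only [map_mul, Complex.conj_ofReal, Complex.conj_I]
    rw [mul_mul_mul_comm, ← Complex.exp_add]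
    congr 2
    ring
  rw [← integral_complex_ofReal]
  simp_rw [h1]
  rw [integral_integral_swap]
  · congr 1
    ext p
    rw [integral_const_mul]
    congr 1
    have := charFun_gaussianReal (μ := 0) (v := v) (p.1 - p.2)
    rw [charFun_apply_real] at this
    simp only [Complex.ofReal_sub] at this
    rw [this]
    congr 1
    push_cast
    ring
  · have hp : Integrable (fun p : ℝ × ℝ => c p.1 * starRingEnd ℂ (c p.2)) := by
      have hc' : Integrable (fun t => starRingEnd ℂ (c t)) :=
        (integrable_norm_iff (by fun_prop)).1 (by simpa using hc.norm)
      exact hc.mul_prod hc'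
    have h2 := (integrable_const (μ := gaussianReal 0 v) (1 : ℂ)).mul_prod hp
    refine (h2.norm).mono' ?_ (ae_of_all _ ?_)
    · refine AEStronglyMeasurable.mul ?_ ?_
      · simpa using h2.aestronglyMeasurable
      · fun_prop
    · rintro ⟨x, s, t⟩
      simp only [Function.uncurry, norm_mul, one_mul]
      have : ‖Complex.exp ((↑s - ↑t) * ↑x * Complex.I)‖ = 1 := by
        have := Complex.norm_exp_ofReal_mul_I ((s - t) * x)
        push_cast at this
        exact this
      rw [this]; simp

-- A Schur test: `|c s| |c t| ≤ (|c s|² + |c t|²)/2`, and the kernel `e^{-v(s-t)²/2}` has total mass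
-- `√(2π/v)` in either variable.
open Real in
lemma lintegral_norm_sq_fourier_gaussianReal_le (c : ℝ → ℂ) (hc : Integrable c)
    (hc2 : Integrable fun t => ‖c t‖ ^ 2) (v : NNReal) (hv : 0 < v) :
    ∫⁻ x : ℝ, ENNReal.ofReal (‖∫ t : ℝ, c t * Complex.exp (t * x * Complex.I)‖ ^ 2)
        ∂(gaussianReal 0 v)
      ≤ ENNReal.ofReal (√(2 * π / v)) * ENNReal.ofReal (∫ t, ‖c t‖ ^ 2) := by
  have hI : Integrable (fun x : ℝ => ‖∫ t : ℝ, c t * Complex.exp (t * x * Complex.I)‖ ^ 2)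
      (gaussianReal 0 v) := by
    refine (integrable_const ((∫ t, ‖c t‖) ^ 2)).mono' ?_ (ae_of_all _ ?_)
    · refine AEStronglyMeasurable.pow (AEStronglyMeasurable.norm ?_) 2
      refine Continuous.aestronglyMeasurable ?_
      refine continuous_of_dominated (bound := fun t => ‖c t‖) ?_ ?_ hc.norm ?_
      · intro x; exact hc.aestronglyMeasurable.mul (by fun_prop)
      · intro x; refine ae_of_all _ fun t => ?_
        have := Complex.norm_exp_ofReal_mul_I (t * x)
        push_cast at this
        rw [norm_mul, this, mul_one]
      · refine ae_of_all _ fun t => ?_; fun_prop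
    · intro x
      rw [norm_pow, norm_norm]
      gcongr
      refine (norm_integral_le_integral_norm _).trans (le_of_eq ?_)
      congr 1; ext t
      have := Complex.norm_exp_ofReal_mul_I (t * x)
      push_cast at this
      rw [norm_mul, this, mul_one]
  rw [← ofReal_integral_eq_lintegral_ofReal hI (ae_of_all _ fun x => by positivity)]
  have h := integral_norm_sq_fourier_gaussianReal c hc v
  set J := ∫ x : ℝ, ‖∫ t : ℝ, c t * Complex.exp (t * x * Complex.I)‖ ^ 2 ∂(gaussianReal 0 v)
  have hJ : 0 ≤ J := integral_nonneg fun x => by positivity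
  have e1 : ENNReal.ofReal J = ‖(J : ℂ)‖ₑ := by
    rw [← ofReal_norm, Complex.norm_real, Real.norm_of_nonneg hJ]
  rw [e1, h]
  refine (enorm_integral_le_lintegral_enorm _).trans ?_
  set g : ℝ → ℝ≥0∞ := fun r => ENNReal.ofReal (rexp (-v * r ^ 2 / 2)) with hg
  have hgm : Measurable g := by fun_prop
  have hgi : ∫⁻ r, g r = ENNReal.ofReal (√(2 * π / v)) := lintegral_gaussian_kernel (by exact_mod_cast hv)
  set q : ℝ → ℝ≥0∞ := fun t => ENNReal.ofReal (‖c t‖ ^ 2 / 2) with hq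
  have hqm : AEMeasurable q := by
    have := hc2.aestronglyMeasurable.aemeasurable
    fun_prop
  have hqi : ∫⁻ t, q t = ENNReal.ofReal ((∫ t, ‖c t‖ ^ 2) / 2) := by
    rw [← integral_div, ofReal_integral_eq_lintegral_ofReal (hc2.div_const 2)
      (ae_of_all _ fun x => by positivity)]
  calc ∫⁻ p : ℝ × ℝ, ‖c p.1 * starRingEnd ℂ (c p.2)
          * Complex.exp (-(v * (p.1 - p.2) ^ 2 / 2))‖ₑ
      ≤ ∫⁻ p : ℝ × ℝ, (q p.1 * g (p.1 - p.2) + q p.2 * g (p.1 - p.2)) := by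
        refine lintegral_mono fun p => ?_
        rw [← add_mul, enorm_mul, hq, hg]
        have e2 : ‖Complex.exp (-(v * (p.1 - p.2) ^ 2 / 2))‖ = rexp (-v * (p.1 - p.2) ^ 2 / 2) := by
          have : (-(v * ((p.1 : ℂ) - p.2) ^ 2 / 2)) = ((-v * (p.1 - p.2) ^ 2 / 2 : ℝ) : ℂ) := by
            push_cast; ring
          rw [this, ← Complex.ofReal_exp, Complex.norm_real, Real.norm_of_nonneg (exp_pos _).le]
        rw [← ofReal_norm, ← ofReal_norm, e2]
        gcongr
        rw [← ENNReal.ofReal_add (by positivity) (by positivity)]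
        apply ENNReal.ofReal_le_ofReal
        rw [norm_mul, RCLike.norm_conj]
        nlinarith [sq_nonneg (‖c p.1‖ - ‖c p.2‖)]
    _ = (∫⁻ p : ℝ × ℝ, q p.1 * g (p.1 - p.2)) + ∫⁻ p : ℝ × ℝ, q p.2 * g (p.1 - p.2) := by
        apply lintegral_add_left'
        exact (hqm.comp_fst).mul (hgm.comp (by fun_prop)).aemeasurable
    _ = ENNReal.ofReal (√(2 * π / v)) * ENNReal.ofReal ((∫ t, ‖c t‖ ^ 2) / 2)
          + ENNReal.ofReal (√(2 * π / v)) * ENNReal.ofReal ((∫ t, ‖c t‖ ^ 2) / 2) := by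
        congr 1
        · rw [Measure.volume_eq_prod, lintegral_prod]
          · simp only
            have : ∀ s : ℝ, ∫⁻ t : ℝ, q s * g (s - t) = q s * ENNReal.ofReal (√(2 * π / v)) := by
              intro s
              rw [lintegral_const_mul _ (by fun_prop), lintegral_sub_left_eq_self g s, hgi]
            simp_rw [this]
            rw [lintegral_mul_const'' _ hqm, hqi, mul_comm]
          · exact (hqm.comp_fst).mul (hgm.comp (by fun_prop)).aemeasurable
        · rw [Measure.volume_eq_prod, lintegral_prod_symm]
          · simp only
            have : ∀ s : ℝ, ∫⁻ t : ℝ, q s * g (t - s) = q s * ENNReal.ofReal (√(2 * π / v)) := by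
              intro s
              rw [lintegral_const_mul _ (by fun_prop), lintegral_sub_right_eq_self g s, hgi]
            simp_rw [this]
            rw [lintegral_mul_const'' _ hqm, hqi, mul_comm]
          · exact (hqm.comp_snd).mul (hgm.comp (by fun_prop)).aemeasurable
    _ = _ := by
        have h0 : 0 ≤ ∫ t, ‖c t‖ ^ 2 := integral_nonneg fun x => by positivity
        rw [← mul_add, ← ENNReal.ofReal_add (by positivity) (by positivity), add_halves]

open Real in
/-- Plancherel's inequality for the Fourier integral of an integrable square-integrable function. -/
lemma lintegral_norm_sq_fourier_le (c : ℝ → ℂ) (hc : Integrable c)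
    (hc2 : Integrable fun t => ‖c t‖ ^ 2) :
    ∫⁻ x : ℝ, ENNReal.ofReal (‖∫ t : ℝ, c t * Complex.exp (t * x * Complex.I)‖ ^ 2)
      ≤ ENNReal.ofReal (2 * π * ∫ t, ‖c t‖ ^ 2) := by
  set H : ℝ → ℝ≥0∞ := fun x =>
    ENNReal.ofReal (‖∫ t : ℝ, c t * Complex.exp (t * x * Complex.I)‖ ^ 2) with hH
  have hHm : Measurable H := by
    have : Continuous fun x : ℝ => ∫ t : ℝ, c t * Complex.exp (t * x * Complex.I) := by
      refine continuous_of_dominated (bound := fun t => ‖c t‖) ?_ ?_ hc.norm ?_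
      · intro x; exact hc.aestronglyMeasurable.mul (by fun_prop)
      · intro x; refine ae_of_all _ fun t => ?_
        have := Complex.norm_exp_ofReal_mul_I (t * x)
        push_cast at this
        rw [norm_mul, this, mul_one]
      · refine ae_of_all _ fun t => ?_; fun_prop
    exact (ENNReal.continuous_ofReal.comp (by fun_prop)).measurable
  -- The weight is the Gaussian density of variance `m + 1` rescaled to height one. The rescaling
  -- factor and the Schur constant multiply to `2π` for every `m`, so Fatou's lemma applies as the
  -- weight tends to one.
  have key : ∀ m : ℕ, ∫⁻ x, ENNReal.ofReal (rexp (-(x ^ 2) / (2 * (m + 1)))) * H x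
      ≤ ENNReal.ofReal (2 * π * ∫ t, ‖c t‖ ^ 2) := by
    intro m
    have hv : (0 : NNReal) < (m : NNReal) + 1 := by positivity
    have h := lintegral_norm_sq_fourier_gaussianReal_le c hc hc2 ((m : NNReal) + 1) hv
    rw [gaussianReal_of_var_ne_zero _ hv.ne',
      lintegral_withDensity_eq_lintegral_mul _ (measurable_gaussianPDF _ _) hHm] at h
    have hm : (0 : ℝ) < m + 1 := by positivity
    have e : ∀ x : ℝ, ENNReal.ofReal (rexp (-(x ^ 2) / (2 * (m + 1))))
        = ENNReal.ofReal (√(2 * π * (m + 1))) * gaussianPDF 0 ((m : NNReal) + 1) x := by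
      intro x
      rw [gaussianPDF, gaussianPDFReal, ← ENNReal.ofReal_mul (by positivity)]
      congr 1
      push_cast
      rw [sub_zero, mul_inv_cancel_left₀]
      positivity
    calc ∫⁻ x, ENNReal.ofReal (rexp (-(x ^ 2) / (2 * (m + 1)))) * H x
        = ENNReal.ofReal (√(2 * π * (m + 1))) * ∫⁻ x, gaussianPDF 0 ((m : NNReal) + 1) x * H x := by
          simp_rw [e, mul_assoc]
          exact lintegral_const_mul _ ((measurable_gaussianPDF _ _).mul hHm)
      _ ≤ ENNReal.ofReal (√(2 * π * (m + 1))) * (ENNReal.ofReal (√(2 * π / ↑((m : NNReal) + 1)))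
            * ENNReal.ofReal (∫ t, ‖c t‖ ^ 2)) := by gcongr; exact h
      _ = _ := by
          have h0 : 0 ≤ ∫ t, ‖c t‖ ^ 2 := integral_nonneg fun x => by positivity
          rw [← mul_assoc, ← ENNReal.ofReal_mul (by positivity), ← ENNReal.ofReal_mul (by positivity)]
          congr 2
          push_cast
          rw [← Real.sqrt_mul (by positivity)]
          rw [show 2 * π * (m + 1 : ℝ) * (2 * π / (m + 1)) = (2 * π) ^ 2 by field_simp]
          exact Real.sqrt_sq (by positivity)
  have hl : ∀ x, Tendsto (fun m : ℕ => ENNReal.ofReal (rexp (-(x ^ 2) / (2 * (m + 1)))) * H x)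
      atTop (𝓝 (H x)) := by
    intro x
    have h1 : Tendsto (fun m : ℕ => rexp (-(x ^ 2) / (2 * ((m : ℝ) + 1)))) atTop (𝓝 1) := by
      have h0 : rexp 0 = 1 := Real.exp_zero
      rw [← h0]
      refine (Real.continuous_exp.tendsto 0).comp ?_
      have := tendsto_one_div_add_atTop_nhds_zero_nat (𝕜 := ℝ)
      have := this.const_mul (-(x ^ 2) / 2)
      rw [mul_zero] at this
      refine this.congr fun m => ?_
      rw [div_mul_div_comm, mul_one, h0]
    have h2 := ENNReal.Tendsto.mul_const (b := H x) (ENNReal.tendsto_ofReal h1)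
      (Or.inr ENNReal.ofReal_ne_top)
    simpa using h2
  calc ∫⁻ x, H x = ∫⁻ x, liminf (fun m : ℕ => ENNReal.ofReal (rexp (-(x ^ 2) / (2 * (m + 1)))) * H x)
        atTop := by congr 1; ext x; exact (hl x).liminf_eq.symm
    _ ≤ liminf (fun m : ℕ => ∫⁻ x, ENNReal.ofReal (rexp (-(x ^ 2) / (2 * (m + 1)))) * H x) atTop :=
        lintegral_liminf_le fun m => by fun_prop
    _ ≤ _ := liminf_le_of_le (by isBoundedDefault) fun b hb => by
        obtain ⟨m, hm⟩ := hb.exists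
        exact hm.trans (key m)

end EBMeans

/-! ### The sinc kernel: Fourier form and L² norms -/

namespace EBMeans

open Real in
lemma norm_fourier_integral_eq (c : ℝ → ℝ) (hc : Integrable c) (x : ℝ) :
    (∫ t : ℝ, (c t : ℂ) * Complex.exp (t * x * Complex.I)).re = ∫ t, c t * cos (t * x) ∧
    (∫ t : ℝ, (c t : ℂ) * Complex.exp (t * x * Complex.I)).im = ∫ t, c t * sin (t * x) := by
  have hi : Integrable fun t : ℝ => (c t : ℂ) * Complex.exp (t * x * Complex.I) := by
    refine hc.norm.mono' (hc.ofReal.aestronglyMeasurable.mul (by fun_prop)) (ae_of_all _ fun t => ?_)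
    have := Complex.norm_exp_ofReal_mul_I (t * x)
    push_cast at this
    rw [norm_mul, this, mul_one, Complex.norm_real]
  constructor
  · have h := integral_re (𝕜 := ℂ) hi
    simp only [RCLike.re_eq_complex_re] at h
    rw [← h]
    congr 1; ext t
    rw [Complex.re_ofReal_mul, ← Complex.ofReal_mul, Complex.exp_ofReal_mul_I_re]
  · have h := integral_im (𝕜 := ℂ) hi
    simp only [RCLike.im_eq_complex_im] at h
    rw [← h]
    congr 1; ext t
    rw [Complex.im_ofReal_mul, ← Complex.ofReal_mul, Complex.exp_ofReal_mul_I_im]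

-- A cosine transform is the real part of the Fourier integral. For even `c` the imaginary part
-- vanishes and nothing is lost; likewise for sine transforms of odd `c`. Those are the cases used
-- below, so the leading constants stay sharp.
open Real in
lemma lintegral_sq_cos_integral_le (c : ℝ → ℝ) (hc : Integrable c)
    (hc2 : Integrable fun t => c t ^ 2) :
    ∫⁻ x : ℝ, ENNReal.ofReal ((∫ t, c t * cos (t * x)) ^ 2) ≤ ENNReal.ofReal (2 * π * ∫ t, c t ^ 2) := by
  have h := lintegral_norm_sq_fourier_le (fun t => (c t : ℂ)) hc.ofReal (by simpa using hc2)
  simp only [Complex.norm_real, norm_eq_abs, sq_abs] at h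
  refine le_trans (lintegral_mono fun x => ENNReal.ofReal_le_ofReal ?_) h
  rw [← (norm_fourier_integral_eq c hc x).1, ← sq_abs]
  exact pow_le_pow_left₀ (abs_nonneg _) (Complex.abs_re_le_norm _) 2

open Real in
lemma lintegral_sq_sin_integral_le (c : ℝ → ℝ) (hc : Integrable c)
    (hc2 : Integrable fun t => c t ^ 2) :
    ∫⁻ x : ℝ, ENNReal.ofReal ((∫ t, c t * sin (t * x)) ^ 2) ≤ ENNReal.ofReal (2 * π * ∫ t, c t ^ 2) := by
  have h := lintegral_norm_sq_fourier_le (fun t => (c t : ℂ)) hc.ofReal (by simpa using hc2)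
  simp only [Complex.norm_real, norm_eq_abs, sq_abs] at h
  refine le_trans (lintegral_mono fun x => ENNReal.ofReal_le_ofReal ?_) h
  rw [← (norm_fourier_integral_eq c hc x).2, ← sq_abs]
  exact pow_le_pow_left₀ (abs_nonneg _) (Complex.abs_im_le_norm _) 2

noncomputable section

/-- The rescaled kernel `y ↦ a K(a y)`. -/
def kernelDens (a y : ℝ) : ℝ := a * sincKernel (a * y)

/-- The derivative of `y ↦ a K(a y)`. -/
def kernelDeriv (a y : ℝ) : ℝ := -(1 / (2 * Real.pi)) * ∫ t in -a..a, t * Real.sin (t * y)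

end

open Real

/-- The Fourier transform of the rescaled sinc is the indicator of the band `[-a, a]`. This form
yields the derivative, the L² norms and the bias. -/
lemma kernelDens_eq (a y : ℝ) : kernelDens a y = 1 / (2 * π) * ∫ t in -a..a, cos (t * y) := by
  rcases eq_or_ne y 0 with rfl | hy
  · simp [kernelDens, sincKernel]; field_simp; ring
  rw [intervalIntegral.integral_comp_mul_right _ hy, integral_cos]
  rcases eq_or_ne a 0 with rfl | ha
  · simp [kernelDens]
  rw [kernelDens, sincKernel, sinc_of_ne_zero (mul_ne_zero ha hy), neg_mul, sin_neg, smul_eq_mul]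
  field_simp; ring

lemma hasDerivAt_kernelDens (a y : ℝ) : HasDerivAt (kernelDens a) (kernelDeriv a y) y := by
  have h : HasDerivAt (fun y => ∫ t in -a..a, cos (t * y)) (∫ t in -a..a, -sin (t * y) * t) y := by
    refine (intervalIntegral.hasDerivAt_integral_of_dominated_loc_of_deriv_le
      (F := fun y t => cos (t * y)) (F' := fun y t => -sin (t * y) * t) (bound := fun t => |t|)
      (s := Set.univ) univ_mem ?_ ?_ ?_ ?_ ?_ ?_).2
    · exact Eventually.of_forall fun y => (Continuous.aestronglyMeasurable (by fun_prop))
    · exact (Continuous.intervalIntegrable (by fun_prop) _ _)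
    · exact (Continuous.aestronglyMeasurable (by fun_prop))
    · refine ae_of_all _ fun t _ x _ => ?_
      rw [norm_mul, norm_neg, norm_eq_abs, norm_eq_abs]
      exact mul_le_of_le_one_left (abs_nonneg _) (abs_sin_le_one _)
    · exact (Continuous.intervalIntegrable (by fun_prop) _ _)
    · refine ae_of_all _ fun t _ x _ => ?_
      have := ((hasDerivAt_id x).const_mul t).cos
      simpa using this
  have h2 := h.const_mul (1 / (2 * π))
  have e : kernelDens a = fun y => 1 / (2 * π) * ∫ t in -a..a, cos (t * y) := by
    ext y; exact kernelDens_eq a y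
  rw [e]
  refine h2.congr_deriv ?_
  rw [kernelDeriv, neg_mul, ← mul_neg, ← intervalIntegral.integral_neg]
  congr 2; ext t; ring

lemma abs_kernelDens_le {a : ℝ} (ha : 0 ≤ a) (y : ℝ) : |kernelDens a y| ≤ a := by
  rw [kernelDens, sincKernel, abs_mul, abs_div, abs_of_nonneg ha, abs_of_pos pi_pos]
  have := abs_sinc_le_one (a * y)
  have h3 : |sinc (a * y)| / π ≤ 1 := (div_le_one pi_pos).2 (by linarith [pi_gt_three])
  nlinarith

lemma abs_kernelDeriv_le {a : ℝ} (ha : 0 ≤ a) (y : ℝ) : |kernelDeriv a y| ≤ a ^ 2 := by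
  have h := intervalIntegral.norm_integral_le_of_norm_le_const (a := -a) (b := a) (C := a)
    (f := fun t => t * sin (t * y)) ?_
  · rw [kernelDeriv, neg_mul, abs_neg, abs_mul, abs_of_pos (by positivity)]
    rw [norm_eq_abs, sub_neg_eq_add, ← two_mul, abs_of_nonneg (by positivity : 0 ≤ 2 * a)] at h
    have h1 : 1 / (2 * π) ≤ 1 / 2 := by
      apply one_div_le_one_div_of_le (by norm_num); linarith [pi_gt_three]
    calc _ ≤ 1 / 2 * (a * (2 * a)) := by gcongr
      _ = a ^ 2 := by ring
  · intro t ht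
    rw [Set.uIoc_of_le (by linarith)] at ht
    rw [norm_mul, norm_eq_abs, norm_eq_abs]
    have h1 : |t| ≤ a := abs_le.2 ⟨ht.1.le, ht.2⟩
    have := abs_sin_le_one (t * y)
    nlinarith [abs_nonneg t, abs_nonneg (sin (t * y))]

lemma continuous_kernelDens (a : ℝ) : Continuous (kernelDens a) :=
  continuous_iff_continuousAt.2 fun y => (hasDerivAt_kernelDens a y).continuousAt

lemma continuous_kernelDeriv (a : ℝ) : Continuous (kernelDeriv a) := by
  unfold kernelDeriv
  refine continuous_const.mul ?_
  exact intervalIntegral.continuous_parametric_intervalIntegral_of_continuous' (by fun_prop) _ _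

lemma kernelDeriv_zero (a : ℝ) : kernelDeriv a 0 = 0 := by simp [kernelDeriv]

/-- Plancherel for the band indicator: `2π · (1/(2π))² · 2a = a/π`. This is the source of the
variance of `φ̂` in the main term. -/
lemma lintegral_kernelDens_sq_le {a : ℝ} (ha : 0 ≤ a) :
    ∫⁻ y, ENNReal.ofReal (kernelDens a y ^ 2) ≤ ENNReal.ofReal (a / π) := by
  have h := lintegral_sq_cos_integral_le ((Set.Ioc (-a) a).indicator fun _ => 1 / (2 * π))
    (by rw [integrable_indicator_iff measurableSet_Ioc]; exact integrable_const _) (by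
      have : (fun t => (Set.Ioc (-a) a).indicator (fun _ => 1 / (2 * π)) t ^ 2)
          = (Set.Ioc (-a) a).indicator fun _ => (1 / (2 * π)) ^ 2 := by
        ext t; by_cases ht : t ∈ Set.Ioc (-a) a <;> simp [ht]
      rw [this, integrable_indicator_iff measurableSet_Ioc]; exact integrable_const _)
  convert h using 2
  · ext y
    congr 2
    rw [kernelDens_eq, intervalIntegral.integral_of_le (by linarith), ← integral_const_mul,
      ← integral_indicator measurableSet_Ioc]
    congr 1; ext t
    by_cases ht : t ∈ Set.Ioc (-a) a <;> simp [ht]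
  · have : (fun t => (Set.Ioc (-a) a).indicator (fun _ => 1 / (2 * π)) t ^ 2)
          = (Set.Ioc (-a) a).indicator fun _ => (1 / (2 * π)) ^ 2 := by
        ext t; by_cases ht : t ∈ Set.Ioc (-a) a <;> simp [ht]
    rw [this, integral_indicator measurableSet_Ioc]
    simp only [integral_const, measureReal_restrict_apply_univ, smul_eq_mul, volume_real_Ioc_of_le (by linarith : -a ≤ a)]
    field_simp; ring

/-- Differentiation multiplies the frequency `t` by its size, so `2a` is replaced by `∫ t² = 2a³/3`
over the band. -/
lemma lintegral_kernelDeriv_sq_le {a : ℝ} (ha : 0 ≤ a) :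
    ∫⁻ y, ENNReal.ofReal (kernelDeriv a y ^ 2) ≤ ENNReal.ofReal (a ^ 3 / (3 * π)) := by
  have e : (fun t => (Set.Ioc (-a) a).indicator (fun t => -(1 / (2 * π)) * t) t ^ 2)
          = (Set.Ioc (-a) a).indicator fun t => (1 / (2 * π)) ^ 2 * t ^ 2 := by
        ext t; by_cases ht : t ∈ Set.Ioc (-a) a <;> simp [ht]; ring
  have h := lintegral_sq_sin_integral_le ((Set.Ioc (-a) a).indicator fun t => -(1 / (2 * π)) * t)
    (by rw [integrable_indicator_iff measurableSet_Ioc]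
        exact (Continuous.integrableOn_Ioc (by fun_prop))) (by
      rw [e, integrable_indicator_iff measurableSet_Ioc]
      exact (Continuous.integrableOn_Ioc (by fun_prop)))
  convert h using 2
  · ext y
    congr 2
    rw [kernelDeriv, intervalIntegral.integral_of_le (by linarith), ← integral_const_mul,
      ← integral_indicator measurableSet_Ioc]
    congr 1; ext t
    by_cases ht : t ∈ Set.Ioc (-a) a <;> simp [ht]; ring
  · rw [e, integral_indicator measurableSet_Ioc, ← intervalIntegral.integral_of_le (by linarith),
      intervalIntegral.integral_const_mul, integral_pow]
    field_simp; ring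

/-! ### Gaussian expectations of the kernel as truncated Fourier inversion -/

lemma integral_cos_gaussianReal (t x u : ℝ) :
    ∫ y, cos (t * (x - y)) ∂(gaussianReal u 1) = cos (t * (x - u)) * rexp (-t ^ 2 / 2) ∧
    ∫ y, sin (t * (x - y)) ∂(gaussianReal u 1) = sin (t * (x - u)) * rexp (-t ^ 2 / 2) := by
  have h := charFun_gaussianReal (μ := u) (v := 1) (-t)
  rw [charFun_apply_real] at h
  have hi : Integrable (fun y : ℝ => Complex.exp ((t * (x - y) : ℝ) * Complex.I)) (gaussianReal u 1) := by
    refine (integrable_const (1 : ℝ)).mono' (by fun_prop) (ae_of_all _ fun y => ?_)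
    rw [Complex.norm_exp_ofReal_mul_I]
  have h2 : ∫ y : ℝ, Complex.exp ((t * (x - y) : ℝ) * Complex.I) ∂(gaussianReal u 1)
      = Complex.exp ((t * (x - u) : ℝ) * Complex.I) * (rexp (-t ^ 2 / 2) : ℂ) := by
    have : ∀ y : ℝ, Complex.exp ((t * (x - y) : ℝ) * Complex.I)
        = Complex.exp ((t * x : ℝ) * Complex.I) * Complex.exp (((-t : ℝ) : ℂ) * y * Complex.I) := by
      intro y; rw [← Complex.exp_add]; congr 1; push_cast; ring
    simp_rw [this]
    rw [integral_const_mul, h, ← Complex.exp_add, Complex.ofReal_exp, ← Complex.exp_add,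
      ← Complex.exp_add]
    refine congrArg Complex.exp ?_
    simp only [NNReal.coe_one]
    push_cast
    ring
  constructor
  · have h3 := integral_re (𝕜 := ℂ) hi
    simp only [RCLike.re_eq_complex_re] at h3
    simpa only [h2, Complex.re_mul_ofReal, Complex.exp_ofReal_mul_I_re] using h3
  · have h3 := integral_im (𝕜 := ℂ) hi
    simp only [RCLike.im_eq_complex_im] at h3
    simpa only [h2, Complex.im_mul_ofReal, Complex.exp_ofReal_mul_I_im] using h3

/-- Averaging over a Gaussian observation damps the frequency `t` by `e^{-t²/2}`. The result is the
inversion formula for the Gaussian density with its frequencies cut off at `a`. -/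
lemma integral_kernelDens_gaussianReal {a : ℝ} (ha : 0 ≤ a) (x u : ℝ) :
    ∫ y, kernelDens a (x - y) ∂(gaussianReal u 1)
      = 1 / (2 * π) * ∫ t in Set.Ioc (-a) a, cos (t * (x - u)) * rexp (-t ^ 2 / 2) := by
  simp_rw [kernelDens_eq, intervalIntegral.integral_of_le (by linarith : -a ≤ a)]
  rw [integral_const_mul, integral_integral_swap]
  · simp_rw [(integral_cos_gaussianReal _ x u).1]
  · refine (integrable_const (1 : ℝ)).mono' (Continuous.aestronglyMeasurable ?_) (ae_of_all _ fun p => ?_)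
    · simp only [Function.uncurry_def]; fun_prop
    · exact abs_cos_le_one _

lemma integral_kernelDeriv_gaussianReal {a : ℝ} (ha : 0 ≤ a) (x u : ℝ) :
    ∫ y, kernelDeriv a (x - y) ∂(gaussianReal u 1)
      = -(1 / (2 * π)) * ∫ t in Set.Ioc (-a) a, t * (sin (t * (x - u)) * rexp (-t ^ 2 / 2)) := by
  simp_rw [kernelDeriv, intervalIntegral.integral_of_le (by linarith : -a ≤ a)]
  rw [integral_const_mul, integral_integral_swap]
  · simp_rw [integral_const_mul, (integral_cos_gaussianReal _ x u).2]
  · have : Integrable (fun p : ℝ × ℝ => |p.2|) ((gaussianReal u 1).prod (volume.restrict (Set.Ioc (-a) a))) := by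
      have h1 := (integrable_const (μ := gaussianReal u 1) (1 : ℝ)).mul_prod
        (ν := volume.restrict (Set.Ioc (-a) a)) (f := fun _ => (1 : ℝ)) (g := fun t => |t|)
        (Continuous.integrableOn_Ioc (by fun_prop))
      simpa using h1
    refine this.mono' (Continuous.aestronglyMeasurable ?_) (ae_of_all _ fun p => ?_)
    · simp only [Function.uncurry_def]; fun_prop
    · simp only [Function.uncurry, norm_mul, norm_eq_abs]
      exact mul_le_of_le_one_right (abs_nonneg _) (abs_sin_le_one _)

lemma integrable_exp_neg_sq_div_two : Integrable fun t : ℝ => rexp (-t ^ 2 / 2) := by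
  refine (integrable_exp_neg_mul_sq (b := 1 / 2) (by norm_num)).congr (ae_of_all _ fun t => ?_)
  simp only; congr 1; ring

lemma integrable_mul_exp_neg_sq_div_two : Integrable fun t : ℝ => t * rexp (-t ^ 2 / 2) := by
  refine (integrable_mul_exp_neg_mul_sq (b := 1 / 2) (by norm_num)).congr (ae_of_all _ fun t => ?_)
  simp only; congr 2; ring

lemma gaussianPDFReal_std (z : ℝ) : gaussianPDFReal 0 1 z = (√(2 * π))⁻¹ * rexp (-z ^ 2 / 2) := by
  simp [gaussianPDFReal]

/-- Self-duality of the Gaussian: the characteristic function of N(0,1), read as an integral against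
its density, is already the inversion formula up to normalization. -/
lemma gaussianPDFReal_eq_integral_cos (z : ℝ) :
    gaussianPDFReal 0 1 z = 1 / (2 * π) * ∫ t, cos (t * z) * rexp (-t ^ 2 / 2) := by
  have h := (integral_cos_gaussianReal (-z) 0 0).1
  rw [integral_gaussianReal_eq_integral_smul (by norm_num)] at h
  simp only [smul_eq_mul, gaussianPDFReal_std] at h
  have e : ∀ t : ℝ, (√(2 * π))⁻¹ * rexp (-t ^ 2 / 2) * cos (-z * (0 - t))
      = (√(2 * π))⁻¹ * (cos (t * z) * rexp (-t ^ 2 / 2)) := by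
    intro t; rw [show -z * (0 - t) = t * z by ring]; ring
  simp_rw [e] at h
  rw [integral_const_mul, sub_zero, mul_zero, cos_zero, one_mul, neg_sq] at h
  rw [gaussianPDFReal_std, ← h, ← mul_assoc, ← mul_inv, Real.mul_self_sqrt (by positivity), one_div]

lemma integrable_cos_mul_exp (z : ℝ) : Integrable fun t : ℝ => cos (t * z) * rexp (-t ^ 2 / 2) := by
  refine integrable_exp_neg_sq_div_two.mono' (by fun_prop) (ae_of_all _ fun t => ?_)
  rw [norm_mul, norm_eq_abs, norm_eq_abs, abs_of_pos (exp_pos _)]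
  exact mul_le_of_le_one_left (exp_pos _).le (abs_cos_le_one _)

lemma integrable_sin_mul_exp (z : ℝ) :
    Integrable fun t : ℝ => t * (sin (t * z) * rexp (-t ^ 2 / 2)) := by
  refine integrable_mul_exp_neg_sq_div_two.norm.mono' (by fun_prop) (ae_of_all _ fun t => ?_)
  rw [norm_mul, norm_mul, norm_mul]
  refine mul_le_mul_of_nonneg_left ?_ (norm_nonneg _)
  exact mul_le_of_le_one_left (norm_nonneg _) (abs_sin_le_one _)

/-- Integration by parts: the derivative in `t` of `e^{-t²/2} sin(tz)` has integral zero, which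
trades the factor `z` for a frequency `t`. -/
lemma mul_gaussianPDFReal_eq_integral_sin (z : ℝ) :
    z * gaussianPDFReal 0 1 z = 1 / (2 * π) * ∫ t, t * (sin (t * z) * rexp (-t ^ 2 / 2)) := by
  have hd : ∀ t : ℝ, HasDerivAt (fun t : ℝ => rexp (-t ^ 2 / 2) * sin (t * z))
      (z * (cos (t * z) * rexp (-t ^ 2 / 2)) - t * (sin (t * z) * rexp (-t ^ 2 / 2))) t := by
    intro t
    have h1 : HasDerivAt (fun t : ℝ => -t ^ 2 / 2) (-t) t := by
      have := ((hasDerivAt_id t).pow 2).neg.div_const 2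
      refine this.congr_deriv ?_
      simp; ring
    have h2 := h1.exp.mul (((hasDerivAt_id t).mul_const z).sin)
    refine h2.congr_deriv ?_
    simp; ring
  have ht : Tendsto (fun t : ℝ => rexp (-t ^ 2 / 2) * sin (t * z)) (cocompact ℝ) (𝓝 0) := by
    have h0 : Tendsto (fun t : ℝ => rexp (-t ^ 2 / 2)) (cocompact ℝ) (𝓝 0) := by
      refine tendsto_exp_atBot.comp ?_
      have h1 : Tendsto (fun t : ℝ => t ^ 2 / 2) (cocompact ℝ) atTop := by
        have := (tendsto_norm_cocompact_atTop (E := ℝ))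
        have h2 := ((tendsto_pow_atTop (α := ℝ) (two_ne_zero)).comp this).atTop_div_const (by norm_num : (0:ℝ) < 2)
        refine h2.congr fun t => by simp
      refine (tendsto_neg_atTop_atBot.comp h1).congr fun t => by simp [neg_div]
    refine squeeze_zero_norm (fun t => ?_) h0
    rw [norm_mul, norm_eq_abs, norm_eq_abs, abs_of_pos (exp_pos _)]
    exact mul_le_of_le_one_right (exp_pos _).le (abs_sin_le_one _)
  have h := integral_of_hasDerivAt_of_tendsto hd
    (((integrable_cos_mul_exp z).const_mul z).sub (integrable_sin_mul_exp z))
    (ht.mono_left atBot_le_cocompact) (ht.mono_left atTop_le_cocompact)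
  rw [integral_sub ((integrable_cos_mul_exp z).const_mul z) (integrable_sin_mul_exp z),
    integral_const_mul, sub_zero] at h
  rw [gaussianPDFReal_eq_integral_cos]
  linear_combination (1 / (2 * π)) * h

end EBMeans

/-! ### Bias of the kernel estimate: frequency tails -/

namespace EBMeans

open Real

noncomputable section

/-- The bias of the kernel density estimate for the standard normal density. -/
def biasDens (a z : ℝ) : ℝ :=
  -(1 / (2 * π)) * ∫ t in (Set.Ioc (-a) a)ᶜ, cos (t * z) * rexp (-t ^ 2 / 2)

/-- The bias of the derivative of the kernel density estimate for the standard normal density. -/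
def biasDeriv (a z : ℝ) : ℝ :=
  1 / (2 * π) * ∫ t in (Set.Ioc (-a) a)ᶜ, t * (sin (t * z) * rexp (-t ^ 2 / 2))

end

/-- The full inversion integral is the band plus its complement, so the bias is minus the part over
the complement. -/
lemma integral_kernelDens_eq_add_bias {a : ℝ} (ha : 0 ≤ a) (x u : ℝ) :
    ∫ y, kernelDens a (x - y) ∂(gaussianReal u 1)
      = gaussianPDFReal 0 1 (x - u) + biasDens a (x - u) := by
  rw [integral_kernelDens_gaussianReal ha, gaussianPDFReal_eq_integral_cos, biasDens,
    ← integral_add_compl (measurableSet_Ioc (a := -a) (b := a)) (integrable_cos_mul_exp _)]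
  ring

lemma integral_kernelDeriv_eq_add_bias {a : ℝ} (ha : 0 ≤ a) (x u : ℝ) :
    ∫ y, kernelDeriv a (x - y) ∂(gaussianReal u 1)
      = -((x - u) * gaussianPDFReal 0 1 (x - u)) + biasDeriv a (x - u) := by
  rw [integral_kernelDeriv_gaussianReal ha, mul_gaussianPDFReal_eq_integral_sin, biasDeriv,
    ← integral_add_compl (measurableSet_Ioc (a := -a) (b := a)) (integrable_sin_mul_exp _)]
  ring

lemma abs_mul_exp_neg_sq_le_one (t : ℝ) : |t| * rexp (-t ^ 2 / 2) ≤ 1 := by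
  have h1 : t ^ 2 / 2 + 1 ≤ rexp (t ^ 2 / 2) := add_one_le_exp _
  have h2 : |t| ≤ rexp (t ^ 2 / 2) := by nlinarith [sq_abs t, sq_nonneg (|t| - 1)]
  rw [neg_div, exp_neg, ← div_eq_mul_inv]
  exact (div_le_one (exp_pos _)).2 h2

/-- The function `t e^{-t²/2}` decreases beyond `t = 1`; the proof uses only `1 + y ≤ e^y`. -/
lemma mul_exp_neg_sq_le {a t : ℝ} (ha : 1 ≤ a) (ht : a ≤ t) :
    t * rexp (-t ^ 2 / 2) ≤ a * rexp (-a ^ 2 / 2) := by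
  have h1 : (t ^ 2 - a ^ 2) / 2 + 1 ≤ rexp ((t ^ 2 - a ^ 2) / 2) := add_one_le_exp _
  have h2 : t ≤ a * rexp ((t ^ 2 - a ^ 2) / 2) := by
    have h3 : t ≤ a * ((t ^ 2 - a ^ 2) / 2 + 1) := by nlinarith [mul_nonneg (sub_nonneg.2 ht) (sub_nonneg.2 ha), mul_nonneg (mul_nonneg (sub_nonneg.2 ht) (sub_nonneg.2 ha)) (by linarith : 0 ≤ t + a)]
    exact h3.trans (by gcongr)
  calc t * rexp (-t ^ 2 / 2) ≤ a * rexp ((t ^ 2 - a ^ 2) / 2) * rexp (-t ^ 2 / 2) := by gcongr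
    _ = _ := by rw [mul_assoc, ← exp_add]; congr 2; ring

lemma setIntegral_compl_Ioc_of_even {g : ℝ → ℝ} (hg : Integrable g) (he : ∀ t, g (-t) = g t)
    {a : ℝ} (ha : 0 ≤ a) : ∫ t in (Set.Ioc (-a) a)ᶜ, g t = 2 * ∫ t in Set.Ioi a, g t := by
  have h : (Set.Ioc (-a) a)ᶜ = Set.Iic (-a) ∪ Set.Ioi a := by
    ext t; simp only [Set.mem_compl_iff, Set.mem_Ioc, Set.mem_union, Set.mem_Iic, Set.mem_Ioi]
    constructor
    · intro h; by_contra hc; push Not at hc; exact h hc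
    · rintro (h | h) <;> intro hc <;> linarith [hc.1, hc.2]
  rw [h, setIntegral_union ?_ measurableSet_Ioi hg.integrableOn hg.integrableOn]
  · have h2 := integral_comp_neg_Ioi a g
    simp_rw [he] at h2
    rw [← h2]; ring
  · rw [Set.disjoint_left]; intro t h1 h2
    simp only [Set.mem_Iic, Set.mem_Ioi] at h1 h2; linarith

lemma integral_Ioi_mul_exp_neg_sq (a : ℝ) :
    ∫ t in Set.Ioi a, t * rexp (-t ^ 2 / 2) = rexp (-a ^ 2 / 2) := by
  have h0 : Tendsto (fun t : ℝ => -rexp (-t ^ 2 / 2)) atTop (𝓝 (-0)) := by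
    refine (tendsto_exp_atBot.comp ?_).neg
    have h2 := ((tendsto_pow_atTop (α := ℝ) (two_ne_zero))).atTop_div_const (by norm_num : (0:ℝ) < 2)
    exact (tendsto_neg_atTop_atBot.comp h2).congr fun t => by simp [neg_div]
  rw [integral_Ioi_of_hasDerivAt_of_tendsto' (fun t _ => ?_)
    integrable_mul_exp_neg_sq_div_two.integrableOn h0]
  · simp
  · have h1 : HasDerivAt (fun t : ℝ => -t ^ 2 / 2) (-t) t := by
      have := ((hasDerivAt_id t).pow 2).neg.div_const 2
      refine this.congr_deriv ?_
      simp; ring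
    refine h1.exp.neg.congr_deriv ?_
    ring

lemma integrable_abs_mul_exp : Integrable fun t : ℝ => |t| * rexp (-t ^ 2 / 2) := by
  refine integrable_mul_exp_neg_sq_div_two.norm.congr (ae_of_all _ fun t => ?_)
  simp

lemma integrable_sq_mul_exp : Integrable fun t : ℝ => (t * rexp (-t ^ 2 / 2)) ^ 2 := by
  refine integrable_abs_mul_exp.mono' (by fun_prop) (ae_of_all _ fun t => ?_)
  have h := abs_mul_exp_neg_sq_le_one t
  rw [norm_eq_abs, abs_of_nonneg (sq_nonneg _), ← sq_abs, abs_mul, abs_of_pos (exp_pos _)]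
  nlinarith [mul_nonneg (abs_nonneg t) (exp_pos (-t ^ 2 / 2)).le]

lemma integral_compl_abs_mul_exp {a : ℝ} (ha : 0 ≤ a) :
    ∫ t in (Set.Ioc (-a) a)ᶜ, |t| * rexp (-t ^ 2 / 2) = 2 * rexp (-a ^ 2 / 2) := by
  rw [setIntegral_compl_Ioc_of_even integrable_abs_mul_exp (fun t => by simp) ha,
    ← integral_Ioi_mul_exp_neg_sq]
  congr 1
  refine setIntegral_congr_fun measurableSet_Ioi fun t ht => ?_
  simp only [abs_of_pos (lt_of_le_of_lt ha ht)]

/-- One of the two factors `t e^{-t²/2}` is frozen at its value at `a`; the other integrates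
exactly. -/
lemma integral_compl_sq_mul_exp_le {a : ℝ} (ha : 1 ≤ a) :
    ∫ t in (Set.Ioc (-a) a)ᶜ, (t * rexp (-t ^ 2 / 2)) ^ 2 ≤ 2 * (a * rexp (-a ^ 2)) := by
  rw [setIntegral_compl_Ioc_of_even integrable_sq_mul_exp (fun t => by simp) (by linarith)]
  gcongr
  calc ∫ t in Set.Ioi a, (t * rexp (-t ^ 2 / 2)) ^ 2
      ≤ ∫ t in Set.Ioi a, a * rexp (-a ^ 2 / 2) * (t * rexp (-t ^ 2 / 2)) := by
        refine setIntegral_mono_on integrable_sq_mul_exp.integrableOn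
          (integrable_mul_exp_neg_sq_div_two.const_mul _).integrableOn measurableSet_Ioi fun t ht => ?_
        have ht' : a < t := ht
        rw [sq]
        have : 0 < t := by linarith
        exact mul_le_mul_of_nonneg_right (mul_exp_neg_sq_le ha ht'.le) (by positivity)
    _ = a * rexp (-a ^ 2) := by
        rw [integral_const_mul, integral_Ioi_mul_exp_neg_sq, mul_assoc, ← exp_add]
        congr 2; ring

lemma one_le_abs_of_mem_compl {a t : ℝ} (ha : 1 ≤ a) (ht : t ∈ (Set.Ioc (-a) a)ᶜ) : 1 ≤ |t| := by
  simp only [Set.mem_compl_iff, Set.mem_Ioc, not_and_or, not_lt, not_le] at ht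
  rw [le_abs]
  rcases ht with h | h
  · right; linarith
  · left; linarith

/-- Off the band `|t| ≥ 1`, so a factor `|t|` may be inserted, and `|t| e^{-t²/2}` has an explicit
tail integral. For `a = √(2 log n)` the bound is `1/n`. -/
lemma abs_biasDens_le {a : ℝ} (ha : 1 ≤ a) (z : ℝ) : |biasDens a z| ≤ rexp (-a ^ 2 / 2) := by
  have h : |∫ t in (Set.Ioc (-a) a)ᶜ, cos (t * z) * rexp (-t ^ 2 / 2)| ≤ 2 * rexp (-a ^ 2 / 2) := by
    rw [← integral_compl_abs_mul_exp (by linarith), ← norm_eq_abs]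
    refine (norm_integral_le_integral_norm _).trans ?_
    refine setIntegral_mono_on (integrable_cos_mul_exp z).norm.integrableOn
      integrable_abs_mul_exp.integrableOn measurableSet_Ioc.compl fun t ht => ?_
    rw [norm_mul, norm_eq_abs, norm_eq_abs, abs_of_pos (exp_pos _)]
    exact mul_le_mul_of_nonneg_right
      ((abs_cos_le_one _).trans (one_le_abs_of_mem_compl ha ht)) (exp_pos _).le
  rw [biasDens, abs_mul, abs_neg, abs_of_pos (by positivity)]
  have h1 : 1 / (2 * π) ≤ 1 / 2 := by
    apply one_div_le_one_div_of_le (by norm_num); linarith [pi_gt_three]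
  calc _ ≤ 1 / 2 * (2 * rexp (-a ^ 2 / 2)) := by gcongr
    _ = _ := by ring

lemma abs_biasDeriv_le {a : ℝ} (ha : 1 ≤ a) (z : ℝ) : |biasDeriv a z| ≤ rexp (-a ^ 2 / 2) := by
  have h : |∫ t in (Set.Ioc (-a) a)ᶜ, t * (sin (t * z) * rexp (-t ^ 2 / 2))|
      ≤ 2 * rexp (-a ^ 2 / 2) := by
    rw [← integral_compl_abs_mul_exp (by linarith), ← norm_eq_abs]
    refine (norm_integral_le_integral_norm _).trans ?_
    refine setIntegral_mono_on (integrable_sin_mul_exp z).norm.integrableOn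
      integrable_abs_mul_exp.integrableOn measurableSet_Ioc.compl fun t ht => ?_
    rw [norm_mul, norm_mul, norm_eq_abs, norm_eq_abs, norm_eq_abs, abs_of_pos (exp_pos _)]
    gcongr
    exact mul_le_of_le_one_left (exp_pos _).le (abs_sin_le_one _)
  rw [biasDeriv, abs_mul, abs_of_pos (by positivity)]
  have h1 : 1 / (2 * π) ≤ 1 / 2 := by
    apply one_div_le_one_div_of_le (by norm_num); linarith [pi_gt_three]
  calc _ ≤ 1 / 2 * (2 * rexp (-a ^ 2 / 2)) := by gcongr
    _ = _ := by ring

/-- Plancherel applied to the frequency tail. With `a = √(2 log n)` the bound is `a/n²`, negligible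
beside the variance bound `a³/(3πn)`. -/
lemma lintegral_biasDeriv_sq_le {a : ℝ} (ha : 1 ≤ a) :
    ∫⁻ z, ENNReal.ofReal (biasDeriv a z ^ 2) ≤ ENNReal.ofReal (a * rexp (-a ^ 2)) := by
  set S := (Set.Ioc (-a) a)ᶜ
  have hS : MeasurableSet S := measurableSet_Ioc.compl
  have e : (fun t => S.indicator (fun t => 1 / (2 * π) * (t * rexp (-t ^ 2 / 2))) t ^ 2)
      = S.indicator fun t => (1 / (2 * π)) ^ 2 * (t * rexp (-t ^ 2 / 2)) ^ 2 := by
    ext t; by_cases ht : t ∈ S <;> simp [ht]; ring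
  have h := lintegral_sq_sin_integral_le
    (S.indicator fun t => 1 / (2 * π) * (t * rexp (-t ^ 2 / 2)))
    ((integrable_mul_exp_neg_sq_div_two.const_mul _).indicator hS)
    (by rw [e]; exact (integrable_sq_mul_exp.const_mul _).indicator hS)
  refine le_trans (le_of_eq ?_) (h.trans (ENNReal.ofReal_le_ofReal ?_))
  · congr 1; ext z; congr 2
    rw [biasDeriv, ← integral_const_mul, ← integral_indicator hS]
    congr 1; ext t
    by_cases ht : t ∈ S <;> simp [ht]; ring
  · rw [e, integral_indicator hS, integral_const_mul]
    have h1 : 2 * π * (1 / (2 * π)) ^ 2 ≤ 1 / 2 := by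
      rw [show 2 * π * (1 / (2 * π)) ^ 2 = 1 / (2 * π) by field_simp]
      apply one_div_le_one_div_of_le (by norm_num); linarith [pi_gt_three]
    calc _ = 2 * π * (1 / (2 * π)) ^ 2 * ∫ t in S, (t * rexp (-t ^ 2 / 2)) ^ 2 := by ring
      _ ≤ 1 / 2 * (2 * (a * rexp (-a ^ 2))) := by
        refine mul_le_mul h1 (integral_compl_sq_mul_exp_le ha) ?_ (by norm_num)
        exact integral_nonneg fun t => sq_nonneg _
      _ = _ := by ring

/-- As for the derivative; inserting `t² ≥ 1` off the band reduces to the same tail integral. -/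
lemma lintegral_biasDens_sq_le {a : ℝ} (ha : 1 ≤ a) :
    ∫⁻ z, ENNReal.ofReal (biasDens a z ^ 2) ≤ ENNReal.ofReal (a * rexp (-a ^ 2)) := by
  set S := (Set.Ioc (-a) a)ᶜ
  have hS : MeasurableSet S := measurableSet_Ioc.compl
  have e : (fun t => S.indicator (fun t => -(1 / (2 * π)) * rexp (-t ^ 2 / 2)) t ^ 2)
      = S.indicator fun t => (1 / (2 * π)) ^ 2 * rexp (-t ^ 2 / 2) ^ 2 := by
    ext t; by_cases ht : t ∈ S <;> simp [ht]; ring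
  have hq : Integrable fun t : ℝ => rexp (-t ^ 2 / 2) ^ 2 := by
    refine integrable_exp_neg_sq_div_two.mono' (by fun_prop) (ae_of_all _ fun t => ?_)
    have h1 : rexp (-t ^ 2 / 2) ≤ 1 := by rw [exp_le_one_iff]; nlinarith [sq_nonneg t]
    rw [norm_eq_abs, abs_of_nonneg (by positivity), sq]
    exact mul_le_of_le_one_left (exp_pos _).le h1
  have h := lintegral_sq_cos_integral_le
    (S.indicator fun t => -(1 / (2 * π)) * rexp (-t ^ 2 / 2))
    ((integrable_exp_neg_sq_div_two.const_mul _).indicator hS)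
    (by rw [e]; exact (hq.const_mul _).indicator hS)
  refine le_trans (le_of_eq ?_) (h.trans (ENNReal.ofReal_le_ofReal ?_))
  · congr 1; ext z; congr 2
    rw [biasDens, ← integral_const_mul, ← integral_indicator hS]
    congr 1; ext t
    by_cases ht : t ∈ S <;> simp [ht]; ring
  · rw [e, integral_indicator hS, integral_const_mul]
    have h1 : 2 * π * (1 / (2 * π)) ^ 2 ≤ 1 / 2 := by
      rw [show 2 * π * (1 / (2 * π)) ^ 2 = 1 / (2 * π) by field_simp]
      apply one_div_le_one_div_of_le (by norm_num); linarith [pi_gt_three]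
    calc _ = 2 * π * (1 / (2 * π)) ^ 2 * ∫ t in S, rexp (-t ^ 2 / 2) ^ 2 := by ring
      _ ≤ 1 / 2 * (2 * (a * rexp (-a ^ 2))) := by
        refine mul_le_mul h1 (le_trans ?_ (integral_compl_sq_mul_exp_le ha)) ?_ (by norm_num)
        · refine setIntegral_mono_on hq.integrableOn integrable_sq_mul_exp.integrableOn hS fun t ht => ?_
          rw [mul_pow]
          refine le_mul_of_one_le_left (sq_nonneg _) ?_
          rw [← sq_abs]
          exact one_le_pow₀ (one_le_abs_of_mem_compl ha ht)
        · exact integral_nonneg fun t => sq_nonneg _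
      _ = _ := by ring

lemma continuous_biasDens (a : ℝ) : Continuous (biasDens a) := by
  refine continuous_const.mul (continuous_of_dominated (bound := fun t => rexp (-t ^ 2 / 2))
    (fun z => (by fun_prop)) (fun z => ae_of_all _ fun t => ?_)
    integrable_exp_neg_sq_div_two.integrableOn (ae_of_all _ fun t => by fun_prop))
  rw [norm_mul, norm_eq_abs, norm_eq_abs, abs_of_pos (exp_pos _)]
  exact mul_le_of_le_one_left (exp_pos _).le (abs_cos_le_one _)

lemma continuous_biasDeriv (a : ℝ) : Continuous (biasDeriv a) := by
  refine continuous_const.mul (continuous_of_dominated (bound := fun t => |t| * rexp (-t ^ 2 / 2))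
    (fun z => (by fun_prop)) (fun z => ae_of_all _ fun t => ?_)
    integrable_abs_mul_exp.integrableOn (ae_of_all _ fun t => by fun_prop))
  rw [norm_mul, norm_mul, norm_eq_abs, norm_eq_abs, norm_eq_abs, abs_of_pos (exp_pos _)]
  gcongr
  exact mul_le_of_le_one_left (exp_pos _).le (abs_sin_le_one _)

end EBMeans

/-! ### Gaussian mixtures: Fisher information, score bound and Bayes risk -/

namespace EBMeans

open Real

lemma inv_sqrt_two_pi_le : (√(2 * π))⁻¹ ≤ 1 / 2 := by
  rw [inv_eq_one_div]
  apply one_div_le_one_div_of_le (by norm_num)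
  apply Real.le_sqrt_of_sq_le; nlinarith [pi_gt_three]

lemma gaussianPDFReal_std_pos (z : ℝ) : 0 < gaussianPDFReal 0 1 z :=
  gaussianPDFReal_pos 0 1 z one_ne_zero

lemma continuous_gaussianPDFReal_std : Continuous (gaussianPDFReal 0 1) := by
  have : gaussianPDFReal 0 1 = fun z => (√(2 * π))⁻¹ * rexp (-z ^ 2 / 2) := by
    ext z; exact gaussianPDFReal_std z
  rw [this]; fun_prop

lemma gaussianPDFReal_std_le_one (z : ℝ) : gaussianPDFReal 0 1 z ≤ 1 := by
  rw [gaussianPDFReal_std]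
  have h1 : rexp (-z ^ 2 / 2) ≤ 1 := by rw [exp_le_one_iff]; nlinarith [sq_nonneg z]
  nlinarith [inv_sqrt_two_pi_le, exp_pos (-z ^ 2 / 2)]

lemma abs_mul_gaussianPDFReal_le_one (z : ℝ) : |z| * gaussianPDFReal 0 1 z ≤ 1 := by
  rw [gaussianPDFReal_std]
  have h1 := abs_mul_exp_neg_sq_le_one z
  have h2 : 0 ≤ |z| * rexp (-z ^ 2 / 2) := by positivity
  nlinarith [inv_sqrt_two_pi_le]

lemma sq_mul_gaussianPDFReal_le_one (z : ℝ) : z ^ 2 * gaussianPDFReal 0 1 z ≤ 1 := by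
  rw [gaussianPDFReal_std]
  have h1 : z ^ 2 / 2 + 1 ≤ rexp (z ^ 2 / 2) := add_one_le_exp _
  have h2 : z ^ 2 * rexp (-z ^ 2 / 2) ≤ 2 := by
    rw [neg_div, exp_neg, ← div_eq_mul_inv]
    exact (div_le_iff₀ (exp_pos _)).2 (by linarith)
  have h3 : 0 ≤ z ^ 2 * rexp (-z ^ 2 / 2) := by positivity
  nlinarith [inv_sqrt_two_pi_le]

lemma gaussianPDFReal_one_eq (u x : ℝ) : gaussianPDFReal u 1 x = gaussianPDFReal 0 1 (x - u) := by
  simp [gaussianPDFReal]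

lemma integrable_mul_gaussianPDFReal : Integrable fun z : ℝ => z * gaussianPDFReal 0 1 z := by
  refine (integrable_mul_exp_neg_sq_div_two.const_mul (√(2 * π))⁻¹).congr (ae_of_all _ fun z => ?_)
  simp only [gaussianPDFReal_std]; ring

lemma integral_sq_gaussianReal (u : ℝ) : Integrable (fun x => (x - u) ^ 2) (gaussianReal u 1) ∧
    ∫ x, (x - u) ^ 2 ∂(gaussianReal u 1) = 1 := by
  have h := variance_fun_id_gaussianReal (μ := u) (v := 1)
  rw [variance_eq_integral (by fun_prop)] at h
  simp only [integral_id_gaussianReal, NNReal.coe_one] at h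
  exact ⟨((memLp_id_gaussianReal 2).sub (memLp_const u)).integrable_sq, h⟩

lemma integrable_sq_mul_gaussianPDFReal :
    Integrable (fun z : ℝ => z ^ 2 * gaussianPDFReal 0 1 z) := by
  have h := (integral_sq_gaussianReal 0).1
  rw [gaussianReal_of_var_ne_zero 0 one_ne_zero, integrable_withDensity_iff (measurable_gaussianPDF _ _)
    (ae_of_all _ fun x => gaussianPDF_lt_top)] at h
  simpa using h

lemma integral_sq_mul_gaussianPDFReal :
    ∫ z : ℝ, z ^ 2 * gaussianPDFReal 0 1 z = 1 := by
  have h := (integral_sq_gaussianReal 0).2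
  rw [integral_gaussianReal_eq_integral_smul one_ne_zero] at h
  rw [← h]; congr 1; ext z; simp [mul_comm]

lemma integral_abs_mul_gaussianPDFReal_le : ∫ z : ℝ, |z| * gaussianPDFReal 0 1 z ≤ 1 := by
  have h1 : Integrable fun z : ℝ => (1 / 2 : ℝ) * gaussianPDFReal 0 1 z + 1 / 2 * (z ^ 2 * gaussianPDFReal 0 1 z) :=
    ((integrable_gaussianPDFReal 0 1).const_mul _).add (integrable_sq_mul_gaussianPDFReal.const_mul _)
  calc ∫ z : ℝ, |z| * gaussianPDFReal 0 1 z
      ≤ ∫ z : ℝ, ((1 / 2 : ℝ) * gaussianPDFReal 0 1 z + 1 / 2 * (z ^ 2 * gaussianPDFReal 0 1 z)) := by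
        refine integral_mono_of_nonneg (ae_of_all _ fun z => mul_nonneg (abs_nonneg z) (gaussianPDFReal_std_pos z).le) h1
          (ae_of_all _ fun z => ?_)
        have := gaussianPDFReal_std_pos z
        have h2 : |z| ≤ 1 / 2 + 1 / 2 * z ^ 2 := by nlinarith [sq_abs z, sq_nonneg (|z| - 1)]
        simp only
        nlinarith
    _ = 1 := by
        rw [integral_add ((integrable_gaussianPDFReal 0 1).const_mul _) (integrable_sq_mul_gaussianPDFReal.const_mul _),
          integral_const_mul, integral_const_mul, integral_sq_mul_gaussianPDFReal,
          integral_gaussianPDFReal_eq_one 0 one_ne_zero]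
        norm_num

/-- Convolution of an integrable function with a probability measure. -/
lemma integral_conv {h : ℝ → ℝ} (hc : Continuous h) (hi : Integrable h) (G : Measure ℝ)
    [IsProbabilityMeasure G] :
    Integrable (fun x => ∫ u, h (x - u) ∂G) ∧ ∫ x, ∫ u, h (x - u) ∂G = ∫ x, h x := by
  have hp : Integrable (fun p : ℝ × ℝ => h (p.1 - p.2)) (volume.prod G) := by
    rw [integrable_prod_iff' (Continuous.aestronglyMeasurable (by fun_prop))]
    refine ⟨ae_of_all _ fun u => hi.comp_sub_right u, ?_⟩
    have : ∀ u : ℝ, ∫ x, ‖h (x - u)‖ = ∫ x, ‖h x‖ := fun u =>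
      integral_sub_right_eq_self (fun x => ‖h x‖) u
    simp_rw [this]
    exact integrable_const _
  refine ⟨hp.integral_prod_left, ?_⟩
  rw [integral_integral_swap hp]
  simp_rw [integral_sub_right_eq_self]
  simp

noncomputable section

/-- The derivative of `mixDensity G`. -/
def mixDeriv (G : Measure ℝ) (x : ℝ) : ℝ := ∫ u, -((x - u) * gaussianPDFReal 0 1 (x - u)) ∂G

/-- `∫ (x - u)² φ(x - u) dG(u)`. -/
def mixSq (G : Measure ℝ) (x : ℝ) : ℝ := ∫ u, (x - u) ^ 2 * gaussianPDFReal 0 1 (x - u) ∂G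

end

lemma sqrt_mul_mixDensity_eq (G : Measure ℝ) (x : ℝ) : √(2 * π) * mixDensity G x = ∫ u, rexp (-(x - u) ^ 2 / 2) ∂G := by
  rw [mixDensity, ← integral_const_mul]
  congr 1; ext u
  rw [gaussianPDFReal_std, mul_inv_cancel_left₀ (by positivity)]

section

variable (G : Measure ℝ) [IsProbabilityMeasure G]

lemma integrable_mixDensity_integrand (x : ℝ) : Integrable (fun u => gaussianPDFReal 0 1 (x - u)) G := by
  have := continuous_gaussianPDFReal_std
  refine (integrable_const (1 : ℝ)).mono' (by fun_prop) (ae_of_all _ fun u => ?_)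
  rw [norm_eq_abs, abs_of_pos (gaussianPDFReal_std_pos _)]
  exact gaussianPDFReal_std_le_one _

lemma integrable_mixDeriv_integrand (x : ℝ) :
    Integrable (fun u => (x - u) * gaussianPDFReal 0 1 (x - u)) G := by
  have := continuous_gaussianPDFReal_std
  refine (integrable_const (1 : ℝ)).mono' (by fun_prop) (ae_of_all _ fun u => ?_)
  rw [norm_mul, norm_eq_abs, norm_eq_abs, abs_of_pos (gaussianPDFReal_std_pos _)]
  exact abs_mul_gaussianPDFReal_le_one _

lemma integrable_mixSq_integrand (x : ℝ) :
    Integrable (fun u => (x - u) ^ 2 * gaussianPDFReal 0 1 (x - u)) G := by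
  have := continuous_gaussianPDFReal_std
  refine (integrable_const (1 : ℝ)).mono' (by fun_prop) (ae_of_all _ fun u => ?_)
  rw [norm_eq_abs, abs_of_nonneg (mul_nonneg (sq_nonneg _) (gaussianPDFReal_std_pos _).le)]
  exact sq_mul_gaussianPDFReal_le_one _

lemma mixDensity_pos (x : ℝ) : 0 < mixDensity G x := by
  rw [mixDensity, integral_pos_iff_support_of_nonneg (fun u => (gaussianPDFReal_std_pos _).le)
    (integrable_mixDensity_integrand G x)]
  have : Function.support (fun u => gaussianPDFReal 0 1 (x - u)) = Set.univ := by
    ext u; simp [(gaussianPDFReal_std_pos (x - u)).ne']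
  rw [this]; simp

lemma integrable_exp_sub (x : ℝ) : Integrable (fun u => rexp (-(x - u) ^ 2 / 2)) G := by
  refine (integrable_const (1 : ℝ)).mono' (by fun_prop) (ae_of_all _ fun u => ?_)
  rw [norm_eq_abs, abs_of_pos (exp_pos _), exp_le_one_iff]
  nlinarith [sq_nonneg (x - u)]

lemma mixDensity_le_one (x : ℝ) : mixDensity G x ≤ 1 := by
  have h := integral_mono (integrable_mixDensity_integrand G x) (integrable_const (1 : ℝ))
    fun u => gaussianPDFReal_std_le_one _
  simpa [mixDensity] using h

lemma hasDerivAt_mixDensity (x : ℝ) : HasDerivAt (mixDensity G) (mixDeriv G x) x := by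
  have hd : ∀ z : ℝ, HasDerivAt (gaussianPDFReal 0 1) (-(z * gaussianPDFReal 0 1 z)) z := by
    intro z
    have h1 : HasDerivAt (fun t : ℝ => -t ^ 2 / 2) (-z) z := by
      have := ((hasDerivAt_id z).pow 2).neg.div_const 2
      refine this.congr_deriv ?_
      simp; ring
    have h2 := h1.exp.const_mul (√(2 * π))⁻¹
    have e : gaussianPDFReal 0 1 = fun z => (√(2 * π))⁻¹ * rexp (-z ^ 2 / 2) := by
      ext z; exact gaussianPDFReal_std z
    rw [e]
    refine h2.congr_deriv ?_
    ring
  have := continuous_gaussianPDFReal_std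
  refine (hasDerivAt_integral_of_dominated_loc_of_deriv_le
    (F := fun x u => gaussianPDFReal 0 1 (x - u))
    (F' := fun x u => -((x - u) * gaussianPDFReal 0 1 (x - u))) (bound := fun _ => 1)
    (s := Set.univ) univ_mem ?_ (integrable_mixDensity_integrand G x) (by fun_prop) ?_ (integrable_const _) ?_).2
  · exact Eventually.of_forall fun y => by fun_prop
  · refine ae_of_all _ fun u y _ => ?_
    rw [norm_neg, norm_mul, norm_eq_abs, norm_eq_abs, abs_of_pos (gaussianPDFReal_std_pos _)]
    exact abs_mul_gaussianPDFReal_le_one _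
  · refine ae_of_all _ fun u y _ => ?_
    exact (hd (y - u)).comp_sub_const y u

lemma continuous_mixDensity : Continuous (mixDensity G) :=
  continuous_iff_continuousAt.2 fun y => (hasDerivAt_mixDensity G y).continuousAt

lemma continuous_mixDeriv : Continuous (mixDeriv G) := by
  have := continuous_gaussianPDFReal_std
  refine continuous_of_dominated (bound := fun _ => (1 : ℝ)) (fun z => (by fun_prop))
    (fun z => ae_of_all _ fun u => ?_) (integrable_const _) (ae_of_all _ fun t => by fun_prop)
  rw [norm_neg, norm_mul, norm_eq_abs, norm_eq_abs, abs_of_pos (gaussianPDFReal_std_pos _)]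
  exact abs_mul_gaussianPDFReal_le_one _

lemma integral_mixDensity : Integrable (mixDensity G) ∧ ∫ x, mixDensity G x = 1 := by
  have h := integral_conv continuous_gaussianPDFReal_std (integrable_gaussianPDFReal 0 1) G
  rw [integral_gaussianPDFReal_eq_one 0 one_ne_zero] at h
  exact h

lemma integral_mixSq : Integrable (mixSq G) ∧ ∫ x, mixSq G x = 1 := by
  have := continuous_gaussianPDFReal_std
  have h := integral_conv (h := fun z => z ^ 2 * gaussianPDFReal 0 1 z) (by fun_prop)
    integrable_sq_mul_gaussianPDFReal G
  rw [integral_sq_mul_gaussianPDFReal] at h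
  exact h

lemma integral_abs_mixDeriv_le : Integrable (mixDeriv G) ∧ ∫ x, |mixDeriv G x| ≤ 1 := by
  have := continuous_gaussianPDFReal_std
  have h := integral_conv (h := fun z => |z| * gaussianPDFReal 0 1 z) (by fun_prop) (by
    refine integrable_mul_gaussianPDFReal.norm.congr (ae_of_all _ fun z => ?_)
    simp only [norm_mul, norm_eq_abs, abs_of_pos (gaussianPDFReal_std_pos _)]) G
  have hle : ∀ x, |mixDeriv G x| ≤ ∫ u, |x - u| * gaussianPDFReal 0 1 (x - u) ∂G := by
    intro x
    rw [← norm_eq_abs]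
    refine (norm_integral_le_integral_norm _).trans (le_of_eq ?_)
    congr 1; ext u
    simp only [norm_neg, norm_mul, norm_eq_abs, abs_of_pos (gaussianPDFReal_std_pos _)]
  refine ⟨h.1.mono' (continuous_mixDeriv G).aestronglyMeasurable (ae_of_all _ hle), ?_⟩
  calc _ ≤ ∫ x, ∫ u, |x - u| * gaussianPDFReal 0 1 (x - u) ∂G :=
        integral_mono_of_nonneg (ae_of_all _ fun x => abs_nonneg _) h.1 (ae_of_all _ hle)
    _ ≤ 1 := by rw [h.2]; exact integral_abs_mul_gaussianPDFReal_le

/-- The posterior second moment of the displacement by `c`. -/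
lemma integral_add_sq_mul (c x : ℝ) :
    ∫ u, (c + (x - u)) ^ 2 * gaussianPDFReal 0 1 (x - u) ∂G
      = c ^ 2 * mixDensity G x - 2 * c * mixDeriv G x + mixSq G x := by
  have e : ∀ u : ℝ, (c + (x - u)) ^ 2 * gaussianPDFReal 0 1 (x - u)
      = c ^ 2 * gaussianPDFReal 0 1 (x - u) + 2 * c * ((x - u) * gaussianPDFReal 0 1 (x - u))
        + (x - u) ^ 2 * gaussianPDFReal 0 1 (x - u) := by intro u; ring
  simp_rw [e]
  have h1 := (integrable_mixDensity_integrand G x).const_mul (c ^ 2)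
  have h2 := (integrable_mixDeriv_integrand G x).const_mul (2 * c)
  have h12 : Integrable (fun u => c ^ 2 * gaussianPDFReal 0 1 (x - u)
      + 2 * c * ((x - u) * gaussianPDFReal 0 1 (x - u))) G := h1.add h2
  rw [integral_add h12 (integrable_mixSq_integrand G x), integral_add h1 h2,
    integral_const_mul, integral_const_mul, mixDensity, mixDeriv, mixSq, integral_neg]
  ring

lemma integrable_add_sq_mul (c x : ℝ) :
    Integrable (fun u => (c + (x - u)) ^ 2 * gaussianPDFReal 0 1 (x - u)) G := by
  have e : ∀ u : ℝ, (c + (x - u)) ^ 2 * gaussianPDFReal 0 1 (x - u)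
      = c ^ 2 * gaussianPDFReal 0 1 (x - u) + 2 * c * ((x - u) * gaussianPDFReal 0 1 (x - u))
        + (x - u) ^ 2 * gaussianPDFReal 0 1 (x - u) := by intro u; ring
  simp_rw [e]
  exact (((integrable_mixDensity_integrand G x).const_mul (c ^ 2)).add
    ((integrable_mixDeriv_integrand G x).const_mul (2 * c))).add (integrable_mixSq_integrand G x)

/-- Nonnegativity of the posterior variance. Given the observation `x`, the displacement `x - u` has
posterior mean `-mixDeriv/mixDensity` and posterior second moment `mixSq/mixDensity`. -/
lemma mixDeriv_sq_div_le (x : ℝ) : mixDeriv G x ^ 2 / mixDensity G x ≤ mixSq G x := by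
  have hf := mixDensity_pos G x
  have h0 : 0 ≤ ∫ u, (mixDeriv G x / mixDensity G x + (x - u)) ^ 2 * gaussianPDFReal 0 1 (x - u) ∂G :=
    integral_nonneg fun u => mul_nonneg (sq_nonneg _) (gaussianPDFReal_std_pos _).le
  rw [integral_add_sq_mul] at h0
  have e : (mixDeriv G x / mixDensity G x) ^ 2 * mixDensity G x
      - 2 * (mixDeriv G x / mixDensity G x) * mixDeriv G x = -(mixDeriv G x ^ 2 / mixDensity G x) := by
    field_simp; ring
  linarith

/-- Gaussian smoothing with unit variance bounds the Fisher information by one: it is dominated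
pointwise by `mixSq`, which has total mass one. -/
lemma integral_fisher : Integrable (fun x => mixDeriv G x ^ 2 / mixDensity G x) ∧
    ∫ x, mixDeriv G x ^ 2 / mixDensity G x ≤ 1 := by
  have hle : ∀ x, mixDeriv G x ^ 2 / mixDensity G x ≤ mixSq G x := mixDeriv_sq_div_le G
  have h0 : ∀ x, 0 ≤ mixDeriv G x ^ 2 / mixDensity G x := fun x =>
    div_nonneg (sq_nonneg _) (mixDensity_pos G x).le
  have hm : Measurable fun x => mixDeriv G x ^ 2 / mixDensity G x :=
    ((continuous_mixDeriv G).measurable.pow_const 2).div (continuous_mixDensity G).measurable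
  refine ⟨(integral_mixSq G).1.mono' hm.aestronglyMeasurable (ae_of_all _ fun x => ?_), ?_⟩
  · rw [norm_eq_abs, abs_of_nonneg (h0 x)]; exact hle x
  · rw [← (integral_mixSq G).2]
    exact integral_mono_of_nonneg (ae_of_all _ h0) (integral_mixSq G).1 (ae_of_all _ hle)

/-- Jensen's inequality for the concave function `-p log p`, since `(x-u)² = -2 log p` with `p =
e^{-(x-u)²/2}`. It is proved through the tangent at the mean `q`: the term `2(q - p)` integrates to
zero. -/
lemma mixSq_le (x : ℝ) : mixSq G x ≤ mixDensity G x * (-Real.log (2 * π * mixDensity G x ^ 2)) := by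
  set q := ∫ u, rexp (-(x - u) ^ 2 / 2) ∂G with hq
  have hqf : √(2 * π) * mixDensity G x = q := sqrt_mul_mixDensity_eq G x
  have hqpos : 0 < q := by rw [← hqf]; exact mul_pos (by positivity) (mixDensity_pos G x)
  have hlog : Real.log (2 * π * mixDensity G x ^ 2) = 2 * Real.log q := by
    rw [← hqf, show 2 * π * mixDensity G x ^ 2 = (√(2 * π) * mixDensity G x) ^ 2 by
      rw [mul_pow, Real.sq_sqrt (by positivity)], Real.log_pow]
    norm_num
  have key : ∀ u : ℝ, (x - u) ^ 2 * rexp (-(x - u) ^ 2 / 2)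
      ≤ 2 * (q - rexp (-(x - u) ^ 2 / 2)) + (-2 * Real.log q) * rexp (-(x - u) ^ 2 / 2) := by
    intro u
    set p := rexp (-(x - u) ^ 2 / 2) with hp
    have hp0 : 0 < p := exp_pos _
    have hlp : Real.log p = -(x - u) ^ 2 / 2 := Real.log_exp _
    have h1 : Real.log (q / p) ≤ q / p - 1 := Real.log_le_sub_one_of_pos (div_pos hqpos hp0)
    rw [Real.log_div hqpos.ne' hp0.ne', hlp] at h1
    have h2 : p * (q / p) = q := by field_simp
    nlinarith
  have hE := integrable_exp_sub G x
  have hS : Integrable (fun u => (x - u) ^ 2 * rexp (-(x - u) ^ 2 / 2)) G := by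
    refine ((integrable_mixSq_integrand G x).const_mul (√(2 * π))).congr (ae_of_all _ fun u => ?_)
    simp only [gaussianPDFReal_std]
    field_simp
  have hD : Integrable (fun u => 2 * (q - rexp (-(x - u) ^ 2 / 2))) G :=
    ((integrable_const q).sub hE).const_mul 2
  have h := integral_mono hS (hD.add (hE.const_mul (-2 * Real.log q))) key
  simp only [Pi.add_apply] at h
  rw [integral_add hD (hE.const_mul _), integral_const_mul,
    integral_const_mul, integral_sub (integrable_const q) hE, ← hq] at h
  simp only [integral_const, probReal_univ, smul_eq_mul, one_mul, sub_self, mul_zero, zero_add] at h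
  have hm : mixSq G x = (√(2 * π))⁻¹ * ∫ u, (x - u) ^ 2 * rexp (-(x - u) ^ 2 / 2) ∂G := by
    rw [mixSq, ← integral_const_mul]; congr 1; ext u; rw [gaussianPDFReal_std]; ring
  rw [hm, hlog]
  calc _ ≤ (√(2 * π))⁻¹ * (-2 * Real.log q * q) := by gcongr
    _ = _ := by rw [← hqf]; field_simp

/-- Here `ρ² < 1/(2π) < 1/e`. So `L > 1`, and `ρ²` lies in the range where `t ↦ -t log t` increases.
-/
lemma neg_log_sq_gt_one {ρ : ℝ} (hρ : 0 < ρ) (hρ1 : ρ < 1 / √(2 * π)) : 1 < -Real.log (ρ ^ 2) := by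
  have h1 : ρ ^ 2 < 1 / (2 * π) := by
    have := pow_lt_pow_left₀ hρ1 hρ.le two_ne_zero
    rwa [div_pow, one_pow, Real.sq_sqrt (by positivity)] at this
  rw [← Real.log_inv, Real.lt_log_iff_exp_lt (by positivity)]
  have h2 : rexp 1 < 2 * π := by linarith [exp_one_lt_d9, pi_gt_three]
  refine h2.trans ?_
  rw [lt_inv_comm₀ (by positivity) (by positivity), ← one_div]
  exact h1

/-- The regularized score of a Gaussian mixture is bounded by `√(-log ρ²)`. -/
lemma abs_mixDeriv_le {ρ : ℝ} (hρ : 0 < ρ) (hρ1 : ρ < 1 / √(2 * π)) (x : ℝ) :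
    |mixDeriv G x| ≤ √(-Real.log (ρ ^ 2)) * max (mixDensity G x) ρ := by
  have hL := neg_log_sq_gt_one hρ hρ1
  have hf := mixDensity_pos G x
  set f := mixDensity G x with hfdef
  have h1 : mixDeriv G x ^ 2 ≤ f ^ 2 * (-Real.log (2 * π * f ^ 2)) := by
    have h2 := mixDeriv_sq_div_le G x
    rw [div_le_iff₀ hf] at h2
    have h3 := mixSq_le G x
    rw [← hfdef] at h3
    nlinarith
  have h2 : -Real.log (2 * π * f ^ 2) ≤ -Real.log (f ^ 2) := by
    rw [neg_le_neg_iff]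
    apply Real.log_le_log (by positivity)
    nlinarith [pi_gt_three, sq_nonneg f]
  have h3 : mixDeriv G x ^ 2 ≤ f ^ 2 * (-Real.log (f ^ 2)) := h1.trans (by gcongr)
  have hM : 0 < max f ρ := lt_max_of_lt_left hf
  have h4 : mixDeriv G x ^ 2 ≤ (√(-Real.log (ρ ^ 2)) * max f ρ) ^ 2 := by
    rw [mul_pow, Real.sq_sqrt (by linarith)]
    rcases le_total ρ f with h | h
    · rw [max_eq_left h]
      have : Real.log (ρ ^ 2) ≤ Real.log (f ^ 2) := Real.log_le_log (by positivity) (by gcongr)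
      nlinarith [sq_nonneg f]
    · rw [max_eq_right h]
      -- Below the threshold, `-t log t` at `t = f²` is compared with its value at `ρ²`; this
      -- inequality and `-log ρ² > 1` replace a monotonicity argument.
      have h5 : Real.log (ρ ^ 2 / f ^ 2) ≤ ρ ^ 2 / f ^ 2 - 1 := Real.log_le_sub_one_of_pos (by positivity)
      rw [Real.log_div (by positivity) (by positivity)] at h5
      have h6 : f ^ 2 * (ρ ^ 2 / f ^ 2) = ρ ^ 2 := by field_simp
      have h7 : f ^ 2 ≤ ρ ^ 2 := by gcongr
      nlinarith [sq_nonneg f, mul_nonneg (sub_nonneg.2 h7) (sub_nonneg.2 hL.le), mul_le_mul_of_nonneg_left h5 (sq_nonneg f)]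
  exact abs_le_of_sq_le_sq h4 (by positivity)

/-- For fixed `x`, integration over the parameter leaves the quadratic `c² f - 2 c f₁ + mixSq` in `c
= t x - x`. Its minimum, at `c = f₁/f`, is `mixSq - f₁²/f`, and `mixSq` integrates to one. -/
lemma le_risk (t : ℝ → ℝ) (ht : Measurable t) :
    ENNReal.ofReal (1 - ∫ x, mixDeriv G x ^ 2 / mixDensity G x) ≤ risk t G := by
  have hcont := continuous_gaussianPDFReal_std
  have h1 : risk t G = ∫⁻ x, ∫⁻ θ, ENNReal.ofReal ((t x - θ) ^ 2 * gaussianPDFReal 0 1 (x - θ)) ∂G := by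
    unfold risk
    have e : ∀ θ : ℝ, ∫⁻ x, ENNReal.ofReal ((t x - θ) ^ 2) ∂(gaussianReal θ 1)
        = ∫⁻ x, ENNReal.ofReal ((t x - θ) ^ 2 * gaussianPDFReal 0 1 (x - θ)) := by
      intro θ
      rw [gaussianReal_of_var_ne_zero _ one_ne_zero, lintegral_withDensity_eq_lintegral_mul _
        (measurable_gaussianPDF _ _) (by fun_prop)]
      congr 1; ext x
      rw [Pi.mul_apply, gaussianPDF, gaussianPDFReal_one_eq, mul_comm, ← ENNReal.ofReal_mul (sq_nonneg _)]
    simp_rw [e]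
    rw [lintegral_lintegral_swap]
    have := hcont.measurable
    fun_prop
  have hs : Integrable (fun x => mixSq G x - mixDeriv G x ^ 2 / mixDensity G x) :=
    (integral_mixSq G).1.sub (integral_fisher G).1
  rw [h1, ← (integral_mixSq G).2, ← integral_sub (integral_mixSq G).1 (integral_fisher G).1,
    ofReal_integral_eq_lintegral_ofReal hs
      (ae_of_all _ fun x => sub_nonneg.2 (mixDeriv_sq_div_le G x))]
  refine lintegral_mono fun x => ?_
  have e2 : ∀ θ : ℝ, (t x - θ) ^ 2 = ((t x - x) + (x - θ)) ^ 2 := by intro θ; ring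
  simp_rw [e2]
  rw [← ofReal_integral_eq_lintegral_ofReal (integrable_add_sq_mul G _ x)
    (ae_of_all _ fun u => mul_nonneg (sq_nonneg _) (gaussianPDFReal_std_pos _).le), integral_add_sq_mul]
  apply ENNReal.ofReal_le_ofReal
  have hf := mixDensity_pos G x
  have h2 : 0 ≤ ((t x - x) - mixDeriv G x / mixDensity G x) ^ 2 * mixDensity G x := by positivity
  have h3 : ((t x - x) - mixDeriv G x / mixDensity G x) ^ 2 * mixDensity G x
      = (t x - x) ^ 2 * mixDensity G x - 2 * (t x - x) * mixDeriv G x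
        + mixDeriv G x ^ 2 / mixDensity G x := by field_simp; ring
  linarith

lemma one_sub_fisher_le_optRisk :
    1 - ∫ x, mixDeriv G x ^ 2 / mixDensity G x ≤ (optRisk G).toReal := by
  have h : ENNReal.ofReal (1 - ∫ x, mixDeriv G x ^ 2 / mixDensity G x) ≤ optRisk G :=
    le_iInf₂ fun t ht => le_risk G t ht
  exact (ENNReal.ofReal_le_iff_le_toReal ((optRisk_le_one G).trans_lt ENNReal.one_lt_top).ne).1 h

end

end EBMeans

/-! ### The model: product structure and integration of one coordinate -/

namespace EBMeans

open Real

noncomputable section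

/-- The Markov kernel `u ↦ N(u, 1)`. -/
def normalShift : Kernel ℝ ℝ :=
  ⟨fun u => gaussianReal u 1, by
    exact measurable_gaussianReal.comp (measurable_id.prodMk measurable_const)⟩

end

lemma normalShift_apply (u : ℝ) : normalShift u = gaussianReal u 1 := rfl

instance : IsMarkovKernel normalShift := ⟨fun u => by rw [normalShift_apply]; infer_instance⟩

section

variable {Ω : Type*} [MeasurableSpace Ω] {P : Measure Ω} [IsProbabilityMeasure P] {n : ℕ}
  {θ X : Fin n → Ω → ℝ}

/-- On boxes: given `θ`, the probability of a box is a product of functions of the single `θ k`, and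
independence of the `θ k` factorizes its expectation. -/
lemma IsNormalMeansModel.map_eq_pi (h : IsNormalMeansModel θ X P) (hi : iIndepFun θ P) :
    P.map (fun ω k => (θ k ω, X k ω)) = Measure.pi fun k => (P.map (θ k)) ⊗ₘ normalShift := by
  have hθ := h.measurable_mean
  have hX := h.measurable_obs
  have : ∀ k, IsProbabilityMeasure (P.map (θ k)) := fun k =>
    Measure.isProbabilityMeasure_map (hθ k).aemeasurable
  refine (Measure.pi_eq fun S hS => ?_).symm
  set T : Set ((Fin n → ℝ) × (Fin n → ℝ)) := {p | ∀ k, (p.1 k, p.2 k) ∈ S k} with hT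
  have hTm : MeasurableSet T := by
    rw [hT, Set.ofPred_forall]
    refine MeasurableSet.iInter fun k => ?_
    exact (by fun_prop : Measurable fun p : (Fin n → ℝ) × (Fin n → ℝ) => (p.1 k, p.2 k)) (hS k)
  have hθm : Measurable fun ω k => θ k ω := measurable_pi_lambda _ hθ
  have hXm : Measurable fun ω k => X k ω := measurable_pi_lambda _ hX
  have h1 : P.map (fun ω k => (θ k ω, X k ω)) (Set.univ.pi S)
      = P.map (fun ω => ((fun k => θ k ω), (fun k => X k ω))) T := by
    rw [Measure.map_apply (by fun_prop) (MeasurableSet.univ_pi hS),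
      Measure.map_apply (by fun_prop) hTm]
    congr 1; ext ω; simp [hT]
  rw [h1, ← compProd_map_condDistrib hXm.aemeasurable, Measure.compProd_apply hTm]
  have h2 : ∀ᵐ t ∂(P.map fun ω k => θ k ω),
      condDistrib (fun ω k => X k ω) (fun ω k => θ k ω) P t (Prod.mk t ⁻¹' T)
        = ∏ k, normalShift (t k) (Prod.mk (t k) ⁻¹' S k) := by
    filter_upwards [h.condLaw] with t ht
    rw [ht]
    have : Prod.mk t ⁻¹' T = Set.univ.pi fun k => Prod.mk (t k) ⁻¹' S k := by
      ext x; simp [hT]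
    rw [this, Measure.pi_pi]
    rfl
  rw [lintegral_congr_ae h2]
  have hg : ∀ k, Measurable fun u : ℝ => normalShift u (Prod.mk u ⁻¹' S k) := fun k =>
    Kernel.measurable_kernel_prodMk_left (hS k)
  rw [lintegral_map (by
    refine Finset.measurable_prod _ fun k _ => ?_
    exact (hg k).comp (measurable_pi_apply k)) hθm]
  have h3 := lintegral_prod_eq_prod_lintegral_of_indepFun Finset.univ
    (fun k ω => normalShift (θ k ω) (Prod.mk (θ k ω) ⁻¹' S k))
    (hi.comp (fun k u => normalShift u (Prod.mk u ⁻¹' S k)) hg) (fun k => (hg k).comp (hθ k))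
  rw [h3]
  refine Finset.prod_congr rfl fun k _ => ?_
  rw [Measure.compProd_apply (hS k), lintegral_map (hg k) (hθ k)]

lemma IsNormalMeansModel.map_pair (h : IsNormalMeansModel θ X P) (hi : iIndepFun θ P) (k : Fin n) :
    P.map (fun ω => (θ k ω, X k ω)) = (P.map (θ k)) ⊗ₘ normalShift := by
  have hθ := h.measurable_mean
  have hX := h.measurable_obs
  have : ∀ k, IsProbabilityMeasure (P.map (θ k)) := fun k =>
    Measure.isProbabilityMeasure_map (hθ k).aemeasurable
  have h1 := (measurePreserving_eval (fun k => (P.map (θ k)) ⊗ₘ normalShift) k).map_eq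
  rw [← h.map_eq_pi hi, Measure.map_map (measurable_pi_apply k) (by fun_prop)] at h1
  exact h1

lemma IsNormalMeansModel.iIndepFun_pair (h : IsNormalMeansModel θ X P) (hi : iIndepFun θ P) :
    iIndepFun (fun k ω => (θ k ω, X k ω)) P := by
  have hθ := h.measurable_mean
  have hX := h.measurable_obs
  rw [iIndepFun_iff_map_fun_eq_pi_map (fun k => by fun_prop)]
  simp_rw [h.map_pair hi]
  exact h.map_eq_pi hi

lemma IsNormalMeansModel.iIndepFun_obs (h : IsNormalMeansModel θ X P) (hi : iIndepFun θ P) :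
    iIndepFun X P :=
  (h.iIndepFun_pair hi).comp (fun _ p => p.2) fun _ => measurable_snd

/-- Overwriting coordinate `k` by `0` encodes the sample without its `k`-th observation while
keeping the index type `Fin n`. -/
lemma IsNormalMeansModel.indepFun_update (h : IsNormalMeansModel θ X P) (hi : iIndepFun θ P)
    (k : Fin n) :
    IndepFun (fun ω => (θ k ω, X k ω)) (fun ω => Function.update (fun j => X j ω) k 0) P := by
  have hθ := h.measurable_mean
  have hX := h.measurable_obs
  have h1 := (h.iIndepFun_pair hi).indepFun_finset {k} (Finset.univ.erase k)
    (by simp) (fun k => by fun_prop)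
  have hφ : Measurable fun w : ↥({k} : Finset (Fin n)) → ℝ × ℝ =>
      w ⟨k, Finset.mem_singleton_self k⟩ := measurable_pi_apply _
  have hψ : Measurable fun (w : ↥(Finset.univ.erase k) → ℝ × ℝ) (j : Fin n) =>
      if hj : j ∈ Finset.univ.erase k then (w ⟨j, hj⟩).2 else 0 := by
    refine measurable_pi_lambda _ fun j => ?_
    by_cases hj : j ∈ Finset.univ.erase k
    · simp only [hj, dite_true]; fun_prop
    · simp only [hj, dite_false]; fun_prop
  have h2 := h1.comp hφ hψ
  have e : (fun ω => Function.update (fun j => X j ω) k 0)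
      = (fun (w : ↥(Finset.univ.erase k) → ℝ × ℝ) (j : Fin n) =>
          if hj : j ∈ Finset.univ.erase k then (w ⟨j, hj⟩).2 else 0)
        ∘ fun ω i => (θ (↑i) ω, X (↑i) ω) := by
    funext ω j
    by_cases hj : j = k
    · subst hj; simp
    · simp [hj]
  rw [e]
  exact h2

/-- Integration of a function of `X_k - θ_k`, `X_k` and of the observations other than `X_k`. -/
lemma IsNormalMeansModel.integral_eq_of_update (h : IsNormalMeansModel θ X P) (hi : iIndepFun θ P)
    (k : Fin n) {H : ℝ → (Fin n → ℝ) → ℝ} (hH : Measurable (Function.uncurry H)) {C : ℝ}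
    (hC : ∀ x w, |H x w| ≤ C) (hu : ∀ x w y, H x (Function.update w k y) = H x w)
    {g : ℝ → ℝ} (hg : Continuous g) (hgi : Integrable fun z => g z * gaussianPDFReal 0 1 z) :
    Integrable (fun ω => H (X k ω) (fun j => X j ω) * g (X k ω - θ k ω)) P ∧
    Integrable (fun x => (∫ ω, H x (fun j => X j ω) ∂P)
      * ∫ u, g (x - u) * gaussianPDFReal 0 1 (x - u) ∂(P.map (θ k))) ∧
    ∫ ω, H (X k ω) (fun j => X j ω) * g (X k ω - θ k ω) ∂P
      = ∫ x, (∫ ω, H x (fun j => X j ω) ∂P)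
          * ∫ u, g (x - u) * gaussianPDFReal 0 1 (x - u) ∂(P.map (θ k)) := by
  have hθ := h.measurable_mean
  have hX := h.measurable_obs
  have hXm : Measurable fun ω k => X k ω := measurable_pi_lambda _ hX
  set μ := P.map (θ k) with hμ
  have hprob : IsProbabilityMeasure μ := Measure.isProbabilityMeasure_map (hθ k).aemeasurable
  set ν := μ ⊗ₘ normalShift with hν
  set V : Ω → (Fin n → ℝ) := fun ω => Function.update (fun j => X j ω) k 0 with hV
  have hVm : Measurable V := by
    refine measurable_pi_lambda _ fun j => ?_
    by_cases hj : j = k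
    · subst hj; simp [hV]
    · simp only [hV, Function.update_of_ne hj]; exact hX j
  set W : Ω → ℝ × ℝ := fun ω => (θ k ω, X k ω) with hW
  have hWm : Measurable W := (hθ k).prodMk (hX k)
  have hWlaw : P.map W = ν := h.map_pair hi k
  have hlaw : P.map (fun ω => (W ω, V ω)) = ν.prod (P.map V) := by
    rw [(indepFun_iff_map_prod_eq_prod_map_map hWm.aemeasurable hVm.aemeasurable).1
      (h.indepFun_update hi k), hWlaw]
  have : IsProbabilityMeasure (P.map V) := Measure.isProbabilityMeasure_map hVm.aemeasurable
  have hgm : Measurable g := hg.measurable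
  have hphi := continuous_gaussianPDFReal_std
  have hnorm : ∀ u : ℝ, Integrable (fun x => g (x - u) * gaussianPDFReal 0 1 (x - u)) := fun u =>
    hgi.comp_sub_right u
  have hshift : ∀ u : ℝ, ∀ f : ℝ → ℝ, Integrable f (gaussianReal u 1) ↔
      Integrable fun x => f x * gaussianPDFReal 0 1 (x - u) := by
    intro u f
    rw [gaussianReal_of_var_ne_zero u one_ne_zero, integrable_withDensity_iff
      (measurable_gaussianPDF _ _) (ae_of_all _ fun x => gaussianPDF_lt_top)]
    simp only [toReal_gaussianPDF, gaussianPDFReal_one_eq u]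
  have hshift2 : ∀ u : ℝ, ∀ f : ℝ → ℝ, ∫ x, f x ∂(gaussianReal u 1)
      = ∫ x, f x * gaussianPDFReal 0 1 (x - u) := by
    intro u f
    rw [integral_gaussianReal_eq_integral_smul one_ne_zero]
    congr 1; ext x
    rw [smul_eq_mul, gaussianPDFReal_one_eq u, mul_comm]
  have hgν : Integrable (fun p : ℝ × ℝ => g (p.2 - p.1)) ν := by
    rw [hν, Measure.integrable_compProd_iff (Measurable.aestronglyMeasurable (by fun_prop))]
    refine ⟨ae_of_all _ fun u => ?_, ?_⟩
    · rw [normalShift_apply, hshift]; exact hnorm u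
    · have e : ∀ u : ℝ, ∫ x, ‖g (x - u)‖ ∂(normalShift u) = ∫ x, ‖g x‖ * gaussianPDFReal 0 1 x := by
        intro u
        rw [normalShift_apply, hshift2]
        exact integral_sub_right_eq_self (fun x => ‖g x‖ * gaussianPDFReal 0 1 x) u
      simp only [e]
      exact integrable_const _
  set Hb : ℝ → ℝ := fun x => ∫ ω, H x (fun j => X j ω) ∂P with hHb
  have hHbm : Measurable Hb := by
    have : StronglyMeasurable (fun p : ℝ × Ω => H p.1 (fun j => X j p.2)) := by
      refine Measurable.stronglyMeasurable ?_
      exact hH.comp (measurable_fst.prodMk (hXm.comp measurable_snd))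
    exact this.integral_prod_right.measurable
  have hHbC : ∀ x, |Hb x| ≤ C := by
    intro x
    have := norm_integral_le_of_norm_le_const (μ := P) (C := C) (f := fun ω => H x (fun j => X j ω))
      (ae_of_all _ fun ω => hC _ _)
    simpa [hHb] using this
  have hHV : ∀ x, ∫ v, H x v ∂(P.map V) = Hb x := by
    intro x
    rw [integral_map hVm.aemeasurable (Measurable.aestronglyMeasurable (by
      exact hH.comp (measurable_const.prodMk measurable_id)))]
    simp only [hV, hu, hHb]
  have hF : Measurable (fun q : (ℝ × ℝ) × (Fin n → ℝ) => H q.1.2 q.2 * g (q.1.2 - q.1.1)) := by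
    refine Measurable.mul ?_ (by fun_prop)
    exact hH.comp (by fun_prop : Measurable fun q : (ℝ × ℝ) × (Fin n → ℝ) => (q.1.2, q.2))
  have hFi : Integrable (fun q : (ℝ × ℝ) × (Fin n → ℝ) => H q.1.2 q.2 * g (q.1.2 - q.1.1))
      (ν.prod (P.map V)) := by
    have h1 : Integrable (fun q : (ℝ × ℝ) × (Fin n → ℝ) => C * |g (q.1.2 - q.1.1)|)
        (ν.prod (P.map V)) := by
      have := (hgν.abs.comp_fst (P.map V)).const_mul C
      exact this
    refine h1.mono' hF.aestronglyMeasurable (ae_of_all _ fun q => ?_)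
    rw [norm_mul, norm_eq_abs, norm_eq_abs]
    exact mul_le_mul_of_nonneg_right (hC _ _) (abs_nonneg _)
  -- Since `H` ignores coordinate `k`, the full sample can be exchanged for `V`, which is
  -- independent of the `k`-th pair.
  have hcomp : (fun ω => H (X k ω) (fun j => X j ω) * g (X k ω - θ k ω))
      = (fun q : (ℝ × ℝ) × (Fin n → ℝ) => H q.1.2 q.2 * g (q.1.2 - q.1.1)) ∘ fun ω => (W ω, V ω) := by
    ext ω
    simp only [Function.comp, hV, hW, hu]
  have hI1 : Integrable (fun ω => H (X k ω) (fun j => X j ω) * g (X k ω - θ k ω)) P := by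
    rw [hcomp, ← integrable_map_measure (by rw [hlaw]; exact hF.aestronglyMeasurable)
      (hWm.prodMk hVm).aemeasurable, hlaw]
    exact hFi
  have hprod : Integrable (fun p : ℝ × ℝ => Hb p.1 * (g (p.1 - p.2) * gaussianPDFReal 0 1 (p.1 - p.2)))
      (volume.prod μ) := by
    have h0 : Integrable (fun p : ℝ × ℝ => g (p.1 - p.2) * gaussianPDFReal 0 1 (p.1 - p.2))
        (volume.prod μ) := by
      rw [integrable_prod_iff' (Continuous.aestronglyMeasurable (by fun_prop))]
      refine ⟨ae_of_all _ fun u => hnorm u, ?_⟩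
      have : ∀ u : ℝ, ∫ x, ‖g (x - u) * gaussianPDFReal 0 1 (x - u)‖
          = ∫ x, ‖g x * gaussianPDFReal 0 1 x‖ := fun u =>
        integral_sub_right_eq_self (fun x => ‖g x * gaussianPDFReal 0 1 x‖) u
      simp_rw [this]
      exact integrable_const _
    refine (h0.abs.const_mul C).mono' ?_ (ae_of_all _ fun p => ?_)
    · exact (hHbm.comp measurable_fst).aestronglyMeasurable.mul h0.aestronglyMeasurable
    · rw [norm_mul, norm_eq_abs, norm_eq_abs]
      exact mul_le_mul_of_nonneg_right (hHbC _) (abs_nonneg _)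
  refine ⟨hI1, ?_, ?_⟩
  · have := hprod.integral_prod_left
    simp_rw [integral_const_mul] at this
    exact this
  · have e1 : ∫ ω, H (X k ω) (fun j => X j ω) * g (X k ω - θ k ω) ∂P
        = ∫ q, H q.1.2 q.2 * g (q.1.2 - q.1.1) ∂(ν.prod (P.map V)) := by
      rw [← hlaw, integral_map (hWm.prodMk hVm).aemeasurable
        (by exact hF.aestronglyMeasurable), hcomp]
      rfl
    rw [e1, integral_prod _ hFi]
    simp_rw [integral_mul_const, hHV]
    have hgν2 : Integrable (fun p : ℝ × ℝ => Hb p.2 * g (p.2 - p.1)) ν := by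
      refine (hgν.abs.const_mul C).mono' ?_ (ae_of_all _ fun p => ?_)
      · exact (hHbm.comp measurable_snd).aestronglyMeasurable.mul hgν.aestronglyMeasurable
      · rw [norm_mul, norm_eq_abs, norm_eq_abs]
        exact mul_le_mul_of_nonneg_right (hHbC _) (abs_nonneg _)
    rw [hν, Measure.integral_compProd hgν2]
    simp_rw [normalShift_apply, hshift2]
    simp_rw [← integral_const_mul, mul_assoc]
    rw [← integral_integral_swap (f := fun x u => Hb x * (g (x - u) * gaussianPDFReal 0 1 (x - u)))]
    exact hprod

end

end EBMeans

/-! ### Deterministic inequalities for regularized scores -/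

namespace EBMeans

/-- Comparison of the squared errors of two regularized scores `g₁ / max g ρ`, `f₁ / max f ρ` as
estimates of the score `f₁ / f`. -/
lemma regularized_score_sq_sub_le {f f₁ g g₁ ρ L : ℝ} (hf : 0 < f) (hρ : 0 < ρ) (hL : 0 ≤ L)
    (hf₁ : |f₁| ≤ L * max f ρ) :
    (g₁ / max g ρ - f₁ / f) ^ 2 * f - (f₁ / f) ^ 2 * (1 - f / max f ρ) ^ 2 * f
      ≤ (|g₁ - f₁| + L * |g - f|) ^ 2 / ρ * (1 + |g - f| / ρ)
        + 2 * ((g₁ - f₁) * (f₁ * (f / max f ρ - 1) / max f ρ)) := by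
  obtain ⟨e, rfl⟩ : ∃ e, g₁ = f₁ + e := ⟨g₁ - f₁, by ring⟩
  rw [add_sub_cancel_left]
  have hM : 0 < max g ρ := lt_max_of_lt_right hρ
  have hMρ : ρ ≤ max g ρ := le_max_right _ _
  have hd : |max g ρ - max f ρ| ≤ |g - f| := abs_max_sub_max_le_abs _ _ _
  set δ := g - f with hδ
  have hQ : 0 ≤ |e| + L * |δ| := by positivity
  rcases le_or_gt ρ f with h | h
  · rw [max_eq_left h, div_self hf.ne'] at *
    simp only [sub_self, mul_zero, zero_div, ne_eq, OfNat.ofNat_ne_zero, not_false_eq_true, zero_pow,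
      zero_mul, sub_zero, add_zero]
    set M := max g ρ
    -- When `ρ ≤ f` the regularization is inactive at `f`: the term to be subtracted and the linear
    -- term both vanish, and `|f₁|/f ≤ L`.
    have h1 : (f₁ + e) / M - f₁ / f = (e + f₁ / f * (f - M)) / M := by field_simp; ring
    have h2 : |e + f₁ / f * (f - M)| ≤ |e| + L * |δ| := by
      refine (abs_add_le _ _).trans ?_
      rw [abs_mul, abs_sub_comm f M, abs_div, abs_of_pos hf]
      have : |f₁| / f ≤ L := (div_le_iff₀ hf).2 hf₁
      gcongr
    have h3 : (e + f₁ / f * (f - M)) ^ 2 ≤ (|e| + L * |δ|) ^ 2 := by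
      rw [← sq_abs]; gcongr
    have h4 : f ≤ M + |δ| := by
      have := neg_abs_le (M - f); linarith
    rw [h1, div_pow]
    calc (e + f₁ / f * (f - M)) ^ 2 / M ^ 2 * f ≤ (|e| + L * |δ|) ^ 2 / M ^ 2 * (M + |δ|) := by gcongr
      _ = (|e| + L * |δ|) ^ 2 / M * (1 + |δ| / M) := by field_simp
      _ ≤ _ := by gcongr
  · rw [max_eq_right h.le] at *
    have hbig : (|e| + L * |δ|) ^ 2 / ρ ≤ (|e| + L * |δ|) ^ 2 / ρ * (1 + |δ| / ρ) :=
      le_mul_of_one_le_right (by positivity) (by linarith [div_nonneg (abs_nonneg δ) hρ.le])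
    rcases le_or_gt g ρ with hg | hg
    · rw [max_eq_right hg]
      -- Both denominators equal `ρ`, so only a square in `e` and the linear term survive.
      have h1 : ((f₁ + e) / ρ - f₁ / f) ^ 2 * f - (f₁ / f) ^ 2 * (1 - f / ρ) ^ 2 * f
          = e ^ 2 * f / ρ ^ 2 + 2 * (e * (f₁ * (f / ρ - 1) / ρ)) := by field_simp; ring
      have h2 : e ^ 2 * f / ρ ^ 2 ≤ (|e| + L * |δ|) ^ 2 / ρ := by
        calc e ^ 2 * f / ρ ^ 2 ≤ e ^ 2 * ρ / ρ ^ 2 := by gcongr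
          _ = |e| ^ 2 / ρ := by rw [sq_abs]; field_simp
          _ ≤ _ := by
            gcongr
            have : 0 ≤ L * |δ| := by positivity
            linarith
      linarith
    · rw [max_eq_left hg.le]
      have hg0 : 0 < g := hρ.trans hg
      have hδ0 : 0 < δ := by rw [hδ]; linarith
      have hδa : |δ| = δ := abs_of_pos hδ0
      -- In the mixed case `f < ρ < g` the same linear term is split off. The coefficients of `e²`,
      -- `e f₁` and `f₁²` in the rest are bounded by `1/ρ`, `2δ/ρ²` and `δ²/ρ³`. With `|f₁| ≤ Lρ`
      -- they reassemble into `(|e| + L|δ|)²/ρ`.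
      have h1 : ((f₁ + e) / g - f₁ / f) ^ 2 * f - (f₁ / f) ^ 2 * (1 - f / ρ) ^ 2 * f
          = e ^ 2 * (f / g ^ 2) + 2 * (e * f₁ * ((ρ - f) / ρ ^ 2 - (g - f) / g ^ 2))
            + f₁ ^ 2 * (((g - ρ) / g) * ((g - f) / g + (ρ - f) / ρ) / ρ)
            + 2 * (e * (f₁ * (f / ρ - 1) / ρ)) := by field_simp; ring
      have h2 : e ^ 2 * (f / g ^ 2) ≤ |e| ^ 2 / ρ := by
        rw [sq_abs]
        have : f / g ^ 2 ≤ 1 / ρ := by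
          rw [div_le_div_iff₀ (by positivity) hρ]; nlinarith
        calc _ ≤ e ^ 2 * (1 / ρ) := by gcongr
          _ = _ := by ring
      have h3 : |(ρ - f) / ρ ^ 2 - (g - f) / g ^ 2| ≤ δ / ρ ^ 2 := by
        have a1 : 0 ≤ (ρ - f) / ρ ^ 2 := div_nonneg (by linarith) (by positivity)
        have a2 : 0 ≤ (g - f) / g ^ 2 := div_nonneg (by linarith) (by positivity)
        have a3 : (ρ - f) / ρ ^ 2 ≤ δ / ρ ^ 2 := by
          rw [hδ]; gcongr
        have a4 : (g - f) / g ^ 2 ≤ δ / ρ ^ 2 := by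
          rw [hδ]
          have : 0 ≤ g - f := by linarith
          gcongr
        rw [abs_le]; constructor <;> linarith
      have h4 : e * f₁ * ((ρ - f) / ρ ^ 2 - (g - f) / g ^ 2) ≤ |e| * (L * ρ) * (δ / ρ ^ 2) := by
        refine (le_abs_self _).trans ?_
        rw [abs_mul, abs_mul]
        gcongr
      have h5 : ((g - ρ) / g) * ((g - f) / g + (ρ - f) / ρ) / ρ ≤ δ ^ 2 / ρ ^ 3 := by
        have b1 : (g - ρ) / g ≤ (g - ρ) / ρ := by
          have : 0 ≤ g - ρ := by linarith
          gcongr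
        have b2 : (g - f) / g ≤ (g - f) / ρ := by
          have : 0 ≤ g - f := by linarith
          gcongr
        calc ((g - ρ) / g) * ((g - f) / g + (ρ - f) / ρ) / ρ
            ≤ ((g - ρ) / ρ) * ((g - f) / ρ + (ρ - f) / ρ) / ρ := by
              have c1 : 0 ≤ (g - ρ) / ρ := div_nonneg (by linarith) hρ.le
              have c2 : 0 ≤ (g - f) / g + (ρ - f) / ρ :=
                add_nonneg (div_nonneg (by linarith) hg0.le) (div_nonneg (by linarith) hρ.le)
              gcongr
          _ = (g - ρ) * ((g - f) + (ρ - f)) / ρ ^ 3 := by field_simp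
          _ ≤ δ ^ 2 / ρ ^ 3 := by
              gcongr
              rw [hδ]; nlinarith
      have h6 : f₁ ^ 2 ≤ (L * ρ) ^ 2 := by rw [← sq_abs]; gcongr
      have h7 : f₁ ^ 2 * (((g - ρ) / g) * ((g - f) / g + (ρ - f) / ρ) / ρ)
          ≤ (L * ρ) ^ 2 * (δ ^ 2 / ρ ^ 3) := by
        calc _ ≤ f₁ ^ 2 * (δ ^ 2 / ρ ^ 3) := by gcongr
          _ ≤ _ := by gcongr
      have h8 : |e| ^ 2 / ρ + 2 * (|e| * (L * ρ) * (δ / ρ ^ 2)) + (L * ρ) ^ 2 * (δ ^ 2 / ρ ^ 3)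
          = (|e| + L * |δ|) ^ 2 / ρ := by rw [hδa]; field_simp; ring
      linarith

lemma abs_regularized_score_le {f f₁ g g₁ ρ L : ℝ} (hρ : 0 < ρ) (hL : 0 ≤ L)
    (hf₁ : |f₁| ≤ L * max f ρ) :
    |g₁ / max g ρ| ≤ L + (|g₁ - f₁| + L * |g - f|) / ρ := by
  have hM : 0 < max g ρ := lt_max_of_lt_right hρ
  have hMρ : ρ ≤ max g ρ := le_max_right _ _
  have hd : |max g ρ - max f ρ| ≤ |g - f| := abs_max_sub_max_le_abs _ _ _
  set M := max g ρ
  have h1 : max f ρ ≤ M + |g - f| := by linarith [neg_abs_le (M - max f ρ)]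
  have h2 : |g₁| ≤ |g₁ - f₁| + L * (M + |g - f|) := by
    have := abs_add_le (g₁ - f₁) f₁
    rw [sub_add_cancel] at this
    have h3 : L * max f ρ ≤ L * (M + |g - f|) := by gcongr
    linarith
  rw [abs_div, abs_of_pos hM]
  calc |g₁| / M ≤ (|g₁ - f₁| + L * (M + |g - f|)) / M := by gcongr
    _ = L + (|g₁ - f₁| + L * |g - f|) / M := by field_simp; ring
    _ ≤ _ := by gcongr

/-- Keeping `f₁²/f`, whose integral over `x` is at most one, avoids a factor `L²`. In the
leave-one-out correction such a factor could reach the order of the main term. -/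
lemma sq_regularized_score_mul_le {f f₁ g g₁ ρ : ℝ} (hf : 0 < f) (hρ : 0 < ρ) :
    (g₁ / max g ρ) ^ 2 * f
      ≤ 2 * f * (g₁ - f₁) ^ 2 / ρ ^ 2 + 4 * (f₁ ^ 2 / f) * (1 + (g - f) ^ 2 / ρ ^ 2) := by
  have hM : 0 < max g ρ := lt_max_of_lt_right hρ
  have hMρ : ρ ≤ max g ρ := le_max_right _ _
  have hd : |max g ρ - max f ρ| ≤ |g - f| := abs_max_sub_max_le_abs _ _ _
  set M := max g ρ
  have h1 : f ≤ M + |g - f| := by linarith [neg_abs_le (M - max f ρ), le_max_left f ρ]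
  have h2 : f ^ 2 ≤ 2 * M ^ 2 + 2 * (g - f) ^ 2 := by
    have : f ^ 2 ≤ (M + |g - f|) ^ 2 := by gcongr
    nlinarith [sq_abs (g - f), sq_nonneg (M - |g - f|)]
  have h3 : g₁ ^ 2 ≤ 2 * (g₁ - f₁) ^ 2 + 2 * f₁ ^ 2 := by nlinarith [sq_nonneg (g₁ - 2 * f₁)]
  calc (g₁ / M) ^ 2 * f = g₁ ^ 2 * f / M ^ 2 := by rw [div_pow]; ring
    _ ≤ (2 * (g₁ - f₁) ^ 2 + 2 * f₁ ^ 2) * f / M ^ 2 := by gcongr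
    _ = 2 * f * (g₁ - f₁) ^ 2 / M ^ 2 + 2 * (f₁ ^ 2 / f) * (f ^ 2 / M ^ 2) := by field_simp
    _ ≤ 2 * f * (g₁ - f₁) ^ 2 / M ^ 2 + 2 * (f₁ ^ 2 / f) * ((2 * M ^ 2 + 2 * (g - f) ^ 2) / M ^ 2) := by
        gcongr
    _ = 2 * f * (g₁ - f₁) ^ 2 / M ^ 2 + 4 * (f₁ ^ 2 / f) * (1 + (g - f) ^ 2 / M ^ 2) := by
        field_simp; ring
    _ ≤ _ := by gcongr

/-- Stability of the regularized score under a perturbation of its arguments. -/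
lemma abs_regularized_score_sub_le {g g₁ h h₁ ρ : ℝ} (hρ : 0 < ρ) :
    |h₁ / max h ρ - g₁ / max g ρ| ≤ (|h₁ - g₁| + |g₁ / max g ρ| * |h - g|) / ρ := by
  have hM : 0 < max g ρ := lt_max_of_lt_right hρ
  have hN : 0 < max h ρ := lt_max_of_lt_right hρ
  have hNρ : ρ ≤ max h ρ := le_max_right _ _
  have hd : |max h ρ - max g ρ| ≤ |h - g| := abs_max_sub_max_le_abs _ _ _
  set M := max g ρ
  set N := max h ρ
  have h1 : h₁ / N - g₁ / M = ((h₁ - g₁) - g₁ / M * (N - M)) / N := by field_simp; ring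
  rw [h1, abs_div, abs_of_pos hN]
  calc _ ≤ (|h₁ - g₁| + |g₁ / M| * |h - g|) / N := by
        gcongr
        refine (abs_sub _ _).trans ?_
        rw [abs_mul]; gcongr
    _ ≤ _ := by gcongr

/-! ### Moments of averages of bounded independent variables -/

section

variable {Ω : Type*} [MeasurableSpace Ω] {P : Measure Ω} [IsProbabilityMeasure P]

lemma integrable_of_abs_le {Y : Ω → ℝ} (hY : Measurable Y) {C : ℝ} (hC : ∀ ω, |Y ω| ≤ C) :
    Integrable Y P :=
  (integrable_const C).mono' hY.aestronglyMeasurable (ae_of_all _ hC)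

lemma integrable_pow_of_abs_le {Y : Ω → ℝ} (hY : Measurable Y) {C : ℝ} (hC : ∀ ω, |Y ω| ≤ C)
    (j : ℕ) : Integrable (fun ω => Y ω ^ j) P :=
  integrable_of_abs_le (C := C ^ j) (hY.pow_const j) fun ω => by
    rw [abs_pow]; exact pow_le_pow_left₀ (abs_nonneg _) (hC ω) j

/-- Second and fourth moments of a sum of bounded centred independent variables. -/
lemma moments_sum_of_iIndepFun {ι : Type*} {Y : ι → Ω → ℝ} (hY : ∀ i, Measurable (Y i)) {C : ℝ}
    (hC : ∀ i ω, |Y i ω| ≤ C) (h0 : ∀ i, ∫ ω, Y i ω ∂P = 0) (hi : iIndepFun Y P) (s : Finset ι) :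
    ∫ ω, (∑ i ∈ s, Y i ω) ∂P = 0 ∧
    ∫ ω, (∑ i ∈ s, Y i ω) ^ 2 ∂P = ∑ i ∈ s, ∫ ω, Y i ω ^ 2 ∂P ∧
    ∫ ω, (∑ i ∈ s, Y i ω) ^ 4 ∂P
      ≤ ∑ i ∈ s, ∫ ω, Y i ω ^ 4 ∂P + 3 * (∑ i ∈ s, ∫ ω, Y i ω ^ 2 ∂P) ^ 2 := by
  classical
  induction s using Finset.induction_on with
  | empty => simp
  | insert k s hk ih =>
    obtain ⟨ih1, ih2, ih4⟩ := ih
    set S : Ω → ℝ := fun ω => ∑ i ∈ s, Y i ω with hS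
    have hSm : Measurable S := by fun_prop
    have hSC : ∀ ω, |S ω| ≤ s.card * C := fun ω => by
      refine (Finset.abs_sum_le_sum_abs _ _).trans ?_
      rw [← nsmul_eq_mul]
      exact Finset.sum_le_card_nsmul _ _ _ fun i _ => hC i ω
    have hind : IndepFun S (Y k) P := by
      have := hi.indepFun_finsetSum_of_notMem hY hk
      convert this using 1
      ext ω; simp [hS]
    have hmul : ∀ p q : ℕ, ∫ ω, S ω ^ p * Y k ω ^ q ∂P = (∫ ω, S ω ^ p ∂P) * ∫ ω, Y k ω ^ q ∂P := by
      intro p q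
      exact (hind.comp (φ := fun x => x ^ p) (ψ := fun x => x ^ q) (by fun_prop)
        (by fun_prop)).integral_fun_mul_eq_mul_integral
          (hSm.pow_const p).aestronglyMeasurable ((hY k).pow_const q).aestronglyMeasurable
    have hint : ∀ p q : ℕ, Integrable (fun ω => S ω ^ p * Y k ω ^ q) P := by
      intro p q
      refine integrable_of_abs_le (C := (s.card * C) ^ p * C ^ q)
        ((hSm.pow_const p).mul ((hY k).pow_const q)) fun ω => ?_
      rw [abs_mul, abs_pow, abs_pow]
      have h1 := hSC ω
      have h2 := hC k ω
      have h3 : 0 ≤ s.card * C := (abs_nonneg _).trans h1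
      gcongr
    have hS2 := integrable_pow_of_abs_le (P := P) hSm hSC
    have hYk := integrable_pow_of_abs_le (P := P) (hY k) (hC k)
    simp only [Finset.sum_insert hk]
    have e : ∀ ω, Y k ω + ∑ i ∈ s, Y i ω = S ω + Y k ω := fun ω => by rw [hS]; ring
    simp only [e]
    refine ⟨?_, ?_, ?_⟩
    · rw [integral_add (by simpa using hS2 1) (by simpa using hYk 1), ih1, h0 k, add_zero]
    · have e2 : ∀ ω, (S ω + Y k ω) ^ 2 = S ω ^ 2 + (2 * (S ω ^ 1 * Y k ω ^ 1) + Y k ω ^ 2) := by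
        intro ω; ring
      simp only [e2]
      rw [integral_add (hS2 2) (((hint 1 1).const_mul 2).fun_add (hYk 2)),
        integral_add ((hint 1 1).const_mul 2) (hYk 2), integral_const_mul, hmul]
      simp only [pow_one, h0 k, mul_zero, zero_add]
      rw [ih2]; ring
    · have e4 : ∀ ω, (S ω + Y k ω) ^ 4 = S ω ^ 4 + (4 * (S ω ^ 3 * Y k ω ^ 1)
          + (6 * (S ω ^ 2 * Y k ω ^ 2) + (4 * (S ω ^ 1 * Y k ω ^ 3) + Y k ω ^ 4))) := by
        intro ω; ring
      simp only [e4]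
      rw [integral_add (hS2 4) (((hint 3 1).const_mul 4).fun_add (((hint 2 2).const_mul 6).fun_add
          (((hint 1 3).const_mul 4).fun_add (hYk 4)))),
        integral_add ((hint 3 1).const_mul 4) (((hint 2 2).const_mul 6).fun_add
          (((hint 1 3).const_mul 4).fun_add (hYk 4))),
        integral_add ((hint 2 2).const_mul 6) (((hint 1 3).const_mul 4).fun_add (hYk 4)),
        integral_add ((hint 1 3).const_mul 4) (hYk 4),
        integral_const_mul, integral_const_mul, integral_const_mul, hmul, hmul, hmul]
      -- Every mixed term but `6 E S² E Y²` contains a centred first moment. The surviving one is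
      -- the cross term of `3 (E S² + E Y²)²`.
      simp only [pow_one, h0 k, mul_zero, zero_add, ih1, zero_mul]
      rw [ih2]
      nlinarith [sq_nonneg (∫ ω, Y k ω ^ 2 ∂P)]

/-- Moments of the centred average of bounded independent variables. -/
lemma moments_average {n : ℕ} (hn : 0 < n) {Z : Fin n → Ω → ℝ} (hZ : ∀ i, Measurable (Z i)) {B : ℝ}
    (hB : ∀ i ω, |Z i ω| ≤ B) (hi : iIndepFun Z P) {m v : ℝ}
    (hm : m = (1 / (n : ℝ)) * ∑ i, ∫ ω, Z i ω ∂P) (hv : v = (1 / (n : ℝ)) * ∑ i, ∫ ω, Z i ω ^ 2 ∂P) :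
    ∫ ω, ((1 / (n : ℝ)) * ∑ i, Z i ω - m) ∂P = 0 ∧
    ∫ ω, ((1 / (n : ℝ)) * ∑ i, Z i ω - m) ^ 2 ∂P ≤ v / n ∧
    ∫ ω, ((1 / (n : ℝ)) * ∑ i, Z i ω - m) ^ 4 ∂P ≤ 3 * v ^ 2 / n ^ 2 + 4 * B ^ 2 * v / n ^ 3 := by
  have hn' : (0 : ℝ) < n := by exact_mod_cast hn
  have hB0 : 0 ≤ B := (abs_nonneg _).trans (hB ⟨0, hn⟩ (Classical.choice P.nonempty_of_neZero))
  have hZ1 : ∀ i, Integrable (Z i) P := fun i => integrable_of_abs_le (hZ i) (hB i)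
  set c : Fin n → ℝ := fun i => ∫ ω, Z i ω ∂P with hc
  have hcB : ∀ i, |c i| ≤ B := fun i => by
    have := norm_integral_le_of_norm_le_const (μ := P) (C := B) (f := Z i) (ae_of_all _ (hB i))
    simpa using this
  set Y : Fin n → Ω → ℝ := fun i ω => Z i ω - c i with hY
  have hYm : ∀ i, Measurable (Y i) := fun i => (hZ i).sub_const _
  have hYB : ∀ i ω, |Y i ω| ≤ 2 * B := fun i ω => by
    refine (abs_sub _ _).trans ?_
    linarith [hB i ω, hcB i]
  have hY0 : ∀ i, ∫ ω, Y i ω ∂P = 0 := fun i => by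
    rw [hY]; simp only
    rw [integral_sub (hZ1 i) (integrable_const _)]; simp [hc]
  have hYi : iIndepFun Y P := hi.comp (fun i x => x - c i) fun i => by fun_prop
  obtain ⟨h1, h2, h4⟩ := moments_sum_of_iIndepFun hYm hYB hY0 hYi Finset.univ
  have e : ∀ ω, (1 / (n : ℝ)) * ∑ i, Z i ω - m = (1 / (n : ℝ)) * ∑ i, Y i ω := fun ω => by
    rw [hm, hY]; simp only [Finset.sum_sub_distrib]; ring
  have hY2 : ∀ i, ∫ ω, Y i ω ^ 2 ∂P ≤ ∫ ω, Z i ω ^ 2 ∂P := fun i => by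
    have e2 : ∀ ω, Y i ω ^ 2 = Z i ω ^ 2 + (-2 * c i * Z i ω + c i ^ 2) := fun ω => by rw [hY]; ring
    simp only [e2]
    rw [integral_add (integrable_pow_of_abs_le (hZ i) (hB i) 2)
      (((hZ1 i).const_mul _).fun_add (integrable_const _)), integral_add ((hZ1 i).const_mul _)
      (integrable_const _), integral_const_mul]
    simp only [integral_const, probReal_univ, smul_eq_mul, one_mul]
    have : ∫ ω, Z i ω ∂P = c i := rfl
    rw [this]
    nlinarith [sq_nonneg (c i)]
  have hY4 : ∀ i, ∫ ω, Y i ω ^ 4 ∂P ≤ 4 * B ^ 2 * ∫ ω, Z i ω ^ 2 ∂P := fun i => by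
    calc ∫ ω, Y i ω ^ 4 ∂P ≤ ∫ ω, 4 * B ^ 2 * Y i ω ^ 2 ∂P := by
          refine integral_mono (integrable_pow_of_abs_le (hYm i) (hYB i) 4)
            ((integrable_pow_of_abs_le (hYm i) (hYB i) 2).const_mul _) fun ω => ?_
          have : Y i ω ^ 2 ≤ (2 * B) ^ 2 := by rw [← sq_abs]; exact pow_le_pow_left₀ (abs_nonneg _) (hYB i ω) 2
          simp only
          nlinarith [sq_nonneg (Y i ω)]
      _ ≤ _ := by rw [integral_const_mul]; exact mul_le_mul_of_nonneg_left (hY2 i) (by positivity)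
  have hnv : ∑ i, ∫ ω, Z i ω ^ 2 ∂P = n * v := by rw [hv]; field_simp
  have hs2 : ∑ i, ∫ ω, Y i ω ^ 2 ∂P ≤ n * v := by
    rw [← hnv]; exact Finset.sum_le_sum fun i _ => hY2 i
  have hs20 : 0 ≤ ∑ i, ∫ ω, Y i ω ^ 2 ∂P :=
    Finset.sum_nonneg fun i _ => integral_nonneg fun ω => sq_nonneg _
  have hs4 : ∑ i, ∫ ω, Y i ω ^ 4 ∂P ≤ 4 * B ^ 2 * (n * v) := by
    rw [← hnv, Finset.mul_sum]; exact Finset.sum_le_sum fun i _ => hY4 i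
  simp only [e, mul_pow]
  refine ⟨?_, ?_, ?_⟩
  · rw [integral_const_mul, h1, mul_zero]
  · rw [integral_const_mul, h2]
    calc _ ≤ (1 / (n : ℝ)) ^ 2 * (n * v) := by gcongr
      _ = _ := by field_simp
  · rw [integral_const_mul]
    calc _ ≤ (1 / (n : ℝ)) ^ 4 * (4 * B ^ 2 * (n * v) + 3 * (n * v) ^ 2) := by
          gcongr
          refine h4.trans ?_
          gcongr
      _ = _ := by field_simp; ring

end

end EBMeans

/-! ### Expected error of regularized scores -/

namespace EBMeans

section

variable {Ω : Type*} [MeasurableSpace Ω] {P : Measure Ω} [IsProbabilityMeasure P]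

/-- Moments of the error of an average of bounded independent variables as an estimate of `f`. -/
lemma moments_error {n : ℕ} (hn : 0 < n) {Z : Fin n → Ω → ℝ} (hZ : ∀ i, Measurable (Z i)) {B : ℝ}
    (hB : ∀ i ω, |Z i ω| ≤ B) (hi : iIndepFun Z P) {f b v V : ℝ}
    (hm : (1 / (n : ℝ)) * ∑ i, ∫ ω, Z i ω ∂P = f + b)
    (hv : v = (1 / (n : ℝ)) * ∑ i, ∫ ω, Z i ω ^ 2 ∂P) (hvV : v ≤ V) (hBV : B ^ 2 ≤ V * n)
    (hb : |b| ≤ 1 / n) :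
    ∫ ω, ((1 / (n : ℝ)) * ∑ i, Z i ω - f) ∂P = b ∧
    ∫ ω, ((1 / (n : ℝ)) * ∑ i, Z i ω - f) ^ 2 ∂P ≤ v / n + b ^ 2 ∧
    ∫ ω, ((1 / (n : ℝ)) * ∑ i, Z i ω - f) ^ 4 ∂P ≤ 56 * V * v / n ^ 2 + 8 * b ^ 2 / n ^ 2 := by
  have hn' : (0 : ℝ) < n := by exact_mod_cast hn
  obtain ⟨h1, h2, h4⟩ := moments_average hn hZ hB hi hm.symm hv
  have hv0 : 0 ≤ v := by
    rw [hv]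
    exact mul_nonneg (by positivity) (Finset.sum_nonneg fun i _ => integral_nonneg fun ω => sq_nonneg _)
  set D : Ω → ℝ := fun ω => (1 / (n : ℝ)) * ∑ i, Z i ω - (f + b) with hD
  have hDm : Measurable D := by fun_prop
  have hDB : ∀ ω, |D ω| ≤ B + |f + b| := fun ω => by
    refine (abs_sub _ _).trans ?_
    gcongr
    rw [abs_mul, abs_of_pos (by positivity)]
    have : |∑ i, Z i ω| ≤ n * B := by
      refine (Finset.abs_sum_le_sum_abs _ _).trans ?_
      refine (Finset.sum_le_card_nsmul Finset.univ _ B fun i _ => hB i ω).trans ?_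
      simp
    calc 1 / (n : ℝ) * |∑ i, Z i ω| ≤ 1 / n * (n * B) := by gcongr
      _ = B := by field_simp
  have hDi := integrable_pow_of_abs_le (P := P) hDm hDB
  have hD1 : Integrable D P := by simpa using hDi 1
  have e : ∀ ω, (1 / (n : ℝ)) * ∑ i, Z i ω - f = D ω + b := fun ω => by rw [hD]; ring
  simp only [e]
  refine ⟨?_, ?_, ?_⟩
  · rw [integral_add hD1 (integrable_const _), h1]; simp
  · have e2 : ∀ ω, (D ω + b) ^ 2 = D ω ^ 2 + (2 * b * D ω + b ^ 2) := fun ω => by ring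
    simp only [e2]
    rw [integral_add (hDi 2) ((hD1.const_mul _).fun_add (integrable_const _)),
      integral_add (hD1.const_mul _) (integrable_const _), integral_const_mul, h1]
    simp only [mul_zero, zero_add, integral_const, probReal_univ, smul_eq_mul, one_mul]
    gcongr
  · calc ∫ ω, (D ω + b) ^ 4 ∂P ≤ ∫ ω, (8 * D ω ^ 4 + 8 * b ^ 4) ∂P := by
          refine integral_mono (integrable_pow_of_abs_le (hDm.add_const b)
            (C := B + |f + b| + |b|) (fun ω => (abs_add_le _ _).trans (by gcongr; exact hDB ω)) 4)
            (((hDi 4).const_mul 8).fun_add (integrable_const _)) fun ω => ?_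
          simp only
          nlinarith [sq_nonneg (D ω - b), sq_nonneg (D ω ^ 2 - b ^ 2), sq_nonneg (D ω + b),
            mul_nonneg (sq_nonneg (D ω - b)) (sq_nonneg (D ω + b)), sq_nonneg ((D ω - b) ^ 2),
            mul_nonneg (sq_nonneg (D ω - b)) (sq_nonneg (D ω)), mul_nonneg (sq_nonneg (D ω - b)) (sq_nonneg b)]
      _ = 8 * ∫ ω, D ω ^ 4 ∂P + 8 * b ^ 4 := by
          rw [integral_add ((hDi 4).const_mul 8) (integrable_const _), integral_const_mul]; simp
      _ ≤ 8 * (3 * v ^ 2 / n ^ 2 + 4 * B ^ 2 * v / n ^ 3) + 8 * (b ^ 2 * (1 / n) ^ 2) := by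
          have : b ^ 2 ≤ (1 / (n : ℝ)) ^ 2 := by rw [← sq_abs]; gcongr
          have h5 : b ^ 4 ≤ b ^ 2 * (1 / n) ^ 2 := by
            calc b ^ 4 = b ^ 2 * b ^ 2 := by ring
              _ ≤ _ := by gcongr
          gcongr
      -- One factor `v` and one factor `b²` are retained, since their integrals over `x` are
      -- controlled; the other factors are replaced by the uniform bounds. The constant is `8 · (3 +
      -- 4) = 56`.
      _ ≤ 8 * (3 * (V * v) / n ^ 2 + 4 * (V * n) * v / n ^ 3) + 8 * (b ^ 2 * (1 / n) ^ 2) := by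
          have : v ^ 2 ≤ V * v := by nlinarith
          gcongr
      _ = _ := by field_simp; ring

/-- Three weighted AM-GM inequalities. The weight `s` splits the main square and is optimized later.
The weight `κ` trades the factor `|δ|/ρ` for a small multiple of second moments plus fourth moments.
The weight `a` balances `e⁴` with `δ⁴`, differentiation of the kernel costing about a factor `a`. -/
lemma error_weight_le {e δ L ρ κ s a : ℝ} (hρ : 0 < ρ) (hκ : 0 < κ) (hs : 0 < s)
    (ha : 0 < a) :
    (|e| + L * |δ|) ^ 2 / ρ * (1 + |δ| / ρ)
      ≤ ((1 + s) * e ^ 2 + (1 + 1 / s) * (L ^ 2 * δ ^ 2)) / ρ + κ / ρ * (e ^ 2 + L ^ 2 * δ ^ 2)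
        + 1 / (κ * ρ ^ 3) * ((e ^ 4 / a ^ 2 + a ^ 2 * δ ^ 4) / 2 + L ^ 2 * δ ^ 4) := by
  have h1 : (|e| + L * |δ|) ^ 2 ≤ (1 + s) * e ^ 2 + (1 + 1 / s) * (L ^ 2 * δ ^ 2) := by
    have h : 0 ≤ (s * |e| - L * |δ|) ^ 2 / s := by positivity
    have h2 : (s * |e| - L * |δ|) ^ 2 / s = s * |e| ^ 2 - 2 * |e| * (L * |δ|) + 1 / s * (L ^ 2 * |δ| ^ 2) := by
      field_simp; ring
    rw [h2] at h
    rw [← sq_abs e, ← sq_abs δ]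
    nlinarith
  have h2 : (|e| + L * |δ|) ^ 2 ≤ 2 * (e ^ 2 + L ^ 2 * δ ^ 2) := by
    rw [← sq_abs e, ← sq_abs δ]; nlinarith [sq_nonneg (|e| - L * |δ|)]
  have h3 : |δ| / ρ ≤ κ / 2 + δ ^ 2 / (2 * κ * ρ ^ 2) := by
    have h : 0 ≤ (κ * ρ - |δ|) ^ 2 / (2 * κ * ρ ^ 2) := by positivity
    have h4 : (κ * ρ - |δ|) ^ 2 / (2 * κ * ρ ^ 2) = κ / 2 + |δ| ^ 2 / (2 * κ * ρ ^ 2) - |δ| / ρ := by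
      field_simp; ring
    rw [h4, sq_abs] at h; linarith
  have h4 : e ^ 2 * δ ^ 2 ≤ (e ^ 4 / a ^ 2 + a ^ 2 * δ ^ 4) / 2 := by
    have h : 0 ≤ (e ^ 2 / a - a * δ ^ 2) ^ 2 := sq_nonneg _
    have h5 : (e ^ 2 / a - a * δ ^ 2) ^ 2 = e ^ 4 / a ^ 2 + a ^ 2 * δ ^ 4 - 2 * (e ^ 2 * δ ^ 2) := by
      field_simp; ring
    rw [h5] at h; linarith
  calc (|e| + L * |δ|) ^ 2 / ρ * (1 + |δ| / ρ)
      = (|e| + L * |δ|) ^ 2 / ρ + (|e| + L * |δ|) ^ 2 / ρ * (|δ| / ρ) := by ring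
    _ ≤ ((1 + s) * e ^ 2 + (1 + 1 / s) * (L ^ 2 * δ ^ 2)) / ρ
        + 2 * (e ^ 2 + L ^ 2 * δ ^ 2) / ρ * (κ / 2 + δ ^ 2 / (2 * κ * ρ ^ 2)) := by gcongr
    _ = ((1 + s) * e ^ 2 + (1 + 1 / s) * (L ^ 2 * δ ^ 2)) / ρ + κ / ρ * (e ^ 2 + L ^ 2 * δ ^ 2)
        + 1 / (κ * ρ ^ 3) * (e ^ 2 * δ ^ 2 + L ^ 2 * δ ^ 4) := by field_simp; ring
    _ ≤ _ := by gcongr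

/-- Expected squared error of the regularized score of a pair of random estimates `g`, `g₁`. -/
lemma integral_regularized_score_sq_le {g g₁ : Ω → ℝ} (hg : Measurable g) (hg₁ : Measurable g₁)
    {C : ℝ} (hgC : ∀ ω, |g ω| ≤ C) (hg₁C : ∀ ω, |g₁ ω| ≤ C) {f f₁ ρ L κ s a b₁ A₂ B₂ A₄ B₄ : ℝ}
    (hf : 0 < f) (hρ : 0 < ρ) (hL : 0 ≤ L) (hf₁ : |f₁| ≤ L * max f ρ) (hκ : 0 < κ) (hs : 0 < s)
    (ha : 0 < a) (h1 : ∫ ω, (g₁ ω - f₁) ∂P = b₁) (hA₂ : ∫ ω, (g₁ ω - f₁) ^ 2 ∂P ≤ A₂)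
    (hB₂ : ∫ ω, (g ω - f) ^ 2 ∂P ≤ B₂) (hA₄ : ∫ ω, (g₁ ω - f₁) ^ 4 ∂P ≤ A₄)
    (hB₄ : ∫ ω, (g ω - f) ^ 4 ∂P ≤ B₄) :
    (∫ ω, (g₁ ω / max (g ω) ρ) ^ 2 ∂P) * f - 2 * (∫ ω, g₁ ω / max (g ω) ρ ∂P) * f₁
      ≤ -(f₁ ^ 2 / f) + (f₁ / f) ^ 2 * (1 - f / max f ρ) ^ 2 * f
        + ((1 + s) * A₂ + (1 + 1 / s) * (L ^ 2 * B₂)) / ρ + κ / ρ * (A₂ + L ^ 2 * B₂)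
        + 1 / (κ * ρ ^ 3) * ((A₄ / a ^ 2 + a ^ 2 * B₄) / 2 + L ^ 2 * B₄)
        + 2 * |b₁| * |f₁| / ρ := by
  have hM : ∀ ω, 0 < max (g ω) ρ := fun ω => lt_max_of_lt_right hρ
  have hψm : Measurable fun ω => g₁ ω / max (g ω) ρ := hg₁.div (hg.max measurable_const)
  have hψC : ∀ ω, |g₁ ω / max (g ω) ρ| ≤ C / ρ := fun ω => by
    rw [abs_div, abs_of_pos (hM ω)]
    exact div_le_div₀ ((abs_nonneg _).trans (hg₁C ω)) (hg₁C ω) hρ (le_max_right _ _)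
  have hψ1 := integrable_of_abs_le (P := P) hψm hψC
  have hψ2 := integrable_pow_of_abs_le (P := P) hψm hψC 2
  have hem : Measurable fun ω => g₁ ω - f₁ := hg₁.sub_const _
  have hdm : Measurable fun ω => g ω - f := hg.sub_const _
  have heC : ∀ ω, |g₁ ω - f₁| ≤ C + |f₁| := fun ω => (abs_sub _ _).trans (by gcongr; exact hg₁C ω)
  have hdC : ∀ ω, |g ω - f| ≤ C + |f| := fun ω => (abs_sub _ _).trans (by gcongr; exact hgC ω)
  have he1 := integrable_of_abs_le (P := P) hem heC
  have he := integrable_pow_of_abs_le (P := P) hem heC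
  have hd := integrable_pow_of_abs_le (P := P) hdm hdC
  -- The coefficient of the linear error term is deterministic, so in expectation this term
  -- contributes only through the bias `b₁`.
  set ℓ := f₁ * (f / max f ρ - 1) / max f ρ with hℓ
  have hℓb : |ℓ| ≤ |f₁| / ρ := by
    have hMf : 0 < max f ρ := lt_max_of_lt_left hf
    rw [hℓ, abs_div, abs_mul, abs_of_pos hMf]
    have h2 : |f / max f ρ - 1| ≤ 1 := by
      have : f / max f ρ ≤ 1 := (div_le_one hMf).2 (le_max_left _ _)
      have h3 : 0 ≤ f / max f ρ := by positivity
      rw [abs_le]; constructor <;> linarith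
    calc _ ≤ |f₁| * 1 / ρ := by
          gcongr
          exact le_max_right _ _
      _ = _ := by rw [mul_one]
  have e1 : (∫ ω, (g₁ ω / max (g ω) ρ) ^ 2 ∂P) * f - 2 * (∫ ω, g₁ ω / max (g ω) ρ ∂P) * f₁
      = ∫ ω, ((g₁ ω / max (g ω) ρ) ^ 2 * f + (-2 * f₁) * (g₁ ω / max (g ω) ρ)) ∂P := by
    rw [integral_add (hψ2.mul_const _) (hψ1.const_mul _), integral_mul_const, integral_const_mul]
    ring
  rw [e1]
  have hmain : ∀ ω, (g₁ ω / max (g ω) ρ) ^ 2 * f + (-2 * f₁) * (g₁ ω / max (g ω) ρ)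
      ≤ (-(f₁ ^ 2 / f) + (f₁ / f) ^ 2 * (1 - f / max f ρ) ^ 2 * f)
        + (((1 + s) / ρ + κ / ρ) * (g₁ ω - f₁) ^ 2
        + (((1 + 1 / s) * L ^ 2 / ρ + κ / ρ * L ^ 2) * (g ω - f) ^ 2
        + (1 / (κ * ρ ^ 3) / (2 * a ^ 2) * (g₁ ω - f₁) ^ 4
        + (1 / (κ * ρ ^ 3) * (a ^ 2 / 2 + L ^ 2) * (g ω - f) ^ 4
        + 2 * ℓ * (g₁ ω - f₁))))) := by
    intro ω
    have k1 := regularized_score_sq_sub_le (g := g ω) (g₁ := g₁ ω) hf hρ hL hf₁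
    have k2 := error_weight_le (e := g₁ ω - f₁) (δ := g ω - f) (L := L) hρ hκ hs ha
    -- Completing the square turns the risk integrand into the squared error about the score `f₁ /
    -- f`.
    have k3 : (g₁ ω / max (g ω) ρ - f₁ / f) ^ 2 * f
        = (g₁ ω / max (g ω) ρ) ^ 2 * f + (-2 * f₁) * (g₁ ω / max (g ω) ρ) + f₁ ^ 2 / f := by
      field_simp; ring
    rw [k3, ← hℓ] at k1
    have k4 : ((1 + s) * (g₁ ω - f₁) ^ 2 + (1 + 1 / s) * (L ^ 2 * (g ω - f) ^ 2)) / ρ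
        + κ / ρ * ((g₁ ω - f₁) ^ 2 + L ^ 2 * (g ω - f) ^ 2)
        + 1 / (κ * ρ ^ 3) * (((g₁ ω - f₁) ^ 4 / a ^ 2 + a ^ 2 * (g ω - f) ^ 4) / 2
          + L ^ 2 * (g ω - f) ^ 4)
        = ((1 + s) / ρ + κ / ρ) * (g₁ ω - f₁) ^ 2
        + (((1 + 1 / s) * L ^ 2 / ρ + κ / ρ * L ^ 2) * (g ω - f) ^ 2
        + (1 / (κ * ρ ^ 3) / (2 * a ^ 2) * (g₁ ω - f₁) ^ 4
        + 1 / (κ * ρ ^ 3) * (a ^ 2 / 2 + L ^ 2) * (g ω - f) ^ 4)) := by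
      field_simp; ring
    rw [k4] at k2
    linarith
  have i5 := (he1.const_mul (2 * ℓ))
  have i4 := ((hd 4).const_mul (1 / (κ * ρ ^ 3) * (a ^ 2 / 2 + L ^ 2))).fun_add i5
  have i3 := ((he 4).const_mul (1 / (κ * ρ ^ 3) / (2 * a ^ 2))).fun_add i4
  have i2 := ((hd 2).const_mul ((1 + 1 / s) * L ^ 2 / ρ + κ / ρ * L ^ 2)).fun_add i3
  have i1 := ((he 2).const_mul ((1 + s) / ρ + κ / ρ)).fun_add i2
  refine (integral_mono ((hψ2.mul_const f).fun_add (hψ1.const_mul (-2 * f₁)))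
    ((integrable_const _).fun_add i1) hmain).trans ?_
  rw [integral_add (integrable_const _) i1, integral_add ((he 2).const_mul _) i2,
    integral_add ((hd 2).const_mul _) i3, integral_add ((he 4).const_mul _) i4,
    integral_add ((hd 4).const_mul _) i5, integral_const_mul, integral_const_mul,
    integral_const_mul, integral_const_mul, integral_const_mul, h1]
  simp only [integral_const, probReal_univ, smul_eq_mul, one_mul]
  have t1 : ((1 + s) / ρ + κ / ρ) * ∫ ω, (g₁ ω - f₁) ^ 2 ∂P ≤ ((1 + s) / ρ + κ / ρ) * A₂ := by gcongr
  have t2 : ((1 + 1 / s) * L ^ 2 / ρ + κ / ρ * L ^ 2) * ∫ ω, (g ω - f) ^ 2 ∂P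
      ≤ ((1 + 1 / s) * L ^ 2 / ρ + κ / ρ * L ^ 2) * B₂ := by gcongr
  have t3 : 1 / (κ * ρ ^ 3) / (2 * a ^ 2) * ∫ ω, (g₁ ω - f₁) ^ 4 ∂P
      ≤ 1 / (κ * ρ ^ 3) / (2 * a ^ 2) * A₄ := by gcongr
  have t4 : 1 / (κ * ρ ^ 3) * (a ^ 2 / 2 + L ^ 2) * ∫ ω, (g ω - f) ^ 4 ∂P
      ≤ 1 / (κ * ρ ^ 3) * (a ^ 2 / 2 + L ^ 2) * B₄ := by gcongr
  have t5 : 2 * ℓ * b₁ ≤ 2 * |b₁| * |f₁| / ρ := by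
    calc 2 * ℓ * b₁ ≤ 2 * (|ℓ| * |b₁|) := by
          have := le_abs_self (ℓ * b₁)
          rw [abs_mul] at this; linarith
      _ ≤ 2 * (|f₁| / ρ * |b₁|) := by gcongr
      _ = _ := by ring
  have t6 : ((1 + s) * A₂ + (1 + 1 / s) * (L ^ 2 * B₂)) / ρ + κ / ρ * (A₂ + L ^ 2 * B₂)
        + 1 / (κ * ρ ^ 3) * ((A₄ / a ^ 2 + a ^ 2 * B₄) / 2 + L ^ 2 * B₄)
      = ((1 + s) / ρ + κ / ρ) * A₂ + ((1 + 1 / s) * L ^ 2 / ρ + κ / ρ * L ^ 2) * B₂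
        + 1 / (κ * ρ ^ 3) / (2 * a ^ 2) * A₄ + 1 / (κ * ρ ^ 3) * (a ^ 2 / 2 + L ^ 2) * B₄ := by
    field_simp; ring
  linarith

/-- Crude bounds suffice here: these moments enter only the leave-one-out correction, where they are
multiplied by `1/(nρ)`. -/
lemma integral_regularized_score_moments_le {g g₁ : Ω → ℝ} (hg : Measurable g) (hg₁ : Measurable g₁)
    {C : ℝ} (hgC : ∀ ω, |g ω| ≤ C) (hg₁C : ∀ ω, |g₁ ω| ≤ C) {f f₁ ρ L A₂ B₂ : ℝ}
    (hf : 0 < f) (hρ : 0 < ρ) (hL : 0 ≤ L) (hf₁ : |f₁| ≤ L * max f ρ)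
    (hA₂ : ∫ ω, (g₁ ω - f₁) ^ 2 ∂P ≤ A₂) (hB₂ : ∫ ω, (g ω - f) ^ 2 ∂P ≤ B₂) :
    (∫ ω, (g₁ ω / max (g ω) ρ) ^ 2 ∂P) * f
      ≤ 2 * f * A₂ / ρ ^ 2 + 4 * (f₁ ^ 2 / f) * (1 + B₂ / ρ ^ 2) ∧
    ∫ ω, |g₁ ω / max (g ω) ρ| ∂P
      ≤ L + (1 / 2 + A₂ / (2 * ρ ^ 2)) + L * (1 / 2 + B₂ / (2 * ρ ^ 2)) := by
  have hM : ∀ ω, 0 < max (g ω) ρ := fun ω => lt_max_of_lt_right hρ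
  have hψm : Measurable fun ω => g₁ ω / max (g ω) ρ := hg₁.div (hg.max measurable_const)
  have hψC : ∀ ω, |g₁ ω / max (g ω) ρ| ≤ C / ρ := fun ω => by
    rw [abs_div, abs_of_pos (hM ω)]
    exact div_le_div₀ ((abs_nonneg _).trans (hg₁C ω)) (hg₁C ω) hρ (le_max_right _ _)
  have hψ1 := integrable_of_abs_le (P := P) hψm hψC
  have hψ2 := integrable_pow_of_abs_le (P := P) hψm hψC 2
  have hem : Measurable fun ω => g₁ ω - f₁ := hg₁.sub_const _
  have hdm : Measurable fun ω => g ω - f := hg.sub_const _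
  have heC : ∀ ω, |g₁ ω - f₁| ≤ C + |f₁| := fun ω => (abs_sub _ _).trans (by gcongr; exact hg₁C ω)
  have hdC : ∀ ω, |g ω - f| ≤ C + |f| := fun ω => (abs_sub _ _).trans (by gcongr; exact hgC ω)
  have he := integrable_pow_of_abs_le (P := P) hem heC 2
  have hd := integrable_pow_of_abs_le (P := P) hdm hdC 2
  constructor
  · rw [← integral_mul_const]
    have i1 := (he.const_mul (2 * f / ρ ^ 2)).fun_add (hd.const_mul (4 * (f₁ ^ 2 / f) / ρ ^ 2))
    calc ∫ ω, (g₁ ω / max (g ω) ρ) ^ 2 * f ∂P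
        ≤ ∫ ω, (4 * (f₁ ^ 2 / f) + (2 * f / ρ ^ 2 * (g₁ ω - f₁) ^ 2
            + 4 * (f₁ ^ 2 / f) / ρ ^ 2 * (g ω - f) ^ 2)) ∂P := by
          refine integral_mono (hψ2.mul_const f) ((integrable_const _).fun_add i1) fun ω => ?_
          refine (sq_regularized_score_mul_le hf hρ (f₁ := f₁)).trans (le_of_eq ?_)
          ring
      _ = 4 * (f₁ ^ 2 / f) + (2 * f / ρ ^ 2 * ∫ ω, (g₁ ω - f₁) ^ 2 ∂P
            + 4 * (f₁ ^ 2 / f) / ρ ^ 2 * ∫ ω, (g ω - f) ^ 2 ∂P) := by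
          rw [integral_add (integrable_const _) i1, integral_add (he.const_mul _) (hd.const_mul _)]
          simp only [integral_const_mul, integral_const, probReal_univ, smul_eq_mul, one_mul]
      _ ≤ 4 * (f₁ ^ 2 / f) + (2 * f / ρ ^ 2 * A₂ + 4 * (f₁ ^ 2 / f) / ρ ^ 2 * B₂) := by gcongr
      _ = _ := by ring
  · have i1 := (he.const_mul (1 / (2 * ρ ^ 2))).fun_add (hd.const_mul (L / (2 * ρ ^ 2)))
    calc ∫ ω, |g₁ ω / max (g ω) ρ| ∂P
        ≤ ∫ ω, (L + 1 / 2 + L / 2 + (1 / (2 * ρ ^ 2) * (g₁ ω - f₁) ^ 2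
            + L / (2 * ρ ^ 2) * (g ω - f) ^ 2)) ∂P := by
          refine integral_mono hψ1.abs ((integrable_const _).fun_add i1) fun ω => ?_
          refine (abs_regularized_score_le hρ hL hf₁ (g := g ω) (g₁ := g₁ ω)).trans ?_
          have aux : ∀ t : ℝ, |t| / ρ ≤ 1 / 2 + 1 / (2 * ρ ^ 2) * t ^ 2 := fun t => by
            have h : 0 ≤ (ρ - |t|) ^ 2 / (2 * ρ ^ 2) := by positivity
            have h4 : (ρ - |t|) ^ 2 / (2 * ρ ^ 2) = 1 / 2 + 1 / (2 * ρ ^ 2) * |t| ^ 2 - |t| / ρ := by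
              field_simp; ring
            rw [h4, sq_abs] at h; linarith
          have k1 := aux (g₁ ω - f₁)
          have k2 := mul_le_mul_of_nonneg_left (aux (g ω - f)) hL
          have k3 : (|g₁ ω - f₁| + L * |g ω - f|) / ρ = |g₁ ω - f₁| / ρ + L * (|g ω - f| / ρ) := by ring
          have k4 : L / (2 * ρ ^ 2) * (g ω - f) ^ 2 = L * (1 / (2 * ρ ^ 2) * (g ω - f) ^ 2) := by ring
          rw [k3, k4]
          linarith
      _ = L + 1 / 2 + L / 2 + (1 / (2 * ρ ^ 2) * ∫ ω, (g₁ ω - f₁) ^ 2 ∂P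
            + L / (2 * ρ ^ 2) * ∫ ω, (g ω - f) ^ 2 ∂P) := by
          rw [integral_add (integrable_const _) i1, integral_add (he.const_mul _) (hd.const_mul _)]
          simp only [integral_const_mul, integral_const, probReal_univ, smul_eq_mul, one_mul]
      _ ≤ L + 1 / 2 + L / 2 + (1 / (2 * ρ ^ 2) * A₂ + L / (2 * ρ ^ 2) * B₂) := by gcongr
      _ = _ := by ring

/-- Effect on the risk integrand of removing the observation being denoised from the sample. -/
lemma regularized_score_perturb_le {g g₁ z z₁ ρ N a κ p q : ℝ} {n : ℕ} (hn : 0 < n) (hρ : 0 < ρ)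
    (ha : 0 < a) (hN : N = n * ρ) (hκ : a / N ≤ κ) (hp : 0 ≤ p) (hz : |z| ≤ 2 * a)
    (hz₁ : |z₁| ≤ a ^ 2) :
    ((g₁ - z₁ / n) / max (g - z / n) ρ) ^ 2 * p - 2 * ((g₁ - z₁ / n) / max (g - z / n) ρ) * q
      ≤ (g₁ / max g ρ) ^ 2 * p - 2 * (g₁ / max g ρ) * q
        + ((5 + 8 * κ) * a * (g₁ / max g ρ) ^ 2 + (1 + 2 * κ) / a * z₁ ^ 2) * p / N
        + 2 * (a ^ 2 + 2 * a * |g₁ / max g ρ|) * |q| / N := by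
  have hn' : (0 : ℝ) < n := by exact_mod_cast hn
  have hN0 : 0 < N := by rw [hN]; positivity
  have h := abs_regularized_score_sub_le (g := g) (g₁ := g₁) (h := g - z / n) (h₁ := g₁ - z₁ / n) hρ
  set ψ := g₁ / max g ρ
  set ψ' := (g₁ - z₁ / n) / max (g - z / n) ρ
  set d := ψ' - ψ with hd
  have hdb : |d| ≤ (|z₁| + 2 * a * |ψ|) / N := by
    refine h.trans ?_
    have e1 : |g₁ - z₁ / n - g₁| = |z₁| / n := by
      rw [sub_sub_cancel_left, abs_neg, abs_div, abs_of_pos hn']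
    have e2 : |g - z / n - g| = |z| / n := by
      rw [sub_sub_cancel_left, abs_neg, abs_div, abs_of_pos hn']
    rw [e1, e2, hN]
    calc (|z₁| / n + |ψ| * (|z| / n)) / ρ ≤ (|z₁| / n + |ψ| * (2 * a / n)) / ρ := by gcongr
      _ = _ := by field_simp
  -- The product `2 |z₁| |ψ|` is split with weight `a`, so that `z₁²`, of mean at most `a³`, returns
  -- as `a²`; the direct term `4a ψ²` brings the constant to `5`.
  have h1 : 2 * |d| * |ψ| ≤ (5 * a * ψ ^ 2 + z₁ ^ 2 / a) / N := by
    calc 2 * |d| * |ψ| ≤ 2 * ((|z₁| + 2 * a * |ψ|) / N) * |ψ| := by gcongr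
      _ = (2 * |z₁| * |ψ| + 4 * a * |ψ| ^ 2) / N := by ring
      _ ≤ (5 * a * |ψ| ^ 2 + |z₁| ^ 2 / a) / N := by
          refine div_le_div_of_nonneg_right ?_ hN0.le
          have : 0 ≤ (a * |ψ| - |z₁|) ^ 2 / a := by positivity
          have h4 : (a * |ψ| - |z₁|) ^ 2 / a = a * |ψ| ^ 2 - 2 * |z₁| * |ψ| + |z₁| ^ 2 / a := by
            field_simp; ring
          linarith
      _ = _ := by rw [sq_abs, sq_abs]
  have h2 : d ^ 2 ≤ (8 * κ * a * ψ ^ 2 + 2 * κ / a * z₁ ^ 2) / N := by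
    calc d ^ 2 = |d| ^ 2 := (sq_abs d).symm
      _ ≤ ((|z₁| + 2 * a * |ψ|) / N) ^ 2 := by gcongr
      _ = (|z₁| + 2 * a * |ψ|) ^ 2 / a * (a / N) / N := by field_simp
      _ ≤ (|z₁| + 2 * a * |ψ|) ^ 2 / a * κ / N := by gcongr
      _ ≤ (2 * (|z₁| ^ 2 + 4 * a ^ 2 * |ψ| ^ 2)) / a * κ / N := by
          have hκ0 : 0 ≤ κ := le_trans (by positivity) hκ
          gcongr
          nlinarith [sq_nonneg (|z₁| - 2 * a * |ψ|)]
      _ = _ := by rw [sq_abs, sq_abs]; field_simp; ring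
  have h3 : -(2 * d * q) ≤ 2 * (a ^ 2 + 2 * a * |ψ|) * |q| / N := by
    calc -(2 * d * q) ≤ 2 * (|d| * |q|) := by
          have := neg_abs_le (d * q); rw [abs_mul] at this; linarith
      _ ≤ 2 * ((a ^ 2 + 2 * a * |ψ|) / N * |q|) := by
          gcongr
          exact hdb.trans (by gcongr)
      _ = _ := by ring
  have h4 : ψ' = ψ + d := by rw [hd]; ring
  have h5 : 2 * d * ψ ≤ 2 * |d| * |ψ| := by
    have := le_abs_self (d * ψ); rw [abs_mul] at this; linarith
  have h6 : (2 * d * ψ + d ^ 2) * p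
      ≤ ((5 * a * ψ ^ 2 + z₁ ^ 2 / a) / N + (8 * κ * a * ψ ^ 2 + 2 * κ / a * z₁ ^ 2) / N) * p := by
    gcongr
    linarith
  have h7 : ((5 * a * ψ ^ 2 + z₁ ^ 2 / a) / N + (8 * κ * a * ψ ^ 2 + 2 * κ / a * z₁ ^ 2) / N) * p
      = ((5 + 8 * κ) * a * ψ ^ 2 + (1 + 2 * κ) / a * z₁ ^ 2) * p / N := by field_simp; ring
  rw [h4]
  linarith

end

end EBMeans

/-! ### Averaging the risk integrand over the coordinates -/

namespace EBMeans

/-- Integrated form of `regularized_score_perturb_le`. -/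
lemma integral_score_perturb_le {Ω : Type*} [MeasurableSpace Ω] {P : Measure Ω}
    [IsProbabilityMeasure P] {ψ ψ' z₁ : Ω → ℝ} (h1 : Integrable ψ P)
    (h2 : Integrable (fun ω => ψ ω ^ 2) P) (h1' : Integrable ψ' P)
    (h2' : Integrable (fun ω => ψ' ω ^ 2) P) (hz : Integrable (fun ω => z₁ ω ^ 2) P)
    {a κ N p q : ℝ} (ha : 0 < a) (hκ : 0 < κ) (hN : 0 < N) (hp : 0 ≤ p)
    (hza : ∫ ω, z₁ ω ^ 2 ∂P ≤ a ^ 3)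
    (h : ∀ ω, ψ' ω ^ 2 * p - 2 * ψ' ω * q ≤ ψ ω ^ 2 * p - 2 * ψ ω * q
        + ((5 + 8 * κ) * a * ψ ω ^ 2 + (1 + 2 * κ) / a * z₁ ω ^ 2) * p / N
        + 2 * (a ^ 2 + 2 * a * |ψ ω|) * |q| / N) :
    (∫ ω, ψ' ω ^ 2 ∂P) * p - 2 * (∫ ω, ψ' ω ∂P) * q
      ≤ ((∫ ω, ψ ω ^ 2 ∂P) + ((5 + 8 * κ) * a * (∫ ω, ψ ω ^ 2 ∂P) + (1 + 2 * κ) * a ^ 2) / N) * p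
        - 2 * (∫ ω, ψ ω ∂P) * q + 2 * (a ^ 2 + 2 * a * ∫ ω, |ψ ω| ∂P) / N * |q| := by
  have el : (∫ ω, ψ' ω ^ 2 ∂P) * p - 2 * (∫ ω, ψ' ω ∂P) * q
      = ∫ ω, (ψ' ω ^ 2 * p + (-2 * q) * ψ' ω) ∂P := by
    rw [integral_add (h2'.mul_const _) (h1'.const_mul _), integral_mul_const, integral_const_mul]
    ring
  rw [el]
  have j4 := (h1.abs.const_mul (4 * a * |q| / N))
  have j3 := (hz.const_mul ((1 + 2 * κ) / a * p / N)).fun_add j4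
  have j2 := (h1.const_mul (-2 * q)).fun_add j3
  have j1 := (h2.const_mul (p + (5 + 8 * κ) * a * p / N)).fun_add j2
  refine (integral_mono (g := fun ω => 2 * a ^ 2 * |q| / N
      + ((p + (5 + 8 * κ) * a * p / N) * ψ ω ^ 2 + (-2 * q * ψ ω
      + ((1 + 2 * κ) / a * p / N * z₁ ω ^ 2 + 4 * a * |q| / N * |ψ ω|))))
    ((h2'.mul_const _).fun_add (h1'.const_mul _)) ((integrable_const _).fun_add j1) fun ω => ?_).trans ?_
  · refine le_trans (le_of_eq ?_) ((h ω).trans (le_of_eq ?_)) <;> ring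
  · rw [integral_add (integrable_const _) j1, integral_add (h2.const_mul _) j2,
      integral_add (h1.const_mul _) j3, integral_add (hz.const_mul _) j4]
    simp only [integral_const_mul, integral_const, probReal_univ, smul_eq_mul, one_mul]
    have t : (1 + 2 * κ) / a * p / N * ∫ ω, z₁ ω ^ 2 ∂P ≤ (1 + 2 * κ) / a * p / N * a ^ 3 := by gcongr
    have t2 : (1 + 2 * κ) / a * p / N * a ^ 3 = (1 + 2 * κ) * a ^ 2 * p / N := by field_simp
    rw [t2] at t
    generalize (∫ ω, ψ ω ^ 2 ∂P) = E₂ at *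
    generalize (∫ ω, ψ ω ∂P) = E₁ at *
    generalize (∫ ω, |ψ ω| ∂P) = Ea at *
    have t3 : (E₂ + ((5 + 8 * κ) * a * E₂ + (1 + 2 * κ) * a ^ 2) / N) * p - 2 * E₁ * q
      + 2 * (a ^ 2 + 2 * a * Ea) / N * |q|
      = 2 * a ^ 2 * |q| / N + ((p + (5 + 8 * κ) * a * p / N) * E₂ + (-2 * q * E₁
        + ((1 + 2 * κ) * a ^ 2 * p / N + 4 * a * |q| / N * Ea))) := by ring
    linarith

-- At a fixed `x`, each leave-one-out score is replaced by the full-sample score, after which only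
-- `p k` and `q k` depend on `k` and average to `f` and `f₁`. The remainder is arranged as a
-- combination of `v₁`, `b₁²`, `v`, `b²`, `F₁`, `f` and `f₁²/f`, which are the quantities whose
-- integrals over `x` can be bounded.
set_option maxHeartbeats 1600000 in
lemma risk_integrand_avg_le {Ω : Type*} [MeasurableSpace Ω] {P : Measure Ω} [IsProbabilityMeasure P]
    {n : ℕ} (hn : 0 < n) {Z Z₁ : Fin n → Ω → ℝ} (hZ : ∀ k, Measurable (Z k))
    (hZ₁ : ∀ k, Measurable (Z₁ k)) (hi : iIndepFun Z P) (hi₁ : iIndepFun Z₁ P)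
    {a z₀ : ℝ} (ha : 1 ≤ a) (han : a ≤ n) (hZa : ∀ k ω, |Z k ω| ≤ a) (hz₀ : |z₀| ≤ a)
    (hZ₁a : ∀ k ω, |Z₁ k ω| ≤ a ^ 2) (hZ₁v : ∀ k, ∫ ω, Z₁ k ω ^ 2 ∂P ≤ a ^ 3)
    {p q : Fin n → ℝ} (hp : ∀ k, 0 ≤ p k) {f f₁ F₁ v v₁ b b₁ ρ L κ s : ℝ}
    (hf : f = (1 / (n : ℝ)) * ∑ k, p k) (hf₁ : f₁ = (1 / (n : ℝ)) * ∑ k, q k)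
    (hF₁ : F₁ = (1 / (n : ℝ)) * ∑ k, |q k|) (hf0 : 0 < f)
    (hm : (1 / (n : ℝ)) * ∑ k, ∫ ω, Z k ω ∂P = f + b)
    (hm₁ : (1 / (n : ℝ)) * ∑ k, ∫ ω, Z₁ k ω ∂P = f₁ + b₁)
    (hv : v = (1 / (n : ℝ)) * ∑ k, ∫ ω, Z k ω ^ 2 ∂P)
    (hv₁ : v₁ = (1 / (n : ℝ)) * ∑ k, ∫ ω, Z₁ k ω ^ 2 ∂P)
    (hva : v ≤ a) (hb : |b| ≤ 1 / n) (hb₁ : |b₁| ≤ 1 / n)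
    (hρ : 0 < ρ) (hL : 1 ≤ L) (hfL : |f₁| ≤ L * max f ρ) (hκ : 0 < κ) (hs : 0 < s)
    (hκ1 : a / (n * ρ) ≤ κ) (hκ2 : a / (n * ρ ^ 2) = κ ^ 2) :
    (1 / (n : ℝ)) * ∑ k,
      ((∫ ω, (((1 / (n : ℝ)) * ∑ j, Z₁ j ω - Z₁ k ω / n)
          / max ((1 / (n : ℝ)) * ∑ j, Z j ω - (Z k ω - z₀) / n) ρ) ^ 2 ∂P) * p k
        - 2 * (∫ ω, ((1 / (n : ℝ)) * ∑ j, Z₁ j ω - Z₁ k ω / n)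
          / max ((1 / (n : ℝ)) * ∑ j, Z j ω - (Z k ω - z₀) / n) ρ ∂P) * q k)
      ≤ -(f₁ ^ 2 / f) + (f₁ / f) ^ 2 * (1 - f / max f ρ) ^ 2 * f
        + (((1 + s + κ) / (n * ρ) + 28 * a / (κ * ρ ^ 3 * n ^ 2)) * v₁
          + ((1 + s + κ) / ρ + 4 / (κ * ρ ^ 3 * a ^ 2 * n ^ 2)) * b₁ ^ 2
          + ((1 + 1 / s + κ) * L ^ 2 / (n * ρ)
              + 56 * a / (κ * ρ ^ 3 * n ^ 2) * (a ^ 2 / 2 + L ^ 2)) * v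
          + ((1 + 1 / s + κ) * L ^ 2 / ρ + 8 / (κ * ρ ^ 3 * n ^ 2) * (a ^ 2 / 2 + L ^ 2)) * b ^ 2
          + (2 + 2 * (a ^ 2 + 2 * a * (2 * L + (a ^ 2 + L) * κ ^ 2))) / (n * ρ) * F₁
          + (4 * (5 + 8 * κ) * a ^ 3 * κ ^ 2 + (1 + 2 * κ) * a ^ 2) / (n * ρ) * f
          + 4 * (5 + 8 * κ) * a * (1 + 2 * κ ^ 2) / (n * ρ) * (f₁ ^ 2 / f)) := by
  have hn' : (0 : ℝ) < n := by exact_mod_cast hn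
  have ha0 : 0 < a := by linarith
  have hv₁a : v₁ ≤ a ^ 3 := by
    rw [hv₁]
    calc _ ≤ 1 / (n : ℝ) * ∑ k : Fin n, a ^ 3 := by gcongr with k; exact hZ₁v k
      _ = a ^ 3 := by simp; field_simp
  have hv0 : 0 ≤ v := by
    rw [hv]
    exact mul_nonneg (by positivity) (Finset.sum_nonneg fun i _ => integral_nonneg fun ω => sq_nonneg _)
  have hv₁0 : 0 ≤ v₁ := by
    rw [hv₁]
    exact mul_nonneg (by positivity) (Finset.sum_nonneg fun i _ => integral_nonneg fun ω => sq_nonneg _)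
  obtain ⟨-, d2, d4⟩ := moments_error hn hZ hZa hi hm hv hva (by nlinarith) hb
  obtain ⟨e1, e2, e4⟩ := moments_error hn hZ₁ hZ₁a hi₁ hm₁ hv₁ hv₁a
    (by nlinarith [pow_pos ha0 3]) hb₁
  set g : Ω → ℝ := fun ω => (1 / (n : ℝ)) * ∑ j, Z j ω with hg
  set g₁ : Ω → ℝ := fun ω => (1 / (n : ℝ)) * ∑ j, Z₁ j ω with hg₁
  have hgm : Measurable g := by fun_prop
  have hg₁m : Measurable g₁ := by fun_prop
  have havg : ∀ (W : Fin n → Ω → ℝ) (B : ℝ), (∀ k ω, |W k ω| ≤ B) → ∀ ω,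
      |(1 / (n : ℝ)) * ∑ j, W j ω| ≤ B := fun W B hW ω => by
    rw [abs_mul, abs_of_pos (by positivity)]
    have : |∑ i, W i ω| ≤ n * B := by
      refine (Finset.abs_sum_le_sum_abs _ _).trans ?_
      refine (Finset.sum_le_card_nsmul Finset.univ _ B fun i _ => hW i ω).trans ?_
      simp
    calc 1 / (n : ℝ) * |∑ i, W i ω| ≤ 1 / n * (n * B) := by gcongr
      _ = B := by field_simp
  have hgC : ∀ ω, |g ω| ≤ a ^ 2 := fun ω => (havg Z a hZa ω).trans (by nlinarith)
  have hg₁C : ∀ ω, |g₁ ω| ≤ a ^ 2 := havg Z₁ _ hZ₁a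
  have hL0 : 0 ≤ L := by linarith
  have main := integral_regularized_score_sq_le hgm hg₁m hgC hg₁C hf0 hρ hL0 hfL hκ hs ha0 e1 e2 d2 e4 d4
  obtain ⟨m2, m1⟩ := integral_regularized_score_moments_le hgm hg₁m hgC hg₁C hf0 hρ hL0 hfL e2 d2
  have hM : ∀ ω, 0 < max (g ω) ρ := fun ω => lt_max_of_lt_right hρ
  have hψm : Measurable fun ω => g₁ ω / max (g ω) ρ := hg₁m.div (hgm.max measurable_const)
  have hψC : ∀ ω, |g₁ ω / max (g ω) ρ| ≤ a ^ 2 / ρ := fun ω => by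
    rw [abs_div, abs_of_pos (hM ω)]
    exact div_le_div₀ ((abs_nonneg _).trans (hg₁C ω)) (hg₁C ω) hρ (le_max_right _ _)
  have hψ1 := integrable_of_abs_le (P := P) hψm hψC
  have hψ2 := integrable_pow_of_abs_le (P := P) hψm hψC 2
  set N : ℝ := n * ρ with hN
  have hN0 : 0 < N := by positivity
  set E₂ := ∫ ω, (g₁ ω / max (g ω) ρ) ^ 2 ∂P with hE₂
  set E₁ := ∫ ω, g₁ ω / max (g ω) ρ ∂P with hE₁
  set Ea := ∫ ω, |g₁ ω / max (g ω) ρ| ∂P with hEa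
  have hk : ∀ k, (∫ ω, ((g₁ ω - Z₁ k ω / n) / max (g ω - (Z k ω - z₀) / n) ρ) ^ 2 ∂P) * p k
        - 2 * (∫ ω, (g₁ ω - Z₁ k ω / n) / max (g ω - (Z k ω - z₀) / n) ρ ∂P) * q k
      ≤ (E₂ + ((5 + 8 * κ) * a * E₂ + (1 + 2 * κ) * a ^ 2) / N) * p k - 2 * E₁ * q k
        + 2 * (a ^ 2 + 2 * a * Ea) / N * |q k| := by
    intro k
    have hm' : Measurable fun ω => (g₁ ω - Z₁ k ω / n) / max (g ω - (Z k ω - z₀) / n) ρ := by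
      have h1 := hZ k
      have h2 := hZ₁ k
      exact Measurable.div (by fun_prop) (Measurable.max (by fun_prop) measurable_const)
    have hC' : ∀ ω, |(g₁ ω - Z₁ k ω / n) / max (g ω - (Z k ω - z₀) / n) ρ| ≤ (a ^ 2 + a ^ 2 / n) / ρ := by
      intro ω
      rw [abs_div, abs_of_pos (lt_max_of_lt_right hρ)]
      refine div_le_div₀ (by positivity) ?_ hρ (le_max_right _ _)
      refine (abs_sub _ _).trans ?_
      rw [abs_div, abs_of_pos hn']
      gcongr
      · exact hg₁C ω
      · exact hZ₁a k ω
    have i1 := integrable_of_abs_le (P := P) hm' hC'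
    have i2 := integrable_pow_of_abs_le (P := P) hm' hC' 2
    have hz2 := integrable_pow_of_abs_le (P := P) (hZ₁ k) (hZ₁a k) 2
    refine integral_score_perturb_le hψ1 hψ2 i1 i2 hz2 ha0 hκ hN0 (hp k) (hZ₁v k) fun ω => ?_
    have hz : |Z k ω - z₀| ≤ 2 * a := (abs_sub _ _).trans (by linarith [hZa k ω])
    exact regularized_score_perturb_le (g := g ω) (g₁ := g₁ ω) (q := q k) hn hρ ha0 hN hκ1 (hp k) hz
      (hZ₁a k ω)
  have hsum : (1 / (n : ℝ)) * ∑ k, ((∫ ω, ((g₁ ω - Z₁ k ω / n) / max (g ω - (Z k ω - z₀) / n) ρ) ^ 2 ∂P) * p k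
        - 2 * (∫ ω, (g₁ ω - Z₁ k ω / n) / max (g ω - (Z k ω - z₀) / n) ρ ∂P) * q k)
      ≤ (E₂ + ((5 + 8 * κ) * a * E₂ + (1 + 2 * κ) * a ^ 2) / N) * f - 2 * E₁ * f₁
        + 2 * (a ^ 2 + 2 * a * Ea) / N * F₁ := by
    calc _ ≤ (1 / (n : ℝ)) * ∑ k, ((E₂ + ((5 + 8 * κ) * a * E₂ + (1 + 2 * κ) * a ^ 2) / N) * p k
          - 2 * E₁ * q k + 2 * (a ^ 2 + 2 * a * Ea) / N * |q k|) := by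
          gcongr with k; exact hk k
      _ = _ := by
          rw [Finset.sum_add_distrib, Finset.sum_sub_distrib, ← Finset.mul_sum, ← Finset.mul_sum,
            ← Finset.mul_sum, hf, hf₁, hF₁]
          ring
  clear_value E₂ E₁ Ea
  have hfF : |f₁| ≤ F₁ := by
    rw [hf₁, hF₁, abs_mul, abs_of_pos (by positivity)]
    gcongr
    exact Finset.abs_sum_le_sum_abs _ _
  have hF0 : 0 ≤ F₁ := (abs_nonneg _).trans hfF
  have hn1 : (1 : ℝ) ≤ n := by exact_mod_cast hn
  have hA : v₁ / n + b₁ ^ 2 ≤ 2 * a ^ 3 / n := by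
    have h1 : b₁ ^ 2 ≤ (1 / (n : ℝ)) ^ 2 := by rw [← sq_abs]; gcongr
    have h2 : (1 / (n : ℝ)) ^ 2 ≤ a ^ 3 / n := by
      rw [div_pow, one_pow, div_le_div_iff₀ (by positivity) hn']
      have : 1 ≤ a ^ 3 := one_le_pow₀ ha
      calc 1 * (n : ℝ) ≤ n * n := by gcongr
        _ ≤ a ^ 3 * n ^ 2 := by rw [← sq]; exact le_mul_of_one_le_left (by positivity) this
    have h3 : v₁ / n ≤ a ^ 3 / n := by gcongr
    have h4 : 2 * a ^ 3 / n = a ^ 3 / n + a ^ 3 / n := by ring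
    linarith
  have hB : v / n + b ^ 2 ≤ 2 * a / n := by
    have h1 : b ^ 2 ≤ (1 / (n : ℝ)) ^ 2 := by rw [← sq_abs]; gcongr
    have h2 : (1 / (n : ℝ)) ^ 2 ≤ a / n := by
      rw [div_pow, one_pow, div_le_div_iff₀ (by positivity) hn']
      calc 1 * (n : ℝ) ≤ n * n := by gcongr
        _ ≤ a * n ^ 2 := by rw [← sq]; exact le_mul_of_one_le_left (by positivity) ha
    have h3 : v / n ≤ a / n := by gcongr
    have h4 : 2 * a / n = a / n + a / n := by ring
    linarith
  -- The scale `κ² = a/(nρ²)` is the squared relative size of the density error against the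
  -- threshold `ρ`; the derivative error carries a further `a²`.
  have hAρ : (v₁ / n + b₁ ^ 2) / ρ ^ 2 ≤ 2 * a ^ 2 * κ ^ 2 := by
    rw [← hκ2]
    calc _ ≤ 2 * a ^ 3 / n / ρ ^ 2 := by gcongr
      _ = _ := by field_simp
  have hBρ : (v / n + b ^ 2) / ρ ^ 2 ≤ 2 * κ ^ 2 := by
    rw [← hκ2]
    calc _ ≤ 2 * a / n / ρ ^ 2 := by gcongr
      _ = _ := by field_simp
  have hI0 : 0 ≤ f₁ ^ 2 / f := by positivity
  have m2' : E₂ * f ≤ 4 * a ^ 2 * κ ^ 2 * f + 4 * (f₁ ^ 2 / f) * (1 + 2 * κ ^ 2) := by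
    refine m2.trans ?_
    have h1 : 2 * f * (v₁ / n + b₁ ^ 2) / ρ ^ 2 ≤ 2 * f * (2 * a ^ 2 * κ ^ 2) := by
      rw [mul_div_assoc]; gcongr
    have h2 : 4 * (f₁ ^ 2 / f) * (1 + (v / n + b ^ 2) / ρ ^ 2) ≤ 4 * (f₁ ^ 2 / f) * (1 + 2 * κ ^ 2) := by
      gcongr
    linarith only [h1, h2]
  have m1' : Ea ≤ 2 * L + (a ^ 2 + L) * κ ^ 2 := by
    refine m1.trans ?_
    have h1 : (v₁ / n + b₁ ^ 2) / (2 * ρ ^ 2) = (v₁ / n + b₁ ^ 2) / ρ ^ 2 / 2 := by ring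
    have h2 : (v / n + b ^ 2) / (2 * ρ ^ 2) = (v / n + b ^ 2) / ρ ^ 2 / 2 := by ring
    rw [h1, h2]
    have h3 : L * (1 / 2 + (v / n + b ^ 2) / ρ ^ 2 / 2) ≤ L * (1 / 2 + κ ^ 2) := by
      gcongr; linarith only [hBρ]
    have h4 : L * (1 / 2 + κ ^ 2) = L / 2 + L * κ ^ 2 := by ring
    have h5 : (a ^ 2 + L) * κ ^ 2 = a ^ 2 * κ ^ 2 + L * κ ^ 2 := by ring
    rw [h4] at h3
    rw [h5]
    linarith only [h3, hAρ, hL]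
  refine hsum.trans ?_
  have s1 : (5 + 8 * κ) * a * (E₂ * f) / N
      ≤ (5 + 8 * κ) * a * (4 * a ^ 2 * κ ^ 2 * f + 4 * (f₁ ^ 2 / f) * (1 + 2 * κ ^ 2)) / N := by gcongr
  have s2 : 2 * (a ^ 2 + 2 * a * Ea) / N * F₁
      ≤ 2 * (a ^ 2 + 2 * a * (2 * L + (a ^ 2 + L) * κ ^ 2)) / N * F₁ := by gcongr
  have s3 : 2 * |b₁| * |f₁| / ρ ≤ 2 / N * F₁ := by
    calc 2 * |b₁| * |f₁| / ρ ≤ 2 * (1 / n) * F₁ / ρ := by gcongr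
      _ = 2 / N * F₁ := by rw [hN]; field_simp
  have s4 : (E₂ + ((5 + 8 * κ) * a * E₂ + (1 + 2 * κ) * a ^ 2) / N) * f - 2 * E₁ * f₁
      = (E₂ * f - 2 * E₁ * f₁) + (5 + 8 * κ) * a * (E₂ * f) / N + (1 + 2 * κ) * a ^ 2 * f / N := by ring
  have s5 : ((1 + s) * (v₁ / n + b₁ ^ 2) + (1 + 1 / s) * (L ^ 2 * (v / n + b ^ 2))) / ρ
        + κ / ρ * ((v₁ / n + b₁ ^ 2) + L ^ 2 * (v / n + b ^ 2))
        + 1 / (κ * ρ ^ 3) * (((56 * a ^ 3 * v₁ / n ^ 2 + 8 * b₁ ^ 2 / n ^ 2) / a ^ 2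
          + a ^ 2 * (56 * a * v / n ^ 2 + 8 * b ^ 2 / n ^ 2)) / 2
          + L ^ 2 * (56 * a * v / n ^ 2 + 8 * b ^ 2 / n ^ 2))
      = ((1 + s + κ) / N + 28 * a / (κ * ρ ^ 3 * n ^ 2)) * v₁
          + ((1 + s + κ) / ρ + 4 / (κ * ρ ^ 3 * a ^ 2 * n ^ 2)) * b₁ ^ 2
          + ((1 + 1 / s + κ) * L ^ 2 / N
              + 56 * a / (κ * ρ ^ 3 * n ^ 2) * (a ^ 2 / 2 + L ^ 2)) * v
          + ((1 + 1 / s + κ) * L ^ 2 / ρ + 8 / (κ * ρ ^ 3 * n ^ 2) * (a ^ 2 / 2 + L ^ 2)) * b ^ 2 := by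
    rw [hN]
    field_simp
    ring
  have s6 : (5 + 8 * κ) * a * (4 * a ^ 2 * κ ^ 2 * f + 4 * (f₁ ^ 2 / f) * (1 + 2 * κ ^ 2)) / N
      = 4 * (5 + 8 * κ) * a ^ 3 * κ ^ 2 / N * f
        + 4 * (5 + 8 * κ) * a * (1 + 2 * κ ^ 2) / N * (f₁ ^ 2 / f) := by ring
  have s7 : (4 * (5 + 8 * κ) * a ^ 3 * κ ^ 2 + (1 + 2 * κ) * a ^ 2) / N * f
      = 4 * (5 + 8 * κ) * a ^ 3 * κ ^ 2 / N * f + (1 + 2 * κ) * a ^ 2 * f / N := by ring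
  have s8 : (2 + 2 * (a ^ 2 + 2 * a * (2 * L + (a ^ 2 + L) * κ ^ 2))) / N * F₁
      = 2 / N * F₁ + 2 * (a ^ 2 + 2 * a * (2 * L + (a ^ 2 + L) * κ ^ 2)) / N * F₁ := by ring
  rw [s4, s7, s8, ← s5]
  rw [s6] at s1
  linarith only [main, s1, s2, s3]

end EBMeans

/-! ### The estimator in the model: leave-one-out form and Stein's identity -/

namespace EBMeans

section

variable {n : ℕ}

lemma hasDerivAt_kernelEst (w : Fin n → ℝ) (x : ℝ) :
    HasDerivAt (kernelEst w) ((1 / (n : ℝ)) * ∑ j, kernelDeriv (bandwidth n) (x - w j)) x := by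
  have h : ∀ j ∈ Finset.univ, HasDerivAt (fun y => kernelDens (bandwidth n) (y - w j))
      (kernelDeriv (bandwidth n) (x - w j)) x := fun j _ =>
    (hasDerivAt_kernelDens (bandwidth n) (x - w j)).comp_sub_const x (w j)
  exact (HasDerivAt.fun_sum h).const_mul (1 / (n : ℝ))

/-- The regularized score at `x` of the kernel estimate in which the contributions of the `k`-th
observation are replaced by those of an observation at `x`. -/
noncomputable def looScore (ρ : ℝ) (k : Fin n) (x : ℝ) (w : Fin n → ℝ) : ℝ :=
  ((1 / (n : ℝ)) * ∑ j, kernelDeriv (bandwidth n) (x - w j)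
      - kernelDeriv (bandwidth n) (x - w k) / n)
    / max ((1 / (n : ℝ)) * ∑ j, kernelDens (bandwidth n) (x - w j)
      - (kernelDens (bandwidth n) (x - w k) - kernelDens (bandwidth n) 0) / n) ρ

/-- At `x = w k` the `k`-th kernel contributes slope `0` and the constant value at `0`. The
corrections in `looScore` vanish there, so the leave-one-out form is exact. -/
lemma gebRule_self (ρ : ℝ) (w : Fin n → ℝ) (k : Fin n) :
    gebRule ρ w (w k) = w k + looScore ρ k (w k) w := by
  rw [gebRule, (hasDerivAt_kernelEst w (w k)).deriv, looScore]
  simp only [sub_self, kernelDeriv_zero, zero_div, sub_zero]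
  rfl

lemma looScore_update (ρ : ℝ) (k : Fin n) (x : ℝ) (w : Fin n → ℝ) (y : ℝ) :
    looScore ρ k x (Function.update w k y) = looScore ρ k x w := by
  have key : ∀ F : ℝ → ℝ, (1 / (n : ℝ)) * ∑ j, F (x - Function.update w k y j) - F (x - y) / n
      = (1 / (n : ℝ)) * ∑ j, F (x - w j) - F (x - w k) / n := by
    intro F
    rw [← Finset.add_sum_erase _ _ (Finset.mem_univ k),
      ← Finset.add_sum_erase _ (fun j => F (x - w j)) (Finset.mem_univ k), Function.update_self]
    have : ∑ j ∈ Finset.univ.erase k, F (x - Function.update w k y j)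
        = ∑ j ∈ Finset.univ.erase k, F (x - w j) :=
      Finset.sum_congr rfl fun j hj => by rw [Function.update_of_ne (Finset.ne_of_mem_erase hj)]
    rw [this]
    ring
  have h1 := key (kernelDeriv (bandwidth n))
  have h2 := key (kernelDens (bandwidth n))
  rw [looScore, looScore, Function.update_self, h1, sub_div (kernelDens _ _),
    sub_div (kernelDens _ _), ← sub_add, ← sub_add, h2]

lemma abs_looScore_le {ρ : ℝ} (hρ : 0 < ρ) (k : Fin n) (x : ℝ) (w : Fin n → ℝ) :
    |looScore ρ k x w| ≤ 2 * bandwidth n ^ 2 / ρ := by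
  have ha : 0 ≤ bandwidth n := Real.sqrt_nonneg _
  have hn : (1 : ℝ) ≤ n := by exact_mod_cast Nat.one_le_iff_ne_zero.2 (Fin.pos k).ne'
  have hs : |∑ j, kernelDeriv (bandwidth n) (x - w j)| ≤ n * bandwidth n ^ 2 := by
    refine (Finset.abs_sum_le_sum_abs _ _).trans ?_
    refine (Finset.sum_le_card_nsmul Finset.univ _ (bandwidth n ^ 2)
      fun j _ => abs_kernelDeriv_le ha _).trans ?_
    simp
  rw [looScore, abs_div, abs_of_pos (lt_max_of_lt_right hρ)]
  refine div_le_div₀ (by positivity) ?_ hρ (le_max_right _ _)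
  refine (abs_sub _ _).trans ?_
  rw [abs_mul, abs_div (kernelDeriv _ _), abs_of_pos (show (0 : ℝ) < n by linarith),
    abs_of_pos (show (0 : ℝ) < 1 / n by positivity)]
  have h1 : 1 / (n : ℝ) * |∑ j, kernelDeriv (bandwidth n) (x - w j)| ≤ bandwidth n ^ 2 := by
    calc _ ≤ 1 / (n : ℝ) * (n * bandwidth n ^ 2) := by gcongr
      _ = _ := by field_simp
  have h2 : |kernelDeriv (bandwidth n) (x - w k)| / n ≤ bandwidth n ^ 2 :=
    (div_le_self (abs_nonneg _) hn).trans (abs_kernelDeriv_le ha _)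
  linarith

lemma measurable_looScore (ρ : ℝ) (k : Fin n) :
    Measurable (Function.uncurry (looScore ρ k)) := by
  have h1 := (continuous_kernelDens (bandwidth n)).measurable
  have h2 := (continuous_kernelDeriv (bandwidth n)).measurable
  have m : ∀ j : Fin n, Measurable fun p : ℝ × (Fin n → ℝ) => p.1 - p.2 j := fun j => by fun_prop
  have m1 : ∀ j : Fin n, Measurable fun p : ℝ × (Fin n → ℝ) =>
    kernelDens (bandwidth n) (p.1 - p.2 j) := fun j => h1.comp (m j)
  have m2 : ∀ j : Fin n, Measurable fun p : ℝ × (Fin n → ℝ) =>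
    kernelDeriv (bandwidth n) (p.1 - p.2 j) := fun j => h2.comp (m j)
  unfold looScore Function.uncurry
  refine Measurable.div ?_ (Measurable.max ?_ measurable_const)
  · exact ((Finset.measurable_sum _ fun j _ => m2 j).const_mul _).sub ((m2 k).div_const _)
  · exact ((Finset.measurable_sum _ fun j _ => m1 j).const_mul _).sub
      (((m1 k).sub_const _).div_const _)

variable {Ω : Type*} [MeasurableSpace Ω] {P : Measure Ω} [IsProbabilityMeasure P]
  {θ X : Fin n → Ω → ℝ}

lemma IsNormalMeansModel.isProbabilityMeasure_map (h : IsNormalMeansModel θ X P) (k : Fin n) :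
    IsProbabilityMeasure (P.map (θ k)) :=
  Measure.isProbabilityMeasure_map (h.measurable_mean k).aemeasurable

/-- Stein's identity for the risk of the general empirical Bayes estimator of `θ k`. -/
lemma IsNormalMeansModel.risk_gebRule (h : IsNormalMeansModel θ X P) (hi : iIndepFun θ P)
    {ρ : ℝ} (hρ : 0 < ρ) (k : Fin n) :
    Integrable (fun ω => (gebRule ρ (fun j => X j ω) (X k ω) - θ k ω) ^ 2) P ∧
    Integrable (fun x => (∫ ω, looScore ρ k x (fun j => X j ω) ^ 2 ∂P) * mixDensity (P.map (θ k)) x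
      - 2 * (∫ ω, looScore ρ k x (fun j => X j ω) ∂P) * mixDeriv (P.map (θ k)) x) ∧
    ∫ ω, (gebRule ρ (fun j => X j ω) (X k ω) - θ k ω) ^ 2 ∂P
      = 1 + ∫ x, ((∫ ω, looScore ρ k x (fun j => X j ω) ^ 2 ∂P) * mixDensity (P.map (θ k)) x
        - 2 * (∫ ω, looScore ρ k x (fun j => X j ω) ∂P) * mixDeriv (P.map (θ k)) x) := by
  have := h.isProbabilityMeasure_map k
  have hm := measurable_looScore ρ k
  have hb := abs_looScore_le hρ k
  -- The square of `ψ + (X_k - θ_k)` is expanded, and its three terms correspond to `g = 1`, `g z =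
  -- z` and `g z = z²`. No integration by parts is needed: the middle weight `(x - u) φ(x - u)`
  -- already integrates to `-mixDeriv`.
  obtain ⟨a1, a2, a3⟩ := h.integral_eq_of_update hi k (H := fun x w => looScore ρ k x w ^ 2)
    (C := (2 * bandwidth n ^ 2 / ρ) ^ 2) (g := fun _ => 1) (hm.pow_const 2)
    (fun x w => by rw [abs_pow]; exact pow_le_pow_left₀ (abs_nonneg _) (hb x w) 2)
    (fun x w y => by simp only [looScore_update]) continuous_const
    (by simpa using integrable_gaussianPDFReal 0 1)
  obtain ⟨b1, b2, b3⟩ := h.integral_eq_of_update hi k (H := looScore ρ k) (g := fun z => z) hm hb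
    (fun x w y => looScore_update ρ k x w y) continuous_id integrable_mul_gaussianPDFReal
  obtain ⟨c1, c2, c3⟩ := h.integral_eq_of_update hi k (H := fun _ _ => 1) (C := 1)
    (g := fun z => z ^ 2) measurable_const (by simp) (by simp) (by fun_prop)
    integrable_sq_mul_gaussianPDFReal
  have hd : ∀ x, ∫ u, (x - u) * gaussianPDFReal 0 1 (x - u) ∂(P.map (θ k))
      = -mixDeriv (P.map (θ k)) x := fun x => by rw [mixDeriv, integral_neg, neg_neg]
  have hf : ∀ x, ∫ u, 1 * gaussianPDFReal 0 1 (x - u) ∂(P.map (θ k))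
      = mixDensity (P.map (θ k)) x := fun x => by simp only [one_mul]; rfl
  simp only [hd] at b2 b3
  simp only [hf, mul_one] at a1 a2 a3
  simp only [one_mul, integral_const, probReal_univ, smul_eq_mul] at c1 c2 c3
  have hs := continuous_gaussianPDFReal_std
  rw [(integral_conv (h := fun z => z ^ 2 * gaussianPDFReal 0 1 z) (by fun_prop)
    integrable_sq_mul_gaussianPDFReal (P.map (θ k))).2, integral_sq_mul_gaussianPDFReal] at c3
  have e : ∀ ω, (gebRule ρ (fun j => X j ω) (X k ω) - θ k ω) ^ 2
      = (X k ω - θ k ω) ^ 2 + (looScore ρ k (X k ω) (fun j => X j ω) ^ 2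
        + 2 * (looScore ρ k (X k ω) (fun j => X j ω) * (X k ω - θ k ω))) := fun ω => by
    rw [gebRule_self ρ (fun j => X j ω) k]
    ring
  have e2 : ∀ x, (∫ ω, looScore ρ k x (fun j => X j ω) ^ 2 ∂P) * mixDensity (P.map (θ k)) x
      - 2 * (∫ ω, looScore ρ k x (fun j => X j ω) ∂P) * mixDeriv (P.map (θ k)) x
      = (∫ ω, looScore ρ k x (fun j => X j ω) ^ 2 ∂P) * mixDensity (P.map (θ k)) x
      + 2 * ((∫ ω, looScore ρ k x (fun j => X j ω) ∂P) * -mixDeriv (P.map (θ k)) x) := fun x => by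
    ring
  simp only [e, e2]
  refine ⟨c1.fun_add (a1.fun_add (b1.const_mul 2)), a2.fun_add (b2.const_mul 2), ?_⟩
  rw [integral_add c1 (a1.fun_add (b1.const_mul 2)), integral_add a1 (b1.const_mul 2),
    integral_const_mul, integral_add a2 (b2.const_mul 2), integral_const_mul, a3, b3, c3]

lemma IsNormalMeansModel.integral_obs (h : IsNormalMeansModel θ X P) (hi : iIndepFun θ P)
    (k : Fin n) {F : ℝ → ℝ} (hF : Measurable F) {C : ℝ} (hC : ∀ x, |F x| ≤ C) :
    ∫ ω, F (X k ω) ∂P = ∫ u, ∫ y, F y ∂(gaussianReal u 1) ∂(P.map (θ k)) := by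
  have hθ := h.measurable_mean k
  have hX := h.measurable_obs k
  have := h.isProbabilityMeasure_map k
  have hm : Measurable fun p : ℝ × ℝ => F p.2 := hF.comp measurable_snd
  have e : ∫ ω, F (X k ω) ∂P = ∫ p, F p.2 ∂(P.map fun ω => (θ k ω, X k ω)) :=
    (integral_map (hθ.prodMk hX).aemeasurable hm.aestronglyMeasurable).symm
  rw [e, h.map_pair hi k, Measure.integral_compProd (integrable_of_abs_le hm fun p => hC p.2)]
  rfl

/-- Averaging a nonnegative function of an observation costs at most its Lebesgue integral. -/
lemma IsNormalMeansModel.integral_obs_le (h : IsNormalMeansModel θ X P) (hi : iIndepFun θ P)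
    (k : Fin n) {F : ℝ → ℝ} (hF : Measurable F) {C : ℝ} (hC : ∀ x, |F x| ≤ C)
    (hF0 : ∀ x, 0 ≤ F x) (hFi : Integrable F) :
    ∫ ω, F (X k ω) ∂P ≤ ∫ x, F x := by
  have := h.isProbabilityMeasure_map k
  obtain ⟨-, a2, a3⟩ := h.integral_eq_of_update hi k (H := fun x _ => F x) (C := C)
    (g := fun _ => 1) (hF.comp measurable_fst) (fun x w => hC x) (fun x w y => rfl)
    continuous_const (by simpa using integrable_gaussianPDFReal 0 1)
  simp only [one_mul, mul_one, integral_const, probReal_univ, smul_eq_mul] at a2 a3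
  rw [a3]
  refine integral_mono a2 hFi fun x => ?_
  exact mul_le_of_le_one_right (hF0 x) (mixDensity_le_one (P.map (θ k)) x)

lemma IsNormalMeansModel.integral_kernelDens (h : IsNormalMeansModel θ X P) (hi : iIndepFun θ P)
    (k : Fin n) {a : ℝ} (ha : 1 ≤ a) (x : ℝ) :
    ∫ ω, kernelDens a (x - X k ω) ∂P
      = mixDensity (P.map (θ k)) x + ∫ u, biasDens a (x - u) ∂(P.map (θ k)) := by
  have := h.isProbabilityMeasure_map k
  have ha0 : 0 ≤ a := by linarith
  rw [h.integral_obs hi k (F := fun y => kernelDens a (x - y))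
    ((continuous_kernelDens a).comp (by fun_prop)).measurable fun y => abs_kernelDens_le ha0 _]
  simp only [integral_kernelDens_eq_add_bias ha0]
  refine integral_add (integrable_mixDensity_integrand _ x) ?_
  exact integrable_of_abs_le ((continuous_biasDens a).comp (by fun_prop)).measurable
    fun u => abs_biasDens_le ha _

lemma IsNormalMeansModel.integral_kernelDeriv (h : IsNormalMeansModel θ X P) (hi : iIndepFun θ P)
    (k : Fin n) {a : ℝ} (ha : 1 ≤ a) (x : ℝ) :
    ∫ ω, kernelDeriv a (x - X k ω) ∂P
      = mixDeriv (P.map (θ k)) x + ∫ u, biasDeriv a (x - u) ∂(P.map (θ k)) := by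
  have := h.isProbabilityMeasure_map k
  have ha0 : 0 ≤ a := by linarith
  rw [h.integral_obs hi k (F := fun y => kernelDeriv a (x - y))
    ((continuous_kernelDeriv a).comp (by fun_prop)).measurable fun y => abs_kernelDeriv_le ha0 _]
  simp only [integral_kernelDeriv_eq_add_bias ha0]
  refine integral_add (integrable_mixDeriv_integrand _ x).fun_neg ?_
  exact integrable_of_abs_le ((continuous_biasDeriv a).comp (by fun_prop)).measurable
    fun u => abs_biasDeriv_le ha _

lemma IsNormalMeansModel.isProbabilityMeasure_mixture (h : IsNormalMeansModel θ X P) (hn : 0 < n) :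
    IsProbabilityMeasure (mixture θ P) := by
  have := h.isProbabilityMeasure_map
  constructor
  simp only [mixture, Measure.smul_apply, Measure.finsetSum_apply, measure_univ, Finset.sum_const,
    Finset.card_univ, Fintype.card_fin, smul_eq_mul, nsmul_eq_mul, mul_one]
  exact ENNReal.inv_mul_cancel (by exact_mod_cast hn.ne') (ENNReal.natCast_ne_top n)

end

/-! ### Mixture averages and mean-square bounds for translates -/

section

lemma integral_mixture {Ω : Type*} [MeasurableSpace Ω] {P : Measure Ω} {n : ℕ}
    {θ : Fin n → Ω → ℝ} {F : ℝ → ℝ} (hF : ∀ k, Integrable F (P.map (θ k))) :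
    ∫ u, F u ∂(mixture θ P) = (1 / (n : ℝ)) * ∑ k, ∫ u, F u ∂(P.map (θ k)) := by
  rw [mixture, integral_smul_measure, integral_finsetSum_measure fun k _ => hF k]
  simp

/-- Jensen's inequality for averages of a bounded continuous function. -/
lemma sq_integral_le {Ω : Type*} [MeasurableSpace Ω] {P : Measure Ω} [IsProbabilityMeasure P]
    {F : Ω → ℝ} (hF : Measurable F) {C : ℝ} (hC : ∀ ω, |F ω| ≤ C) :
    (∫ ω, F ω ∂P) ^ 2 ≤ ∫ ω, F ω ^ 2 ∂P := by
  have h1 := integrable_of_abs_le (P := P) hF hC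
  have h2 := integrable_pow_of_abs_le (P := P) hF hC 2
  set m := ∫ ω, F ω ∂P with hm
  have h : 0 ≤ ∫ ω, (F ω - m) ^ 2 ∂P := integral_nonneg fun ω => sq_nonneg _
  have e : ∀ ω, (F ω - m) ^ 2 = F ω ^ 2 + (-2 * m * F ω + m ^ 2) := fun ω => by ring
  simp only [e] at h
  rw [integral_add h2 ((h1.const_mul _).fun_add (integrable_const _)),
    integral_add (h1.const_mul _) (integrable_const _), integral_const_mul, ← hm] at h
  simp only [integral_const, probReal_univ, smul_eq_mul, one_mul] at h
  nlinarith

/-- Square-integrable functions from a bound on the Lebesgue integral of the square. -/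
lemma integrable_sq_of_lintegral_le {F : ℝ → ℝ} (hF : Continuous F) {B : ℝ} (hB : 0 ≤ B)
    (h : ∫⁻ x, ENNReal.ofReal (F x ^ 2) ≤ ENNReal.ofReal B) :
    Integrable (fun x => F x ^ 2) ∧ ∫ x, F x ^ 2 ≤ B := by
  have hm : AEStronglyMeasurable (fun x => F x ^ 2) volume := (hF.pow 2).aestronglyMeasurable
  have h0 : ∀ x, 0 ≤ F x ^ 2 := fun x => sq_nonneg _
  refine ⟨⟨hm, ?_⟩, ?_⟩
  · rw [hasFiniteIntegral_iff_ofReal (ae_of_all _ h0)]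
    exact h.trans_lt ENNReal.ofReal_lt_top
  · rw [integral_eq_lintegral_of_nonneg_ae (ae_of_all _ h0) hm]
    exact ENNReal.toReal_le_of_le_ofReal hB h

/-- The average of a bounded square-integrable function over translates, in mean square. -/
lemma integral_sq_conv_le {F : ℝ → ℝ} (hF : Continuous F) {C : ℝ} (hC : ∀ x, |F x| ≤ C) {B : ℝ}
    (hi : Integrable fun x => F x ^ 2) (hB : ∫ x, F x ^ 2 ≤ B) (G : Measure ℝ)
    [IsProbabilityMeasure G] :
    Integrable (fun x => (∫ u, F (x - u) ∂G) ^ 2) ∧ ∫ x, (∫ u, F (x - u) ∂G) ^ 2 ≤ B := by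
  have h := integral_conv (h := fun z => F z ^ 2) (by fun_prop) hi G
  have hle : ∀ x, (∫ u, F (x - u) ∂G) ^ 2 ≤ ∫ u, F (x - u) ^ 2 ∂G := fun x =>
    sq_integral_le (hF.comp (by fun_prop)).measurable fun u => hC _
  have hm : AEStronglyMeasurable (fun x => ∫ u, F (x - u) ∂G) volume := by
    have : Continuous fun p : ℝ × ℝ => F (p.1 - p.2) := by fun_prop
    exact (this.stronglyMeasurable.integral_prod_right (ν := G)).aestronglyMeasurable
  have hi' : Integrable (fun x => (∫ u, F (x - u) ∂G) ^ 2) := by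
    refine h.1.mono' (hm.pow 2) (ae_of_all _ fun x => ?_)
    rw [Real.norm_of_nonneg (sq_nonneg _)]
    exact hle x
  exact ⟨hi', ((integral_mono hi' h.1 hle).trans h.2.le).trans hB⟩

end

end EBMeans

/-! ### Collecting the error terms -/

namespace EBMeans

/-- The value `s = √3 L/a` minimizes `(1 + s) a²/3 + (1 + 1/s) L²`, with minimum `(a/√3 + L)²`; this
gives the main term with constant one. Everything else is compared with `aV`, where `V = (a² +
L²)/(nρ)`, and `aV` is comparable to the main term. -/
lemma error_terms_le {n a ρ κ L s : ℝ} (ha : 1 ≤ a) (han : a ≤ n) (hρ : 0 < ρ) (hL : 1 ≤ L)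
    (hκ : 0 < κ) (hκ2 : a / (n * ρ ^ 2) = κ ^ 2) (hs : s = √3 * L / a) :
    ((1 + s + κ) / (n * ρ) + 28 * a / (κ * ρ ^ 3 * n ^ 2)) * (a ^ 3 / (3 * Real.pi))
      + ((1 + s + κ) / ρ + 4 / (κ * ρ ^ 3 * a ^ 2 * n ^ 2)) * (a / n ^ 2)
      + ((1 + 1 / s + κ) * L ^ 2 / (n * ρ)
          + 56 * a / (κ * ρ ^ 3 * n ^ 2) * (a ^ 2 / 2 + L ^ 2)) * (a / Real.pi)
      + ((1 + 1 / s + κ) * L ^ 2 / ρ + 8 / (κ * ρ ^ 3 * n ^ 2) * (a ^ 2 / 2 + L ^ 2)) * (a / n ^ 2)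
      + (2 + 2 * (a ^ 2 + 2 * a * (2 * L + (a ^ 2 + L) * κ ^ 2))) / (n * ρ)
      + (4 * (5 + 8 * κ) * a ^ 3 * κ ^ 2 + (1 + 2 * κ) * a ^ 2) / (n * ρ)
      + 4 * (5 + 8 * κ) * a * (1 + 2 * κ ^ 2) / (n * ρ)
    ≤ (1 + 2000 * (1 / a + κ + κ ^ 3)) * ((a / √3 + L) ^ 2 * (a / (Real.pi * ρ * n))) := by
  have ha0 : 0 < a := by linarith
  have hL0 : 0 < L := by linarith
  have hn : 0 < n := by linarith
  have hr : √3 ^ 2 = (3 : ℝ) := Real.sq_sqrt (by norm_num)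
  have hr0 : 0 < √(3 : ℝ) := by positivity
  obtain ⟨q, hq⟩ : ∃ q, q = 1 / √(3 : ℝ) := ⟨_, rfl⟩
  have hq0 : 0 < q := by rw [hq]; positivity
  have hq2 : q ^ 2 = 1 / 3 := by rw [hq, div_pow, hr]; norm_num
  have hq1 : q ≤ 1 := by nlinarith only [hq2, hq0]
  have hr3 : √(3 : ℝ) = 3 * q := by rw [hq]; field_simp; linarith
  have haq : a / √3 = a * q := by rw [hq]; ring
  have hs1 : s = 3 * q * L / a := by rw [hs, hr3]
  have hs2 : 1 / s = q * a / L := by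
    rw [hs1]; field_simp; linarith
  obtain ⟨i, hi⟩ : ∃ i, i = 1 / (n * ρ) := ⟨_, rfl⟩
  have hi0 : 0 < i := by rw [hi]; positivity
  obtain ⟨p, hp⟩ : ∃ p, p = 1 / Real.pi := ⟨_, rfl⟩
  have hp0 : 0 < p := by rw [hp]; positivity
  have hp3 : p ≤ 1 / 3 := by
    rw [hp]; exact one_div_le_one_div_of_le (by norm_num) Real.pi_gt_three.le
  have hp4 : 1 / 4 ≤ p := by
    rw [hp]; exact one_div_le_one_div_of_le Real.pi_pos Real.pi_lt_four.le
  -- By the choice `κ² = a/(nρ²)`, the fourth-moment coefficients are again `κ` times the basic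
  -- scale `1/(nρ)`.
  have e0 : a / (κ * ρ ^ 3 * n ^ 2) = κ * i := by
    rw [hi]
    field_simp
    field_simp at hκ2
    linear_combination hκ2
  have e1 : 28 * a / (κ * ρ ^ 3 * n ^ 2) = 28 * (κ * i) := by rw [← e0]; ring
  have e2 : 4 / (κ * ρ ^ 3 * a ^ 2 * n ^ 2) = 4 * (κ * i) / a ^ 3 := by
    rw [← e0]; field_simp
  have e3 : 56 * a / (κ * ρ ^ 3 * n ^ 2) = 56 * (κ * i) := by rw [← e0]; ring
  have e4 : 8 / (κ * ρ ^ 3 * n ^ 2) = 8 * (κ * i) / a := by rw [← e0]; field_simp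
  rw [e1, e2, e3, e4, hs2, hs1, haq]
  obtain ⟨V, hV⟩ : ∃ V, V = (a ^ 2 + L ^ 2) * i := ⟨_, rfl⟩
  have hV0 : 0 < V := by rw [hV]; positivity
  obtain ⟨D, hD⟩ : ∃ D, D = (a * q + L) ^ 2 * (a / (Real.pi * ρ * n)) := ⟨_, rfl⟩
  have hD' : D = (a * q + L) ^ 2 * a * p * i := by rw [hD, hp, hi]; field_simp
  -- The factor `12` is `3 · 4`, from `(a² + L²)/3 ≤ (a/√3 + L)²` and `1/π ≥ 1/4`.
  have hVD : a * V ≤ 12 * D := by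
    have h1 : (a ^ 2 + L ^ 2) / 3 ≤ (a * q + L) ^ 2 := by
      have : (a * q + L) ^ 2 = a ^ 2 * q ^ 2 + 2 * (a * q * L) + L ^ 2 := by ring
      rw [this, hq2]
      have : 0 ≤ a * q * L := by positivity
      linarith only [this, sq_nonneg L]
    rw [hV, hD']
    calc a * ((a ^ 2 + L ^ 2) * i) = 12 * ((a ^ 2 + L ^ 2) / 3 * a * (1 / 4) * i) := by ring
      _ ≤ _ := by gcongr
  have haV : V ≤ a * V := le_mul_of_one_le_left hV0.le ha
  have han1 : a / n ≤ 1 := (div_le_one hn).2 han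
  have hn1 : 1 / n ^ 2 ≤ 1 := by
    rw [div_le_one (by positivity)]; exact one_le_pow₀ (by linarith)
  -- The two variance terms are evaluated exactly: their part free of `κ` is the main term `D`.
  have f1 : ((1 + 3 * q * L / a + κ) / (n * ρ) + 28 * (κ * i)) * (a ^ 3 / (3 * Real.pi))
      + ((1 + q * a / L + κ) * L ^ 2 / (n * ρ)
          + 56 * (κ * i) * (a ^ 2 / 2 + L ^ 2)) * (a / Real.pi)
      = D + p * i * κ * a * (29 / 3 * a ^ 2 + L ^ 2 + 28 * a ^ 2 + 56 * L ^ 2) := by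
    have h1 : D = (a ^ 2 / 3 + 2 * (a * q * L) + L ^ 2) * a * p * i := by
      rw [hD', ← mul_one_div (a ^ 2), ← hq2]; ring
    rw [h1]
    have h2 : a ^ 3 / (3 * Real.pi) = a ^ 3 / 3 * p := by rw [hp]; field_simp
    have h3 : a / Real.pi = a * p := by rw [hp]; field_simp
    have h4 : (1 + 3 * q * L / a + κ) / (n * ρ) = (1 + 3 * q * L / a + κ) * i := by rw [hi]; ring
    have h5 : (1 + q * a / L + κ) * L ^ 2 / (n * ρ) = (1 + q * a / L + κ) * L ^ 2 * i := by
      rw [hi]; ring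
    rw [h2, h3, h4, h5]
    field_simp
    ring
  have g1 : p * i * κ * a * (29 / 3 * a ^ 2 + L ^ 2 + 28 * a ^ 2 + 56 * L ^ 2) ≤ 19 * κ * (a * V) := by
    have h1 : 29 / 3 * a ^ 2 + L ^ 2 + 28 * a ^ 2 + 56 * L ^ 2 ≤ 57 * a ^ 2 + 57 * L ^ 2 := by
      linarith only [sq_nonneg a]
    calc _ ≤ 1 / 3 * i * κ * a * (57 * a ^ 2 + 57 * L ^ 2) := by gcongr
      _ = _ := by rw [hV]; ring
  have h1V : i ≤ V := by
    rw [hV]; exact le_mul_of_one_le_left hi0.le (by nlinarith only [ha, hL])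
  have hLV : L ^ 2 * i ≤ V := by rw [hV]; gcongr; linarith only [sq_nonneg a]
  have hL1V : L * i ≤ V := le_trans (by gcongr; nlinarith only [hL]) hLV
  have hLaV : L * a * i ≤ V := by rw [hV]; gcongr; nlinarith only [sq_nonneg (a - L), sq_nonneg a, sq_nonneg L]
  have ha2V : a ^ 2 * i ≤ V := by rw [hV]; gcongr; linarith only [sq_nonneg L]
  have haiV : a * i ≤ V := le_trans (by gcongr; nlinarith only [ha]) ha2V
  have f3 : ((1 + 3 * q * L / a + κ) / ρ + 4 * (κ * i) / a ^ 3) * (a / n ^ 2) ≤ 4 * V + 5 * κ * V := by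
    have h1 : ((1 + 3 * q * L / a + κ) / ρ + 4 * (κ * i) / a ^ 3) * (a / n ^ 2)
        = (1 + 3 * q * L / a + κ) * i * (a / n) + 4 * κ * i / a ^ 2 * (1 / n ^ 2) := by
      rw [hi]; field_simp
    rw [h1]
    calc _ ≤ (1 + 3 * 1 * L / 1 + κ) * i * 1 + 4 * κ * i / 1 * 1 := by
          gcongr
          exact one_le_pow₀ ha
      _ = i + 3 * (L * i) + 5 * κ * i := by ring
      _ ≤ V + 3 * V + 5 * κ * V := by gcongr
      _ = _ := by ring
  have f4 : ((1 + q * a / L + κ) * L ^ 2 / ρ + 8 * (κ * i) / a * (a ^ 2 / 2 + L ^ 2)) * (a / n ^ 2)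
      ≤ 2 * V + 9 * κ * V := by
    have h1 : ((1 + q * a / L + κ) * L ^ 2 / ρ + 8 * (κ * i) / a * (a ^ 2 / 2 + L ^ 2)) * (a / n ^ 2)
        = (L ^ 2 * i + q * (L * a * i) + κ * (L ^ 2 * i)) * (a / n)
          + 8 * κ * ((a ^ 2 / 2 + L ^ 2) * i) * (1 / n ^ 2) := by
      rw [hi]; field_simp
    rw [h1]
    calc _ ≤ (V + 1 * V + κ * V) * 1 + 8 * κ * V * 1 := by
          gcongr
          rw [hV]; gcongr; linarith only [sq_nonneg a]
      _ = _ := by ring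
  have f5 : (2 + 2 * (a ^ 2 + 2 * a * (2 * L + (a ^ 2 + L) * κ ^ 2))) / (n * ρ)
      ≤ 12 * V + 8 * κ ^ 2 * (a * V) := by
    have h1 : (2 + 2 * (a ^ 2 + 2 * a * (2 * L + (a ^ 2 + L) * κ ^ 2))) / (n * ρ)
        = 2 * i + 2 * (a ^ 2 * i) + 8 * (L * a * i) + 4 * κ ^ 2 * (a * (a ^ 2 * i))
          + 4 * κ ^ 2 * (a * (L * i)) := by rw [hi]; ring
    rw [h1]
    calc _ ≤ 2 * V + 2 * V + 8 * V + 4 * κ ^ 2 * (a * V) + 4 * κ ^ 2 * (a * V) := by gcongr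
      _ = _ := by ring
  have f6 : (4 * (5 + 8 * κ) * a ^ 3 * κ ^ 2 + (1 + 2 * κ) * a ^ 2) / (n * ρ)
      ≤ (20 + 32 * κ) * κ ^ 2 * (a * V) + (1 + 2 * κ) * V := by
    calc _ = (20 + 32 * κ) * κ ^ 2 * (a * (a ^ 2 * i)) + (1 + 2 * κ) * (a ^ 2 * i) := by rw [hi]; ring
      _ ≤ _ := by gcongr
  have f7 : 4 * (5 + 8 * κ) * a * (1 + 2 * κ ^ 2) / (n * ρ) ≤ (20 + 32 * κ) * (1 + 2 * κ ^ 2) * V := by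
    calc _ = (20 + 32 * κ) * (1 + 2 * κ ^ 2) * (a * i) := by rw [hi]; ring
      _ ≤ _ := by gcongr
  have k1 : 1 / a * (a * V) = V := by field_simp
  have k2 : κ ^ 2 ≤ κ + κ ^ 3 := by
    nlinarith only [mul_nonneg hκ.le (sq_nonneg (κ - 1)), hκ, pow_pos hκ 3]
  -- Each term is a multiple of `V = (1/a)(aV)` or of a power of `κ` times `aV`, using `V ≤ aV` and
  -- `κ² ≤ κ + κ³`. The largest resulting coefficient is `164`, at `κ³`; then `166 · 12 = 1992` is
  -- rounded up to `2000`.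
  have hall : 19 * κ * (a * V) + (4 * V + 5 * κ * V) + (2 * V + 9 * κ * V)
      + (12 * V + 8 * κ ^ 2 * (a * V)) + ((20 + 32 * κ) * κ ^ 2 * (a * V) + (1 + 2 * κ) * V)
      + (20 + 32 * κ) * (1 + 2 * κ ^ 2) * V ≤ 166 * ((1 / a + κ + κ ^ 3) * (a * V)) := by
    have m1 : κ * V ≤ κ * (a * V) := by gcongr
    have m2 : κ ^ 2 * V ≤ κ ^ 2 * (a * V) := by gcongr
    have m3 : κ ^ 3 * V ≤ κ ^ 3 * (a * V) := by gcongr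
    have m4 : κ ^ 2 * (a * V) ≤ (κ + κ ^ 3) * (a * V) := by gcongr
    have m5 : (1 / a + κ + κ ^ 3) * (a * V) = V + κ * (a * V) + κ ^ 3 * (a * V) := by
      rw [add_mul, add_mul, k1]
    have m6 : 0 ≤ κ * (a * V) := by positivity
    have m7 : 0 ≤ κ ^ 3 * (a * V) := by positivity
    rw [m5]
    nlinarith only [m1, m2, m3, m4, m6, m7, hV0]
  have hfin : 166 * ((1 / a + κ + κ ^ 3) * (a * V)) ≤ 2000 * (1 / a + κ + κ ^ 3) * D := by
    calc _ ≤ 166 * ((1 / a + κ + κ ^ 3) * (12 * D)) := by gcongr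
      _ = 1992 * ((1 / a + κ + κ ^ 3) * D) := by ring
      _ ≤ 2000 * ((1 / a + κ + κ ^ 3) * D) := by
          have : 0 < D := by
            have : 0 < a * V := by positivity
            linarith only [this, hVD]
          gcongr
          norm_num
      _ = _ := by ring
  rw [← hD, show (1 + 2000 * (1 / a + κ + κ ^ 3)) * D
    = D + 2000 * (1 / a + κ + κ ^ 3) * D by ring]
  linarith only [f1, g1, f3, f4, f5, f6, f7, hall, hfin]

end EBMeans

/-! ### Integration over `x` and the oracle inequality with explicit remainder -/

namespace EBMeans

lemma integral_le_of_le_combination {A I D f₁ f₂ f₃ f₄ f₅ f₆ f₇ : ℝ → ℝ}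
    (hA : Integrable A) (hI : Integrable I) (hD : Integrable D) (h₁ : Integrable f₁)
    (h₂ : Integrable f₂) (h₃ : Integrable f₃) (h₄ : Integrable f₄) (h₅ : Integrable f₅)
    (h₆ : Integrable f₆) (h₇ : Integrable f₇) {c₁ c₂ c₃ c₄ c₅ c₆ c₇ B₁ B₂ B₃ B₄ : ℝ}
    (k₁ : 0 ≤ c₁) (k₂ : 0 ≤ c₂) (k₃ : 0 ≤ c₃) (k₄ : 0 ≤ c₄) (k₅ : 0 ≤ c₅) (k₆ : 0 ≤ c₆)
    (k₇ : 0 ≤ c₇) (b₁ : ∫ x, f₁ x ≤ B₁) (b₂ : ∫ x, f₂ x ≤ B₂) (b₃ : ∫ x, f₃ x ≤ B₃)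
    (b₄ : ∫ x, f₄ x ≤ B₄) (b₅ : ∫ x, f₅ x ≤ 1) (b₆ : ∫ x, f₆ x ≤ 1) (b₇ : ∫ x, f₇ x ≤ 1)
    (h : ∀ x, A x ≤ -I x + D x + (c₁ * f₁ x + c₂ * f₂ x + c₃ * f₃ x + c₄ * f₄ x + c₅ * f₅ x
      + c₆ * f₆ x + c₇ * f₇ x)) :
    ∫ x, A x ≤ -(∫ x, I x) + (∫ x, D x) + (c₁ * B₁ + c₂ * B₂ + c₃ * B₃ + c₄ * B₄ + c₅ + c₆ + c₇) := by
  have j₂ := (h₁.const_mul c₁).fun_add (h₂.const_mul c₂)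
  have j₃ := j₂.fun_add (h₃.const_mul c₃)
  have j₄ := j₃.fun_add (h₄.const_mul c₄)
  have j₅ := j₄.fun_add (h₅.const_mul c₅)
  have j₆ := j₅.fun_add (h₆.const_mul c₆)
  have j₇ := j₆.fun_add (h₇.const_mul c₇)
  have j₀ := hI.fun_neg.fun_add hD
  refine (integral_mono hA (j₀.fun_add j₇) h).trans ?_
  rw [integral_add j₀ j₇, integral_add hI.fun_neg hD, integral_add j₆ (h₇.const_mul c₇),
    integral_add j₅ (h₆.const_mul c₆), integral_add j₄ (h₅.const_mul c₅),
    integral_add j₃ (h₄.const_mul c₄), integral_add j₂ (h₃.const_mul c₃),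
    integral_add (h₁.const_mul c₁) (h₂.const_mul c₂), integral_neg]
  simp only [integral_const_mul]
  linarith only [mul_le_mul_of_nonneg_left b₁ k₁, mul_le_mul_of_nonneg_left b₂ k₂,
    mul_le_mul_of_nonneg_left b₃ k₃, mul_le_mul_of_nonneg_left b₄ k₄,
    mul_le_mul_of_nonneg_left b₅ k₅, mul_le_mul_of_nonneg_left b₆ k₆,
    mul_le_mul_of_nonneg_left b₇ k₇]

section

variable {Ω : Type*} [MeasurableSpace Ω] {P : Measure Ω} [IsProbabilityMeasure P] {n : ℕ}

/-- Integrating over `x` first removes the law of `X k` by translation invariance. The squared L²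
norm of `F` appears without loss, which preserves the leading constant. -/
lemma integral_avg_sq_le (hn : 0 < n) {X : Fin n → Ω → ℝ} (hX : ∀ k, Measurable (X k)) {F : ℝ → ℝ}
    (hF : Continuous F) {B : ℝ} (hi : Integrable fun x => F x ^ 2) (hB : ∫ x, F x ^ 2 ≤ B) :
    Integrable (fun x => (1 / (n : ℝ)) * ∑ k, ∫ ω, F (x - X k ω) ^ 2 ∂P) ∧
    ∫ x, (1 / (n : ℝ)) * ∑ k, ∫ ω, F (x - X k ω) ^ 2 ∂P ≤ B := by
  have hn' : (0 : ℝ) < n := by exact_mod_cast hn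
  have h : ∀ k, Integrable (fun x => ∫ ω, F (x - X k ω) ^ 2 ∂P) ∧
      ∫ x, ∫ ω, F (x - X k ω) ^ 2 ∂P = ∫ x, F x ^ 2 := by
    intro k
    have := Measure.isProbabilityMeasure_map (μ := P) (hX k).aemeasurable
    have e : ∀ x, ∫ ω, F (x - X k ω) ^ 2 ∂P = ∫ u, F (x - u) ^ 2 ∂(P.map (X k)) := fun x =>
      (integral_map (hX k).aemeasurable
        (Continuous.aestronglyMeasurable (f := fun u => F (x - u) ^ 2) (by fun_prop))).symm
    simp only [e]
    exact integral_conv (h := fun z => F z ^ 2) (by fun_prop) hi (P.map (X k))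
  refine ⟨(integrable_finsetSum _ fun k _ => (h k).1).const_mul _, ?_⟩
  rw [integral_const_mul, integral_finsetSum _ fun k _ => (h k).1]
  simp only [fun k => (h k).2, Finset.sum_const, Finset.card_univ, Fintype.card_fin, nsmul_eq_mul]
  rw [← mul_assoc, one_div_mul_cancel hn'.ne', one_mul]
  exact hB

lemma avg_le (hn : 0 < n) {m : Fin n → ℝ} {B : ℝ} (h : ∀ k, m k ≤ B) :
    (1 / (n : ℝ)) * ∑ k, m k ≤ B := by
  have hn' : (0 : ℝ) < n := by exact_mod_cast hn
  calc (1 / (n : ℝ)) * ∑ k, m k ≤ 1 / n * (n * B) := by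
        gcongr
        refine (Finset.sum_le_card_nsmul Finset.univ _ B fun i _ => h i).trans ?_
        simp
    _ = B := by field_simp

lemma integrable_kernelDens_sq {a : ℝ} (ha : 0 ≤ a) :
    Integrable (fun y => kernelDens a y ^ 2) ∧ ∫ y, kernelDens a y ^ 2 ≤ a / Real.pi :=
  integrable_sq_of_lintegral_le (continuous_kernelDens a) (by positivity)
    (lintegral_kernelDens_sq_le ha)

lemma integrable_kernelDeriv_sq {a : ℝ} (ha : 0 ≤ a) :
    Integrable (fun y => kernelDeriv a y ^ 2) ∧ ∫ y, kernelDeriv a y ^ 2 ≤ a ^ 3 / (3 * Real.pi) :=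
  integrable_sq_of_lintegral_le (continuous_kernelDeriv a) (by positivity)
    (lintegral_kernelDeriv_sq_le ha)

variable {θ X : Fin n → Ω → ℝ}

/-- A bound at each fixed `x`, valid because the density of an observation is at most one. It
supplies the uniform second moments needed for the fourth-moment estimates and the leave-one-out
correction. -/
lemma IsNormalMeansModel.integral_obs_sub_sq_le (h : IsNormalMeansModel θ X P)
    (hi : iIndepFun θ P) (k : Fin n) {F : ℝ → ℝ} (hF : Continuous F) {C B : ℝ}
    (hC : ∀ x, |F x| ≤ C) (hFi : Integrable fun x => F x ^ 2) (hB : ∫ x, F x ^ 2 ≤ B) (x : ℝ) :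
    ∫ ω, F (x - X k ω) ^ 2 ∂P ≤ B := by
  refine (h.integral_obs_le hi k (F := fun y => F (x - y) ^ 2) (C := C ^ 2)
    (Continuous.measurable (by fun_prop))
    (fun y => by rw [abs_pow]; exact pow_le_pow_left₀ (abs_nonneg _) (hC _) 2)
    (fun y => sq_nonneg _) (hFi.comp_sub_left x)).trans ?_
  rwa [integral_sub_left_eq_self (fun y => F y ^ 2) volume x]

/-- Pointwise bound for the integrand of the average risk given by Stein's identity. -/
lemma IsNormalMeansModel.avg_risk_integrand_le (h : IsNormalMeansModel θ X P)
    (hi : iIndepFun θ P) (hn : 0 < n) {ρ a L κ s : ℝ} (hab : bandwidth n = a) (ha : 1 ≤ a)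
    (han : a ≤ n) (hexp : Real.exp (-a ^ 2 / 2) = 1 / n) (hρ : 0 < ρ)
    (hρ1 : ρ < 1 / √(2 * Real.pi)) (hL : L = √(-Real.log (ρ ^ 2))) (hκ : 0 < κ) (hs : 0 < s)
    (hκ1 : a / (n * ρ) ≤ κ) (hκ2 : a / (n * ρ ^ 2) = κ ^ 2) (x : ℝ) :
    (1 / (n : ℝ)) * ∑ k,
      ((∫ ω, looScore ρ k x (fun j => X j ω) ^ 2 ∂P) * mixDensity (P.map (θ k)) x
        - 2 * (∫ ω, looScore ρ k x (fun j => X j ω) ∂P) * mixDeriv (P.map (θ k)) x)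
      ≤ -(mixDeriv (mixture θ P) x ^ 2 / mixDensity (mixture θ P) x)
        + (mixDeriv (mixture θ P) x / mixDensity (mixture θ P) x) ^ 2
          * (1 - mixDensity (mixture θ P) x / max (mixDensity (mixture θ P) x) ρ) ^ 2
          * mixDensity (mixture θ P) x
        + (((1 + s + κ) / (n * ρ) + 28 * a / (κ * ρ ^ 3 * n ^ 2))
            * ((1 / (n : ℝ)) * ∑ k, ∫ ω, kernelDeriv a (x - X k ω) ^ 2 ∂P)
          + ((1 + s + κ) / ρ + 4 / (κ * ρ ^ 3 * a ^ 2 * n ^ 2))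
            * (∫ u, biasDeriv a (x - u) ∂(mixture θ P)) ^ 2
          + ((1 + 1 / s + κ) * L ^ 2 / (n * ρ)
              + 56 * a / (κ * ρ ^ 3 * n ^ 2) * (a ^ 2 / 2 + L ^ 2))
            * ((1 / (n : ℝ)) * ∑ k, ∫ ω, kernelDens a (x - X k ω) ^ 2 ∂P)
          + ((1 + 1 / s + κ) * L ^ 2 / ρ + 8 / (κ * ρ ^ 3 * n ^ 2) * (a ^ 2 / 2 + L ^ 2))
            * (∫ u, biasDens a (x - u) ∂(mixture θ P)) ^ 2
          + (2 + 2 * (a ^ 2 + 2 * a * (2 * L + (a ^ 2 + L) * κ ^ 2))) / (n * ρ)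
            * ((1 / (n : ℝ)) * ∑ k, |mixDeriv (P.map (θ k)) x|)
          + (4 * (5 + 8 * κ) * a ^ 3 * κ ^ 2 + (1 + 2 * κ) * a ^ 2) / (n * ρ)
            * mixDensity (mixture θ P) x
          + 4 * (5 + 8 * κ) * a * (1 + 2 * κ ^ 2) / (n * ρ)
            * (mixDeriv (mixture θ P) x ^ 2 / mixDensity (mixture θ P) x)) := by
  have hX := h.measurable_obs
  have := h.isProbabilityMeasure_map
  have := h.isProbabilityMeasure_mixture hn
  have ha0 : 0 ≤ a := by linarith
  have hK := (continuous_kernelDens a).measurable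
  have hK₁ := (continuous_kernelDeriv a).measurable
  have hπ : (1 : ℝ) ≤ Real.pi := by linarith [Real.pi_gt_three]
  have hB : ∀ u, |biasDens a (x - u)| ≤ 1 / n := fun u => hexp ▸ abs_biasDens_le ha _
  have hB₁ : ∀ u, |biasDeriv a (x - u)| ≤ 1 / n := fun u => hexp ▸ abs_biasDeriv_le ha _
  have hBm : Measurable fun u => biasDens a (x - u) :=
    ((continuous_biasDens a).comp (by fun_prop)).measurable
  have hBm₁ : Measurable fun u => biasDeriv a (x - u) :=
    ((continuous_biasDeriv a).comp (by fun_prop)).measurable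
  have hf : mixDensity (mixture θ P) x = (1 / (n : ℝ)) * ∑ k, mixDensity (P.map (θ k)) x :=
    integral_mixture fun k => integrable_mixDensity_integrand (P.map (θ k)) x
  have hf₁ : mixDeriv (mixture θ P) x = (1 / (n : ℝ)) * ∑ k, mixDeriv (P.map (θ k)) x :=
    integral_mixture fun k => (integrable_mixDeriv_integrand (P.map (θ k)) x).fun_neg
  have hm : (1 / (n : ℝ)) * ∑ k, ∫ ω, kernelDens a (x - X k ω) ∂P
      = mixDensity (mixture θ P) x + ∫ u, biasDens a (x - u) ∂(mixture θ P) := by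
    rw [hf, integral_mixture fun k => integrable_of_abs_le hBm hB, ← mul_add,
      ← Finset.sum_add_distrib]
    simp only [h.integral_kernelDens hi _ ha]
  have hm₁ : (1 / (n : ℝ)) * ∑ k, ∫ ω, kernelDeriv a (x - X k ω) ∂P
      = mixDeriv (mixture θ P) x + ∫ u, biasDeriv a (x - u) ∂(mixture θ P) := by
    rw [hf₁, integral_mixture fun k => integrable_of_abs_le hBm₁ hB₁, ← mul_add,
      ← Finset.sum_add_distrib]
    simp only [h.integral_kernelDeriv hi _ ha]
  have habs : ∀ {F : ℝ → ℝ}, (∀ u, |F u| ≤ 1 / n) → |∫ u, F u ∂(mixture θ P)| ≤ 1 / n := by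
    intro F hF
    have := norm_integral_le_of_norm_le_const (μ := mixture θ P) (f := F) (C := 1 / n)
      (ae_of_all _ fun u => hF u)
    simpa using this
  have hL1 : 1 ≤ L := by
    rw [hL]; exact Real.one_le_sqrt.2 (neg_log_sq_gt_one hρ hρ1).le
  obtain ⟨d1, d2⟩ := integrable_kernelDens_sq ha0
  obtain ⟨d1', d2'⟩ := integrable_kernelDeriv_sq ha0
  -- The value `z₀ = kernelDens a 0` is what the `k`-th observation would contribute if it were at
  -- `x`, matching `looScore`.
  have key := risk_integrand_avg_le (P := P) hn (Z := fun k ω => kernelDens a (x - X k ω))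
    (Z₁ := fun k ω => kernelDeriv a (x - X k ω)) (fun k => hK.comp (by fun_prop))
    (fun k => hK₁.comp (by fun_prop))
    ((h.iIndepFun_obs hi).comp (fun _ y => kernelDens a (x - y)) fun _ => hK.comp (by fun_prop))
    ((h.iIndepFun_obs hi).comp (fun _ y => kernelDeriv a (x - y)) fun _ => hK₁.comp (by fun_prop))
    (z₀ := kernelDens a 0) ha han (fun k ω => abs_kernelDens_le ha0 _) (abs_kernelDens_le ha0 _)
    (fun k ω => abs_kernelDeriv_le ha0 _)
    (fun k => (h.integral_obs_sub_sq_le hi k (continuous_kernelDeriv a)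
      (abs_kernelDeriv_le ha0) d1' d2' x).trans (div_le_self (by positivity) (by linarith)))
    (p := fun k => mixDensity (P.map (θ k)) x) (q := fun k => mixDeriv (P.map (θ k)) x)
    (fun k => (mixDensity_pos (P.map (θ k)) x).le) hf hf₁ rfl (mixDensity_pos _ x) hm hm₁ rfl rfl
    (avg_le hn fun k => (h.integral_obs_sub_sq_le hi k (continuous_kernelDens a)
      (abs_kernelDens_le ha0) d1 d2 x).trans (div_le_self (by positivity) hπ))
    (habs hB) (habs hB₁) hρ hL1 (hL ▸ abs_mixDeriv_le (mixture θ P) hρ hρ1 x) hκ hs hκ1 hκ2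
  simp only [looScore, hab]
  exact key

/-- The average risk of the general empirical Bayes estimator, with explicit remainder. -/
lemma IsNormalMeansModel.avg_risk_le (h : IsNormalMeansModel θ X P)
    (hi : iIndepFun θ P) (hn : 0 < n) {ρ a L κ : ℝ} (hab : bandwidth n = a) (ha : 1 ≤ a)
    (han : a ≤ n) (hexp : Real.exp (-a ^ 2 / 2) = 1 / n) (hρ : 0 < ρ)
    (hρ1 : ρ < 1 / √(2 * Real.pi)) (hL : L = √(-Real.log (ρ ^ 2))) (hκ : 0 < κ)
    (hκ1 : a / (n * ρ) ≤ κ) (hκ2 : a / (n * ρ ^ 2) = κ ^ 2) :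
    (1 / (n : ℝ)) * ∑ k, ∫ ω, (gebRule ρ (fun j => X j ω) (X k ω) - θ k ω) ^ 2 ∂P
        - (optRisk (mixture θ P)).toReal
      ≤ Delta ρ (mixture θ P)
        + (1 + 2000 * (1 / a + κ + κ ^ 3)) * ((a / √3 + L) ^ 2 * (a / (Real.pi * ρ * n))) := by
  have hX := h.measurable_obs
  have := h.isProbabilityMeasure_map
  have := h.isProbabilityMeasure_mixture hn
  have ha0 : 0 ≤ a := by linarith
  have hn' : (0 : ℝ) < n := by exact_mod_cast hn
  have hL1 : 1 ≤ L := by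
    rw [hL]; exact Real.one_le_sqrt.2 (neg_log_sq_gt_one hρ hρ1).le
  obtain ⟨s, hs⟩ : ∃ s, s = √3 * L / a := ⟨_, rfl⟩
  have hs0 : 0 < s := by rw [hs]; positivity
  have hexp2 : Real.exp (-a ^ 2) = 1 / n ^ 2 := by
    have : Real.exp (-a ^ 2) = Real.exp (-a ^ 2 / 2) ^ 2 := by
      rw [← Real.exp_nat_mul]; congr 1; push_cast; ring
    rw [this, hexp, div_pow, one_pow]
  have pt := h.avg_risk_integrand_le hi hn hab ha han hexp hρ hρ1 hL hκ hs0 hκ1 hκ2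
  have num := error_terms_le ha han hρ hL1 hκ hκ2 hs
  obtain ⟨d1, d2⟩ := integrable_kernelDens_sq ha0
  obtain ⟨d1', d2'⟩ := integrable_kernelDeriv_sq ha0
  obtain ⟨v1, v2⟩ := integral_avg_sq_le (P := P) hn hX (continuous_kernelDens a) d1 d2
  obtain ⟨v1', v2'⟩ := integral_avg_sq_le (P := P) hn hX (continuous_kernelDeriv a) d1' d2'
  have hB0 : 0 ≤ a * Real.exp (-a ^ 2) := by positivity
  obtain ⟨b1, b2⟩ := integrable_sq_of_lintegral_le (continuous_biasDens a) hB0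
    (lintegral_biasDens_sq_le ha)
  obtain ⟨b1', b2'⟩ := integrable_sq_of_lintegral_le (continuous_biasDeriv a) hB0
    (lintegral_biasDeriv_sq_le ha)
  have hB1 : a * Real.exp (-a ^ 2) = a / n ^ 2 := by rw [hexp2]; ring
  rw [hB1] at b2 b2'
  obtain ⟨c1, c2⟩ := integral_sq_conv_le (continuous_biasDens a) (abs_biasDens_le ha) b1 b2
    (mixture θ P)
  obtain ⟨c1', c2'⟩ := integral_sq_conv_le (continuous_biasDeriv a) (abs_biasDeriv_le ha) b1' b2'
    (mixture θ P)
  obtain ⟨m1, m2⟩ := integral_mixDensity (mixture θ P)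
  obtain ⟨i1, i2⟩ := integral_fisher (mixture θ P)
  have hopt := one_sub_fisher_le_optRisk (mixture θ P)
  have hd : ∀ k, Integrable (fun x => |mixDeriv (P.map (θ k)) x|) ∧
      ∫ x, |mixDeriv (P.map (θ k)) x| ≤ 1 := fun k =>
    ⟨(integral_abs_mixDeriv_le (P.map (θ k))).1.abs, (integral_abs_mixDeriv_le (P.map (θ k))).2⟩
  have F1 : Integrable (fun x => (1 / (n : ℝ)) * ∑ k, |mixDeriv (P.map (θ k)) x|) :=
    (integrable_finsetSum _ fun k _ => (hd k).1).const_mul _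
  have F2 : ∫ x, (1 / (n : ℝ)) * ∑ k, |mixDeriv (P.map (θ k)) x| ≤ 1 := by
    rw [integral_const_mul, integral_finsetSum _ fun k _ => (hd k).1]
    exact avg_le hn fun k => (hd k).2
  have hDelta : Delta ρ (mixture θ P)
      = ∫ x, (mixDeriv (mixture θ P) x / mixDensity (mixture θ P) x) ^ 2
        * (1 - mixDensity (mixture θ P) x / max (mixDensity (mixture θ P) x) ρ) ^ 2
        * mixDensity (mixture θ P) x := by
    simp only [Delta, fun x => (hasDerivAt_mixDensity (mixture θ P) x).deriv]
  have D1 : Integrable fun x => (mixDeriv (mixture θ P) x / mixDensity (mixture θ P) x) ^ 2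
        * (1 - mixDensity (mixture θ P) x / max (mixDensity (mixture θ P) x) ρ) ^ 2
        * mixDensity (mixture θ P) x := by
    have h1 := (continuous_mixDensity (mixture θ P)).measurable
    have h2 := (continuous_mixDeriv (mixture θ P)).measurable
    refine i1.mono' (Measurable.aestronglyMeasurable (by fun_prop)) (ae_of_all _ fun x => ?_)
    have hf := mixDensity_pos (mixture θ P) x
    have hM : 0 < max (mixDensity (mixture θ P) x) ρ := lt_max_of_lt_left hf
    have h3 : mixDensity (mixture θ P) x / max (mixDensity (mixture θ P) x) ρ ≤ 1 :=
      (div_le_one hM).2 (le_max_left _ _)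
    have h4 : 0 ≤ mixDensity (mixture θ P) x / max (mixDensity (mixture θ P) x) ρ := by positivity
    rw [Real.norm_of_nonneg (by positivity)]
    calc _ ≤ (mixDeriv (mixture θ P) x / mixDensity (mixture θ P) x) ^ 2 * 1
          * mixDensity (mixture θ P) x := by
          gcongr
          exact pow_le_one₀ (by linarith) (by linarith)
      _ = _ := by field_simp
  have hr := fun k => h.risk_gebRule hi hρ k
  have R1 := (integrable_finsetSum Finset.univ fun k _ => (hr k).2.1).const_mul (1 / (n : ℝ))
  have R2 : (1 / (n : ℝ)) * ∑ k, ∫ ω, (gebRule ρ (fun j => X j ω) (X k ω) - θ k ω) ^ 2 ∂P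
      = 1 + ∫ x, (1 / (n : ℝ)) * ∑ k,
      ((∫ ω, looScore ρ k x (fun j => X j ω) ^ 2 ∂P) * mixDensity (P.map (θ k)) x
        - 2 * (∫ ω, looScore ρ k x (fun j => X j ω) ∂P) * mixDeriv (P.map (θ k)) x) := by
    rw [integral_const_mul, integral_finsetSum _ fun k _ => (hr k).2.1]
    simp only [fun k => (hr k).2.2, Finset.sum_add_distrib, Finset.sum_const, Finset.card_univ,
      Fintype.card_fin, nsmul_eq_mul, mul_one, mul_add]
    rw [one_div_mul_cancel hn'.ne']
  -- The Fisher information enters twice: with coefficient `-1`, to cancel the lower bound for the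
  -- Bayes risk, and as the seventh remainder term, where only its bound by one is used.
  have key := integral_le_of_le_combination R1 i1 D1 v1' c1' v1 c1 F1 m1 i1 (by positivity)
    (by positivity) (by positivity) (by positivity) (by positivity) (by positivity) (by positivity)
    v2' c2' v2 c2 F2 m2.le i2 pt
  rw [R2, hDelta]
  linarith only [key, num, hopt]

end

end EBMeans

/-! ### The relative error and the theorem -/

namespace EBMeans

/-- The relative error in the oracle inequality. -/
noncomputable def oracleError (n : ℕ) (ρ : ℝ) : ℝ :=
  2000 * (1 / bandwidth n + √(bandwidth n / n) / ρ + (√(bandwidth n / n) / ρ) ^ 3)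

/-- The quantity `κ` is a fixed multiple of the one assumed to vanish, because `√a = 2^{1/4} (log
n)^{1/4}`. -/
lemma sqrt_bandwidth_div (n : ℕ) (ρ : ℝ) :
    √(bandwidth n / n) / ρ = √√2 * (ρ⁻¹ * (Real.log n) ^ (1 / 4 : ℝ) / √(n : ℝ)) := by
  have hl : 0 ≤ Real.log n := Real.log_natCast_nonneg n
  have h : (Real.log n) ^ (1 / 4 : ℝ) = √√(Real.log n) := by
    rw [Real.sqrt_eq_rpow, Real.sqrt_eq_rpow, ← Real.rpow_mul hl]
    norm_num
  rw [h, bandwidth, Real.sqrt_div (Real.sqrt_nonneg _), Real.sqrt_mul (by norm_num),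
    Real.sqrt_mul (Real.sqrt_nonneg _)]
  ring

lemma tendsto_oracleError {ρ : ℕ → ℝ}
    (h : Tendsto (fun n : ℕ => (ρ n)⁻¹ * (Real.log n) ^ (1 / 4 : ℝ) / √(n : ℝ)) atTop (𝓝 0)) :
    Tendsto (fun n : ℕ => oracleError n (ρ n)) atTop (𝓝 0) := by
  have h1 : Tendsto (fun n : ℕ => bandwidth n) atTop atTop :=
    Real.tendsto_sqrt_atTop.comp
      ((Real.tendsto_log_atTop.comp tendsto_natCast_atTop_atTop).const_mul_atTop two_pos)
  have h2 : Tendsto (fun n : ℕ => √(bandwidth n / n) / ρ n) atTop (𝓝 0) := by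
    simp only [sqrt_bandwidth_div]
    simpa using h.const_mul (√√2)
  have h3 : Tendsto (fun n : ℕ => 1 / bandwidth n) atTop (𝓝 0) :=
    tendsto_const_nhds.div_atTop h1
  have := ((h3.add h2).add (h2.pow 3)).const_mul 2000
  simpa [oracleError] using this

end EBMeans

theorem theorem6p1 :
    ∃ η : ℕ → ℝ → ℝ,
      -- `η(n, ρ) = o(1)` in the regime `ρ → 0+`, `ρ⁻¹ (log n)^{1/4} / √n = o(1)`
      (∀ ρ : ℕ → ℝ, Tendsto ρ atTop (𝓝[>] 0) →
        Tendsto (fun n : ℕ => (ρ n)⁻¹ * (Real.log n) ^ (1 / 4 : ℝ) / √(n : ℝ)) atTop (𝓝 0) →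
        Tendsto (fun n : ℕ => η n (ρ n)) atTop (𝓝 0)) ∧
      -- the oracle inequality
      ∀ (n : ℕ) (ρ : ℝ), 1 ≤ n → 1 / (n : ℝ) ≤ ρ → ρ < 1 / √(2 * Real.pi) →
        ∀ (Ω : Type*) [MeasurableSpace Ω] (P : Measure Ω) [IsProbabilityMeasure P]
          (θ X : Fin n → Ω → ℝ),
          EBMeans.IsNormalMeansModel θ X P → iIndepFun θ P →
          (∀ k, Integrable (fun ω => (EBMeans.gebRule ρ (fun j => X j ω) (X k ω) - θ k ω) ^ 2) P) ∧
          (1 / (n : ℝ)) * ∑ k, ∫ ω, (EBMeans.gebRule ρ (fun j => X j ω) (X k ω) - θ k ω) ^ 2 ∂P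
              - (EBMeans.optRisk (EBMeans.mixture θ P)).toReal
            ≤ EBMeans.Delta ρ (EBMeans.mixture θ P) + (1 + η n ρ) * EBMeans.DeltaStar n ρ := by
  refine ⟨EBMeans.oracleError, fun ρ _ h => EBMeans.tendsto_oracleError h, ?_⟩
  intro n ρ hn hnρ hρ1 Ω _ P _ θ X h hi
  have hn0 : (0 : ℝ) < n := by exact_mod_cast hn
  have hρ : 0 < ρ := lt_of_lt_of_le (by positivity) hnρ
  refine ⟨fun k => (h.risk_gebRule hi hρ k).1, ?_⟩
  -- The constraint `1/n ≤ ρ < 1/√(2π) < 1` excludes `n = 1`; then `2 log n ≥ 2 log 2 > 1` gives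
  -- bandwidth at least one, as the tail estimates require.
  have hn2 : (2 : ℝ) ≤ n := by
    have h1 : (1 : ℝ) < √(2 * Real.pi) := by
      rw [Real.lt_sqrt zero_le_one]; nlinarith [Real.pi_gt_three]
    have h2 : 1 / (n : ℝ) < 1 := hnρ.trans_lt (hρ1.trans ((div_lt_one (by linarith)).2 h1))
    have h3 : (1 : ℝ) < n := (div_lt_one hn0).1 h2
    exact_mod_cast h3
  have hlog0 : 0 ≤ Real.log n := Real.log_natCast_nonneg n
  have hlog : 1 / 2 ≤ Real.log n := by
    have := Real.log_two_gt_d9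
    have := Real.log_le_log two_pos hn2
    linarith
  have ha2 : EBMeans.bandwidth n ^ 2 = 2 * Real.log n := Real.sq_sqrt (by positivity)
  have ha : 1 ≤ EBMeans.bandwidth n := Real.one_le_sqrt.2 (by linarith)
  have han : EBMeans.bandwidth n ≤ n := by
    refine Real.sqrt_le_iff.2 ⟨hn0.le, ?_⟩
    nlinarith [Real.log_le_sub_one_of_pos hn0]
  -- This identity is the reason for `a_n = √(2 log n)`: the frequencies cut off carry a bias of
  -- order `1/n`.
  have hexp : Real.exp (-EBMeans.bandwidth n ^ 2 / 2) = 1 / n := by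
    rw [ha2, neg_div, mul_div_cancel_left₀ _ two_ne_zero, Real.exp_neg, Real.exp_log hn0, one_div]
  have hd0 : 0 < EBMeans.bandwidth n / n := by positivity
  have hd1 : EBMeans.bandwidth n / n ≤ 1 := (div_le_one hn0).2 han
  -- With `κ = √(a/n)/ρ`, this is `y ≤ √y` for `y = a/n ≤ 1`.
  have hκ1 : EBMeans.bandwidth n / (n * ρ) ≤ √(EBMeans.bandwidth n / n) / ρ := by
    rw [← div_div]
    gcongr
    exact Real.le_sqrt_of_sq_le (by nlinarith)
  have hκ2 : EBMeans.bandwidth n / (n * ρ ^ 2) = (√(EBMeans.bandwidth n / n) / ρ) ^ 2 := by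
    rw [div_pow, Real.sq_sqrt hd0.le, div_div]
  have key := h.avg_risk_le hi hn rfl ha han hexp hρ hρ1 rfl (by positivity) hκ1 hκ2
  have hΔ : EBMeans.DeltaStar n ρ = (EBMeans.bandwidth n / √3 + √(-Real.log (ρ ^ 2))) ^ 2
      * (EBMeans.bandwidth n / (Real.pi * ρ * n)) := by
    rw [EBMeans.DeltaStar, EBMeans.bandwidth, ← Real.sqrt_div (by positivity), mul_div_right_comm]
  rw [hΔ]
  exact key
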